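/- \textbf{Setting.} Let $A\subset\mathbb{Z}^n_{\ge 0}$ be a non-empty finite set and $N=\mathrm{conv}(A)+\mathbb{R}^n_{\ge 0}$ the corresponding Newton polyhedron. Let $I\subset\{1,\dots,n\}$, $\bar I=\{1,\dots,n\}\setminus I$, let $\pi_I:\mathbb{R}^n\to\mathbb{R}^{\bar I}$ be the coordinate projection along $\mathbb{R}^I$, $N^I=\pi_I(N)$, and for $a\in\mathbb{R}^{\bar I}$ let $N_a\subset\mathbb{R}^I$ be the fiber $N\cap\pi_I^{-1}(a)$, projected to $\mathbb{R}^I$. Lattice volume in a $k$-dimensional rational affine space is normalized so that a fundamental parallelepiped of the lattice of parallel integer vectors has volume $k!$. A face $F$ of $N$ or of $N^I$ is a \emph{$V$-face} if it lies in a coordinate subspace $\mathbb{R}^J$ with $|J|=\dim F+1$; then $m_F$ is the lattice distance from $0$ to the affine span of $F$ in $\mathbb{R}^J$. For a bounded face $B$ of $N^I$ the fiber polyhedron $\int_B N\subset\mathbb{R}^I$ is the set of projections to $\mathbb{R}^I$ of the points $(1+\dim B)\int_B s(x)\,dx$ over all continuous sections $s:B\to N$ of $\pi_I$, where $dx$ is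 the lattice volume form. The \emph{group of virtual polyhedra} is the Grothendieck group of the Minkowski semigroup of polyhedra of the form (bounded rational polytope)$\,+\,\mathbb{R}^I_{\ge 0}$; a virtual polyhedron is \emph{trivial} if it equals $\mathbb{R}^I_{\ge0}$ up to a shift. For an integer $m\ge 1$ put $$\Psi_{m,I}=\sum_B(-1)^{\dim B}\int_B N,$$ the sum over all bounded $V$-faces $B$ of $N^I$ with $m\mid m_B$. Let $c_i=\min_{a\in A}a_i$. The number $m$ is a \emph{non-tautological denominator} for $N$ if $m\ne 1$ and $m\nmid c_i$ for every $i$ with $c_i\neq 0$ (equivalently, $m$ divides no multiplicity in the prime factorization of a non-degenerate germ $f$, $f(0)=0$, with Newton polyhedron $N$). A \emph{$V_I$-face} of $N$ is a $V$-face $\Gamma$ (not necessarily bounded) such that $I$ is the smallest set with bounded projection of $\Gamma$ along $\mathbb{R}^I$. For such $\Gamma$ let $[\Gamma]^d$ be its $d$-th dual fan: the weighted fan of those covectors on the direction space of $\Gamma$ whose support face in $\Gamma$ is bounded and $d$-dimensional, the weight being the lattice volume of this face; let $\langle\Gamma\rangle=\sum_d(-1)^{d-1}[\Gamma]^d$,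 and let $\pi_*$ be the direct image of weighted fans (with lattice indices) under the restriction of covectors to $\mathbb{R}^I$. The number $s=\exp(2\pi i k/m)$, for coprime $k$ and $m$ with $m$ a non-tautological denominator, is a \emph{tropical nearby monodromy eigenvalue (t.n.e.) of $N$ in codimension 1} at the coordinate plane $(\mathbb{C}\setminus0)^I$ if the codimension $1$ component of $\sum_\Gamma\pi_*\langle\Gamma\rangle$ is non-zero as a weighted fan in the open cone of positive covectors, where $\Gamma$ runs over all $V_I$-faces of $N$ with $m\mid m_\Gamma$. \textbf{Theorem.} Assume that $|\bar I|=2$, that $0\notin N^I$, and that $m\ge 1$ divides none of the non-zero numbers $c_i$, $i\in\bar I$ (which is the case for every non-tautological denominator $m$). Then: I. All the fiber polyhedra in the sum $\Psi_{m,I}$ are polyhedra of the form (bounded rational polytope)$\,+\,\mathbb{R}^I_{\ge0}$, and the virtual polyhedron $-\Psi_{m,I}$ (the Minkowski sum of the terms over edges minus that of the terms over vertices) is an actual polyhedron of this form. II. The virtual polyhedron $\Psi_{m,I}$ (equivalently, $-\Psi_{m,I}$) is non-trivial if and only if there exists a lattice point $a\in\mathbb{Z}^{\bar I}$ such that 1)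 $a$ is contained in a bounded edge $B$ of $N^I$ with $m\mid m_B$; 2) $a$ is not a $V$-vertex of $N^I$, or is a $V$-vertex with $m\nmid m_a$; 3) the polyhedron $N_a$ has a bounded edge. Moreover, if $m$ is a non-tautological denominator for $N$ and $k$ is coprime to $m$, then the existence of such a point $a$ is also equivalent to $s=\exp(2\pi i k/m)$ being a t.n.e. of $N$ in codimension 1 at $(\mathbb{C}\setminus0)^I$. -/

import Mathlib

open scoped Pointwise

/-! ### Faces, dimension and lattice geometry in `ℝ^ι` with its standard lattice `ℤ^ι` -/

section Lattice

variable {ι : Type} [Fintype ι]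

/-- The support face of `P` in the direction of the covector `v`: the points of `P` at which `v`
takes its minimal value on `P`. -/
def supportFace (P : Set (ι → ℝ)) (v : ι → ℝ) : Set (ι → ℝ) :=
  {x | x ∈ P ∧ ∀ y ∈ P, v ⬝ᵥ x ≤ v ⬝ᵥ y}

/-- Non-empty faces of a polyhedron. -/
def IsFace (P F : Set (ι → ℝ)) : Prop :=
  F.Nonempty ∧ ∃ v : ι → ℝ, F = supportFace P v

/-- The dimension of (the affine span of) a set. -/
noncomputable def dimOf (S : Set (ι → ℝ)) : ℕ :=
  Module.finrank ℝ (vectorSpan ℝ S)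

/-- Bounded one-dimensional faces. -/
def IsBoundedEdge (P F : Set (ι → ℝ)) : Prop :=
  IsFace P F ∧ Bornology.IsBounded F ∧ dimOf F = 1

/-- A polyhedron has a bounded edge. -/
def HasBoundedEdge (P : Set (ι → ℝ)) : Prop :=
  ∃ F, IsBoundedEdge P F

/-- A `V`-face is a face lying in a coordinate subspace of dimension one more than its own. -/
def IsVFace (P F : Set (ι → ℝ)) : Prop :=
  IsFace P F ∧ ∃ J : Finset ι, J.card = dimOf F + 1 ∧ ∀ x ∈ F, ∀ i ∉ J, x i = 0

/-- The lattice distance `m_F` from `0` to a `V`-face `F ⊆ ℝ^J`, `|J| = dim F + 1`: the value on `F`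
of the primitive integer covector on `ℝ^J` which is constant on `F`. (If the affine span of `F`
does not contain `0`, then `J` is exactly the set of the coordinates which do not vanish
identically on `F`, and the set below has exactly one element. If the affine span of `F` contains
`0`, then the value is `0`.) -/
noncomputable def latticeDist (F : Set (ι → ℝ)) : ℕ :=
  sInf {d : ℕ | ∃ l : ι → ℤ, Finset.univ.gcd l = 1 ∧
    (∀ i, (∀ x ∈ F, x i = 0) → l i = 0) ∧ ∀ x ∈ F, ∑ i, (l i : ℝ) * x i = d}

/-- The family `b` is a basis of the lattice `V ∩ ℤ^ι`. -/
def IsLatticeBasis (V : Submodule ℝ (ι → ℝ)) {k : ℕ} (b : Fin k → ι → ℤ) : Prop :=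
  (∀ j, (fun i => (b j i : ℝ)) ∈ V) ∧
    ∀ z : ι → ℤ, (fun i => (z i : ℝ)) ∈ V → ∃! c : Fin k → ℤ, z = ∑ j, c j • b j

/-- A point `q.1` of `S` with a basis `q.2` of the lattice of integer vectors parallel to `S`. -/
def IsLatticeFrame (S : Set (ι → ℝ)) (q : (ι → ℝ) × (Fin (dimOf S) → ι → ℤ)) : Prop :=
  q.1 ∈ S ∧ IsLatticeBasis (vectorSpan ℝ S) q.2

open Classical in
/-- The lattice volume form on the affine span of `S` (for non-empty `S` with rational affine span),
as a measure on `ℝ^ι`: it is translation invariant on the affine span, and the fundamental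
parallelepiped of the lattice of integer vectors parallel to `S` has volume `(dim S)!`.
It does not depend on the choice of the frame. For a one-point set it is the Dirac measure. -/
noncomputable def latticeMeasure (S : Set (ι → ℝ)) : MeasureTheory.Measure (ι → ℝ) :=
  if h : ∃ q, IsLatticeFrame S q then
    (dimOf S).factorial • MeasureTheory.Measure.map
      (fun t : Fin (dimOf S) → ℝ =>
        h.choose.1 + ∑ j, t j • (fun i => (h.choose.2 j i : ℝ))) MeasureTheory.volume
  else 0

/-- The lattice volume of `S`, of the dimension of `S`. -/
noncomputable def latticeVolume (S : Set (ι → ℝ)) : ℝ :=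
  (latticeMeasure S S).toReal

end Lattice

/-! ### Polyhedra with the recession cone `ℝ^ι_{≥ 0}` and virtual polyhedra -/

section Virtual

variable {ι : Type}

/-- The closed positive orthant. -/
def orthant (ι : Type) : Set (ι → ℝ) := {x | ∀ i, 0 ≤ x i}

/-- The polyhedron (convex hull of a finite set of rational points) + (positive orthant). -/
def polyhedronOf (S : Finset (ι → ℚ)) : Set (ι → ℝ) :=
  convexHull ℝ ((fun (a : ι → ℚ) (i : ι) => (a i : ℝ)) '' (S : Set (ι → ℚ))) + orthant ι

/-- Polyhedra of the form (bounded rational polytope) + (positive orthant). -/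
def IsLocalPolyhedron (P : Set (ι → ℝ)) : Prop :=
  ∃ S : Finset (ι → ℚ), S.Nonempty ∧ P = polyhedronOf S

theorem orthant_add_orthant : orthant ι + orthant ι = orthant ι := by
  ext x
  constructor
  · rintro ⟨a, ha, b, hb, rfl⟩ i
    exact add_nonneg (ha i) (hb i)
  · intro hx
    exact ⟨x, hx, 0, fun i => le_refl _, add_zero x⟩

theorem polyhedronOf_singleton (v : ι → ℚ) :
    polyhedronOf {v} = {fun i => (v i : ℝ)} + orthant ι := by
  simp [polyhedronOf]

theorem isLocalPolyhedron_orthant : IsLocalPolyhedron (orthant ι) := by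
  refine ⟨{0}, Finset.singleton_nonempty _, ?_⟩
  have h : (fun i => ((0 : ι → ℚ) i : ℝ)) = (0 : ι → ℝ) := by
    ext i
    simp
  rw [polyhedronOf_singleton, h, Set.singleton_zero, zero_add]

theorem IsLocalPolyhedron.add_orthant {P : Set (ι → ℝ)} (hP : IsLocalPolyhedron P) :
    P + orthant ι = P := by
  obtain ⟨S, -, rfl⟩ := hP
  rw [polyhedronOf, add_assoc, orthant_add_orthant]

theorem IsLocalPolyhedron.add {P Q : Set (ι → ℝ)} (hP : IsLocalPolyhedron P)
    (hQ : IsLocalPolyhedron Q) : IsLocalPolyhedron (P + Q) := by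
  classical
  obtain ⟨S, hS, rfl⟩ := hP
  obtain ⟨T, hT, rfl⟩ := hQ
  refine ⟨S + T, hS.add hT, ?_⟩
  have h : (fun (a : ι → ℚ) (i : ι) => (a i : ℝ)) '' ((S + T : Finset (ι → ℚ)) : Set (ι → ℚ)) =
      (fun (a : ι → ℚ) (i : ι) => (a i : ℝ)) '' (S : Set (ι → ℚ)) +
        (fun (a : ι → ℚ) (i : ι) => (a i : ℝ)) '' (T : Set (ι → ℚ)) := by
    rw [Finset.coe_add]
    ext x
    constructor
    · rintro ⟨_, ⟨a, ha, b, hb, rfl⟩, rfl⟩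
      refine ⟨_, ⟨a, ha, rfl⟩, _, ⟨b, hb, rfl⟩, ?_⟩
      ext i
      simp
    · rintro ⟨_, ⟨a, ha, rfl⟩, _, ⟨b, hb, rfl⟩, rfl⟩
      refine ⟨a + b, ⟨a, ha, b, hb, rfl⟩, ?_⟩
      ext i
      simp
  rw [polyhedronOf, polyhedronOf, polyhedronOf, h, convexHull_add, add_add_add_comm,
    orthant_add_orthant]

/-- The semigroup of polyhedra of the form (bounded rational polytope) + (positive orthant). -/
def LocalPolyhedron (ι : Type) : Type :=
  {P : Set (ι → ℝ) // IsLocalPolyhedron P}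

instance LocalPolyhedron.instAdd : Add (LocalPolyhedron ι) :=
  ⟨fun P Q => ⟨P.1 + Q.1, P.2.add Q.2⟩⟩

instance LocalPolyhedron.instZero : Zero (LocalPolyhedron ι) :=
  ⟨⟨orthant ι, isLocalPolyhedron_orthant⟩⟩

/-- Minkowski addition. The neutral element is the positive orthant. -/
instance LocalPolyhedron.instAddCommMonoid : AddCommMonoid (LocalPolyhedron ι) where
  add_assoc P Q R := Subtype.ext (add_assoc P.1 Q.1 R.1)
  add_comm P Q := Subtype.ext (add_comm P.1 Q.1)
  add_zero P := Subtype.ext P.2.add_orthant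
  zero_add P := Subtype.ext ((add_comm _ _).trans P.2.add_orthant)
  nsmul := nsmulRec

/-- The orthant shifted by a vector. -/
def LocalPolyhedron.shift (v : ι → ℚ) : LocalPolyhedron ι :=
  ⟨polyhedronOf {v}, {v}, Finset.singleton_nonempty v, rfl⟩

/-- The group of virtual polyhedra. -/
abbrev VirtualPolyhedron (ι : Type) : Type :=
  Algebra.GrothendieckAddGroup (LocalPolyhedron ι)

open Classical in
/-- The class of a polyhedron in the group of virtual polyhedra (with the value `0` for sets that
are not polyhedra of the required form). -/
noncomputable def VirtualPolyhedron.ofSet (P : Set (ι → ℝ)) : VirtualPolyhedron ι :=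
  if h : IsLocalPolyhedron P then
    Algebra.GrothendieckAddGroup.of (⟨P, h⟩ : LocalPolyhedron ι)
  else 0

/-- The virtual polyhedron is an actual polyhedron. -/
def VirtualPolyhedron.IsPolyhedron (X : VirtualPolyhedron ι) : Prop :=
  ∃ P : LocalPolyhedron ι, X = Algebra.GrothendieckAddGroup.of P

/-- The virtual polyhedron is the positive orthant up to a shift. -/
def VirtualPolyhedron.IsTrivial (X : VirtualPolyhedron ι) : Prop :=
  ∃ v : ι → ℚ, X = Algebra.GrothendieckAddGroup.of (LocalPolyhedron.shift v)

end Virtual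

/-! ### Newton polyhedra and fiber polyhedra -/

section Newton

variable {n : ℕ}

/-- The Newton polyhedron (convex hull of `A`) + (positive orthant) in `ℝ^n`. -/
def newtonPolyhedron (A : Finset (Fin n → ℕ)) : Set (Fin n → ℝ) :=
  convexHull ℝ ((fun (a : Fin n → ℕ) (i : Fin n) => (a i : ℝ)) '' (A : Set (Fin n → ℕ))) +
    orthant (Fin n)

/-- The projection `ℝ^n → ℝ^Ī` along `ℝ^I`. -/
def projAlong (I : Finset (Fin n)) (x : Fin n → ℝ) : {i // i ∉ I} → ℝ := fun i => x i

/-- The projection `ℝ^n → ℝ^I` along `ℝ^Ī`, as a linear map. -/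
def projTo (I : Finset (Fin n)) : (Fin n → ℝ) →ₗ[ℝ] ({i // i ∈ I} → ℝ) where
  toFun x := fun i => x i
  map_add' _ _ := rfl
  map_smul' _ _ := rfl

/-- The fiber `N_a` of `N` over the point `a ∈ ℝ^Ī`, as a subset of `ℝ^I`. -/
def fiberAt (I : Finset (Fin n)) (N : Set (Fin n → ℝ)) (a : {i // i ∉ I} → ℝ) :
    Set ({i // i ∈ I} → ℝ) :=
  projTo I '' {x | x ∈ N ∧ projAlong I x = a}

/-- The fiber polyhedron `∫_B N`, as a subset of `ℝ^I`: the (projections of the) points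
`(1 + dim B) ∫_B s(x) dx` for all continuous sections `s : B → N` of the projection along `ℝ^I`,
where `dx` is the lattice volume form on `B`. -/
noncomputable def fiberPolyhedron (I : Finset (Fin n)) (N : Set (Fin n → ℝ))
    (B : Set ({i // i ∉ I} → ℝ)) : Set ({i // i ∈ I} → ℝ) :=
  {p | ∃ s : ({i // i ∉ I} → ℝ) → (Fin n → ℝ), ContinuousOn s B ∧
    (∀ x ∈ B, s x ∈ N ∧ projAlong I (s x) = x) ∧
    p = projTo I ((1 + dimOf B : ℝ) • ∫ x in B, s x ∂(latticeMeasure B))}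

/-- The faces contributing to `Ψ_{m,I}`: bounded `V`-faces `B` of `N^I` such that `m ∣ m_B`. -/
def IsContributing (I : Finset (Fin n)) (N : Set (Fin n → ℝ)) (m : ℕ)
    (B : Set ({i // i ∉ I} → ℝ)) : Prop :=
  IsVFace (projAlong I '' N) B ∧ Bornology.IsBounded B ∧ m ∣ latticeDist B

/-- The virtual polyhedron `Ψ_{m,I} = ∑_B (-1)^{dim B} ∫_B N` over all bounded `V`-faces `B` of `N^I`
such that `m ∣ m_B`. -/
noncomputable def virtualPsi (I : Finset (Fin n)) (N : Set (Fin n → ℝ)) (m : ℕ) :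
    VirtualPolyhedron {i // i ∈ I} :=
  ∑ᶠ B ∈ {B | IsContributing I N m B},
    ((-1 : ℤ) ^ dimOf B) • VirtualPolyhedron.ofSet (fiberPolyhedron I N B)

/-! ### Tropical nearby monodromy eigenvalues in codimension one -/

/-- A `V_I`-face: a `V`-face for which `I` is the unique minimal subset of coordinates such that the
projection of the face along `ℝ^I` is bounded. -/
def IsVIFace (I : Finset (Fin n)) (N Γ : Set (Fin n → ℝ)) : Prop :=
  IsVFace N Γ ∧ IsLeast {K : Finset (Fin n) | Bornology.IsBounded (projAlong K '' Γ)} I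

/-- Covectors in `ℝ^n` orthogonal to the set `F`. -/
def normalSpan (F : Set (Fin n → ℝ)) : Submodule ℝ (Fin n → ℝ) where
  carrier := {v | ∀ u ∈ vectorSpan ℝ F, v ⬝ᵥ u = 0}
  add_mem' ha hb u hu := by rw [add_dotProduct, ha u hu, hb u hu, add_zero]
  zero_mem' u _ := zero_dotProduct u
  smul_mem' c v hv u hu := by rw [smul_dotProduct, hv u hu, smul_zero]

/-- The subgroup of integer vectors. -/
def integerVectors (κ : Type) : AddSubgroup (κ → ℝ) where
  carrier := {v | ∀ i, ∃ z : ℤ, v i = z}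
  add_mem' {a b} ha hb i := by
    obtain ⟨x, hx⟩ := ha i
    obtain ⟨y, hy⟩ := hb i
    exact ⟨x + y, by simp [hx, hy]⟩
  zero_mem' _ := ⟨0, by simp⟩
  neg_mem' {a} ha i := by
    obtain ⟨x, hx⟩ := ha i
    exact ⟨-x, by simp [hx]⟩

/-- The index `|p(U) ∩ p(L) / p(U ∩ L)|` for the projection `p` of covectors on `Γ` to covectors on
`ℝ^I`, where `U` is the space of the covectors orthogonal to the face `F` of `Γ`. A covector on `Γ`
(and a lattice covector, dual to the integer vectors parallel to `Γ`) is represented by its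
extension to `ℝ^n` (by an integer extension); then `p` is the restriction of coordinates. -/
noncomputable def pushIndex (I : Finset (Fin n)) (F : Set (Fin n → ℝ)) : ℕ :=
  (((normalSpan F).toAddSubgroup ⊓ integerVectors (Fin n)).map
      (projTo I).toAddMonoidHom).relIndex
    ((Submodule.map (projTo I) (normalSpan F)).toAddSubgroup ⊓ integerVectors {i // i ∈ I})

/-- The weight at the covector `y` on `ℝ^I` of the direct image `π_* [Γ]^d` of the `d`-th dual fan of
the face `Γ`. The cones of the fan `[Γ]^d` consist of the covectors with a given bounded
`d`-dimensional support face `F ⊆ Γ`, span the space orthogonal to `F` and have the lattice volume of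
`F` as the weight; such a cone is mapped to its image with the weight multiplied by the lattice
index, if its dimension `dim Γ - d` is preserved, and to zero otherwise. -/
noncomputable def pushDualFan (I : Finset (Fin n)) (Γ : Set (Fin n → ℝ)) (d : ℕ)
    (y : {i // i ∈ I} → ℝ) : ℝ :=
  ∑ᶠ F ∈ {F : Set (Fin n → ℝ) | Bornology.IsBounded F ∧ dimOf F = d ∧
      (∃ v : Fin n → ℝ, projTo I v = y ∧ F.Nonempty ∧ F = supportFace Γ v) ∧
      Module.finrank ℝ (Submodule.map (projTo I) (normalSpan F)) + d = dimOf Γ},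
    (pushIndex I F : ℝ) * latticeVolume F

/-- The weight function of the codimension one component of `Φ_{m,I} = ∑_Γ π_* ⟨Γ⟩`, over all
`V_I`-faces `Γ` of `N` such that `m ∣ m_Γ`, where `⟨Γ⟩ = ∑_d (-1)^(d-1) [Γ]^d`. The fan `[Γ]^d` has
dimension `dim Γ - d`, so the component of dimension `|I| - 1` comes from
`d = (dim Γ - |I|) + 1` (note that `|I| ≤ dim Γ` for a `V_I`-face). -/
noncomputable def tropicalWeight (I : Finset (Fin n)) (N : Set (Fin n → ℝ)) (m : ℕ)
    (y : {i // i ∈ I} → ℝ) : ℝ :=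
  ∑ᶠ Γ ∈ {Γ | IsVIFace I N Γ ∧ m ∣ latticeDist Γ},
    (-1 : ℝ) ^ (dimOf Γ - I.card) * pushDualFan I Γ (dimOf Γ - I.card + 1) y

/-- The weight function `w` represents the zero weighted fan of codimension one in the ambient cone
of positive covectors: it vanishes on this open cone outside a set of smaller dimension. -/
def IsZeroFan {κ : Type} [Fintype κ] (w : (κ → ℝ) → ℝ) : Prop :=
  ∃ T : Finset (Submodule ℝ (κ → ℝ)),
    (∀ V ∈ T, Module.finrank ℝ V + 1 < Fintype.card κ) ∧
    ∀ y : κ → ℝ, (∀ i, 0 < y i) → w y ≠ 0 → ∃ V ∈ T, y ∈ V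

/-- The largest power of the variable `x_i` dividing a series with the Newton polyhedron `N`. -/
noncomputable def coordOrder (N : Set (Fin n → ℝ)) (i : Fin n) : ℕ :=
  sSup {c : ℕ | ∀ x ∈ N, (c : ℝ) ≤ x i}

/-- The number `m` divides no multiplicity in the prime factorization of a non-degenerate germ with
the Newton polyhedron `N`: such a germ vanishing at the origin is a monomial times a reduced germ. -/
def IsNonTautological (N : Set (Fin n → ℝ)) (m : ℕ) : Prop :=
  m ≠ 1 ∧ ∀ i, coordOrder N i ≠ 0 → ¬ m ∣ coordOrder N i

/-- The number `s = exp(2πik/m)`, for coprime `k` and `m` with a non-tautological denominator `m`, is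
a tropical nearby monodromy eigenvalue of `N` in codimension one at the coordinate plane of `I`. -/
def IsTropicalNearbyEigenvalue (I : Finset (Fin n)) (N : Set (Fin n → ℝ)) (s : ℂ) : Prop :=
  ∃ (k : ℤ) (m : ℕ), 0 < m ∧ IsCoprime k (m : ℤ) ∧
    s = Complex.exp (2 * Real.pi * Complex.I * k / m) ∧ IsNonTautological N m ∧
    ¬ IsZeroFan (tropicalWeight I N m)

/-- The existence of a lattice point `a ∈ ℤ^Ī` which is contained in a bounded edge `B` of `N^I` with
`m ∣ m_B`, is not a `V`-vertex with `m ∣ m_a`, and whose fiber `N_a` has a bounded edge. -/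
def HasSpecialPoint (I : Finset (Fin n)) (N : Set (Fin n → ℝ)) (m : ℕ) : Prop :=
  ∃ a : {i // i ∉ I} → ℤ,
    (∃ B, IsBoundedEdge (projAlong I '' N) B ∧ (fun i => (a i : ℝ)) ∈ B ∧ m ∣ latticeDist B) ∧
    ¬ (IsVFace (projAlong I '' N) {fun i => (a i : ℝ)} ∧
      m ∣ latticeDist {fun i => (a i : ℝ)}) ∧
    HasBoundedEdge (fiberAt I N (fun i => (a i : ℝ)))

end Newton

/-!
Write `N` for the Newton polyhedron, `Q` for its projection along `ℝ^I`, which is a polygon with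
recession cone the positive quadrant, and `N_a` for the fiber of `N` over a point `a` of `Q`.

**Fibers over an edge.** Let `p + [0, L] b`, with `b` primitive, be a bounded edge of `Q`. The part of
`N` over it is the sum of the orthant of `ℝ^I` and the convex hull of the points of `A` over the edge,
and those lie over the lattice points `p + k b`. Hence no vertex lies over the interior of a unit
segment, and the fibers there interpolate linearly, in the sense of Minkowski sums, between the fibers
over its two ends (`IsEdgeParam.interpolate`). Both quantities in question are therefore trapezoid sums
over the lattice points of the edge:

* the fiber polyhedron of the edge is the Minkowski sum of `N_{p + k b} + N_{p + (k + 1) b}` over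
  `k < L` (`IsEdgeParam.fiberPolyhedron_eq`);
* at a generic positive covector `y` the tropical weight of the face of `N` over the edge is the sum of
  `ℓ (p + k b) + ℓ (p + (k + 1) b)` over `k < L`, where `ℓ a` is the lattice length of the support face
  of `N_a` at `y` (`IsEdgeParam.pushDualFan_eq`). Each unit segment with a non-zero term is spanned by
  exactly one two-dimensional face at the extensions of `y`, the lattice area of such a face is computed
  by slicing (`IsAdaptedBasis.index_mul_latticeVolume_eq`), and the factor by which its lattice is
  coarser than the product lattice is the index in the direct image of fans
  (`IsAdaptedBasis.pushIndex_eq`).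

For a vertex `a` the two quantities are `N_a` and `ℓ a`. The `V_I`-faces of `N` are the parts of `N`
over the bounded `V`-faces of `Q`, with the same lattice distance, so both sums run over the same faces
(`tropicalWeight_eq`).

**Cancellation.** A vertex of `Q` which is a `V`-face lies on a coordinate axis. If `m` divides its
lattice distance, then it lies on exactly one bounded edge, and `m` divides the lattice distance of that
edge as well; the case of no bounded edge is excluded by the assumption on the numbers `c_i`. So the
term of the vertex cancels a unit of the trapezoid sum of that edge, and what remains is a sum over
lattice points `a` with positive multiplicities `c a` exactly at the points subject to the conditions 1)
and 2) (`exists_multiplicity`, `exists_newton_multiplicity`). Consequently `-Ψ` is the Minkowski sum of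
the polyhedra `c a • N_a` (`virtualPsi_eq`), and the tropical weight at a generic `y` is minus the sum
of the numbers `c a * ℓ a` (`tropicalWeight_eq_sum`).

**Non-triviality.** A polyhedron with recession cone the orthant and without bounded edges is a shifted
orthant (`IsLocalPolyhedron.eq_shift`), and if a positive combination of support functions is linear on
the positive covectors, then no summand has a bounded edge (`not_hasBoundedEdge_of_linear`). This
settles the virtual polyhedron (`virtualPsi_isTrivial_iff`). For the fan there is no cancellation, as
all the terms have the same sign, and a bounded edge of some `N_a` is the support face for an open set
of covectors in a hyperplane, which finitely many subspaces of codimension two do not cover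
(`not_isZeroFan_iff`).
-/

set_option linter.unusedSectionVars false

/-! ### Support faces of polyhedra -/

section SupportFaces

variable {ι : Type} [Fintype ι]

theorem convex_dotProduct_ge (v : ι → ℝ) (r : ℝ) : Convex ℝ {x : ι → ℝ | r ≤ v ⬝ᵥ x} := by
  intro x hx y hy a b ha hb hab
  simp only [Set.mem_ofPred_eq, dotProduct_add, dotProduct_smul, smul_eq_mul] at *
  obtain rfl : a = 1 - b := by linarith
  nlinarith [mul_le_mul_of_nonneg_left hx ha, mul_le_mul_of_nonneg_left hy hb]

theorem le_dotProduct_of_mem_convexHull {S : Set (ι → ℝ)} {v : ι → ℝ} {r : ℝ}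
    (h : ∀ s ∈ S, r ≤ v ⬝ᵥ s) {x : ι → ℝ} (hx : x ∈ convexHull ℝ S) : r ≤ v ⬝ᵥ x :=
  convexHull_min (t := {x | r ≤ v ⬝ᵥ x}) h (convex_dotProduct_ge v r) hx

theorem convexHull_face {S : Set (ι → ℝ)} {v : ι → ℝ} {r : ℝ} (h : ∀ s ∈ S, r ≤ v ⬝ᵥ s)
    {x : ι → ℝ} (hx : x ∈ convexHull ℝ S) (hxr : v ⬝ᵥ x = r) :
    x ∈ convexHull ℝ {s ∈ S | v ⬝ᵥ s = r} := by
  -- a convex set containing `S`: the points off the face, and the hull of the vertices on it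
  have key : x ∈ {x | r < v ⬝ᵥ x} ∪ convexHull ℝ {s ∈ S | v ⬝ᵥ s = r} := by
    have hge : ∀ z ∈ {x | r < v ⬝ᵥ x} ∪ convexHull ℝ {s ∈ S | v ⬝ᵥ s = r}, r ≤ v ⬝ᵥ z := by
      rintro z (hz | hz)
      · exact le_of_lt hz
      · exact le_dotProduct_of_mem_convexHull (fun s hs => hs.2.ge) hz
    refine convexHull_min (fun s hs => ?_) ?_ hx
    · rcases (h s hs).lt_or_eq with h1 | h1
      · exact Or.inl h1
      · exact Or.inr (subset_convexHull _ _ ⟨hs, h1.symm⟩)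
    · intro p hp q hq a b ha hb hab
      rcases ha.eq_or_lt with rfl | ha'
      · obtain rfl : b = 1 := by linarith
        simpa using hq
      rcases hb.eq_or_lt with rfl | hb'
      · obtain rfl : a = 1 := by linarith
        simpa using hp
      have h1 := hge p hp
      have h2 := hge q hq
      have hb1 : b = 1 - a := by linarith
      rcases hp with hp | hp
      · left
        simp only [Set.mem_ofPred_eq, dotProduct_add, dotProduct_smul, smul_eq_mul] at *
        subst hb1
        nlinarith [mul_pos ha' (sub_pos.2 hp), mul_nonneg hb (sub_nonneg.2 h2)]
      rcases hq with hq | hq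
      · left
        simp only [Set.mem_ofPred_eq, dotProduct_add, dotProduct_smul, smul_eq_mul] at *
        subst hb1
        nlinarith [mul_pos hb' (sub_pos.2 hq), mul_nonneg ha (sub_nonneg.2 h1)]
      exact Or.inr (convex_convexHull ℝ _ hp hq ha hb hab)
  rcases key with h1 | h1
  · exact absurd hxr (ne_of_gt h1)
  · exact h1

theorem dotProduct_eq_of_mem_convexHull {S : Set (ι → ℝ)} {v : ι → ℝ} {r : ℝ}
    (h : ∀ s ∈ S, v ⬝ᵥ s = r) {x : ι → ℝ} (hx : x ∈ convexHull ℝ S) : v ⬝ᵥ x = r := by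
  refine le_antisymm ?_ (le_dotProduct_of_mem_convexHull (fun s hs => (h s hs).ge) hx)
  have := le_dotProduct_of_mem_convexHull (v := -v) (r := -r)
    (fun s hs => by rw [neg_dotProduct, h s hs]) hx
  rw [neg_dotProduct] at this
  linarith

/-- The support face of a polytope plus a cone, in a direction which is nonnegative on the cone. -/
theorem supportFace_convexHull_add {S C : Set (ι → ℝ)} {v s₀ : ι → ℝ} (hC0 : 0 ∈ C)
    (hC : ∀ c ∈ C, 0 ≤ v ⬝ᵥ c) (hs₀ : s₀ ∈ S) (hmin : ∀ s ∈ S, v ⬝ᵥ s₀ ≤ v ⬝ᵥ s) :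
    supportFace (convexHull ℝ S + C) v =
      convexHull ℝ {s ∈ S | v ⬝ᵥ s = v ⬝ᵥ s₀} + {c ∈ C | v ⬝ᵥ c = 0} := by
  ext x
  constructor
  · rintro ⟨⟨p, hp, c, hc, rfl⟩, hx⟩
    have h1 := hx s₀ ⟨s₀, subset_convexHull _ _ hs₀, 0, hC0, add_zero _⟩
    have h2 := le_dotProduct_of_mem_convexHull hmin hp
    have h3 := hC c hc
    simp only [dotProduct_add] at h1
    exact ⟨p, convexHull_face hmin hp (by linarith), c, ⟨hc, by linarith⟩, rfl⟩
  · rintro ⟨p, hp, c, ⟨hc, hc0⟩, rfl⟩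
    refine ⟨⟨p, convexHull_mono (fun s hs => hs.1) hp, c, hc, rfl⟩, ?_⟩
    rintro _ ⟨q, hq, d, hd, rfl⟩
    have h1 := dotProduct_eq_of_mem_convexHull (fun s hs => hs.2) hp
    have h2 := le_dotProduct_of_mem_convexHull hmin hq
    have h3 := hC d hd
    simp only [dotProduct_add]
    linarith

theorem supportFace_add {P Q : Set (ι → ℝ)} {v : ι → ℝ} (hP : (supportFace P v).Nonempty)
    (hQ : (supportFace Q v).Nonempty) :
    supportFace (P + Q) v = supportFace P v + supportFace Q v := by
  obtain ⟨p₀, hp₀, hp₀'⟩ := hP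
  obtain ⟨q₀, hq₀, hq₀'⟩ := hQ
  ext x
  constructor
  · rintro ⟨⟨p, hp, q, hq, rfl⟩, hx⟩
    refine ⟨p, ⟨hp, fun y hy => ?_⟩, q, ⟨hq, fun y hy => ?_⟩, rfl⟩
    · have := hx (y + q) ⟨y, hy, q, hq, rfl⟩
      simp only [dotProduct_add] at this
      linarith
    · have := hx (p + y) ⟨p, hp, y, hy, rfl⟩
      simp only [dotProduct_add] at this
      linarith
  · rintro ⟨p, hp, q, hq, rfl⟩
    refine ⟨⟨p, hp.1, q, hq.1, rfl⟩, ?_⟩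
    rintro _ ⟨p', hp', q', hq', rfl⟩
    have h1 := hp.2 p' hp'
    have h2 := hq.2 q' hq'
    simp only [dotProduct_add]
    linarith

theorem supportFace_smul {P : Set (ι → ℝ)} {v : ι → ℝ} {c : ℝ} (hc : 0 < c) :
    supportFace (c • P) v = c • supportFace P v := by
  ext x
  constructor
  · rintro ⟨⟨p, hp, rfl⟩, hx⟩
    refine ⟨p, ⟨hp, fun y hy => ?_⟩, rfl⟩
    have := hx (c • y) ⟨y, hy, rfl⟩
    simp only [dotProduct_smul, smul_eq_mul] at this
    exact le_of_mul_le_mul_left this hc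
  · rintro ⟨p, hp, rfl⟩
    refine ⟨⟨p, hp.1, rfl⟩, ?_⟩
    rintro _ ⟨q, hq, rfl⟩
    simp only [dotProduct_smul, smul_eq_mul]
    exact mul_le_mul_of_nonneg_left (hp.2 q hq) hc.le

theorem convex_supportFace {P : Set (ι → ℝ)} (hP : Convex ℝ P) (v : ι → ℝ) :
    Convex ℝ (supportFace P v) := by
  intro x hx y hy a b ha hb hab
  refine ⟨hP hx.1 hy.1 ha hb hab, fun z hz => ?_⟩
  have h1 := mul_le_mul_of_nonneg_left (hx.2 z hz) ha
  have h2 := mul_le_mul_of_nonneg_left (hy.2 z hz) hb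
  simp only [dotProduct_add, dotProduct_smul, smul_eq_mul]
  have : v ⬝ᵥ z = a * (v ⬝ᵥ z) + b * (v ⬝ᵥ z) := by rw [← add_mul, hab, one_mul]
  linarith

theorem dotProduct_pos_of_pos {y c : ι → ℝ} (hy : ∀ i, 0 < y i) (hc : c ∈ orthant ι)
    (h : y ⬝ᵥ c = 0) : c = 0 := by
  have h1 : ∀ i ∈ Finset.univ, 0 ≤ y i * c i := fun i _ => mul_nonneg (hy i).le (hc i)
  have h2 := (Finset.sum_eq_zero_iff_of_nonneg h1).1 h
  ext i
  exact (mul_eq_zero.1 (h2 i (Finset.mem_univ i))).resolve_left (hy i).ne'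

theorem dotProduct_nonneg_orthant {y c : ι → ℝ} (hy : ∀ i, 0 ≤ y i) (hc : c ∈ orthant ι) :
    0 ≤ y ⬝ᵥ c :=
  Finset.sum_nonneg fun i _ => mul_nonneg (hy i) (hc i)

/-- A covector with a non-empty support face is nonnegative on the recession directions. -/
theorem nonneg_of_supportFace_nonempty [DecidableEq ι] {P : Set (ι → ℝ)} {v : ι → ℝ} {i : ι}
    (hP : ∀ x ∈ P, ∀ t : ℝ, 0 ≤ t → x + Pi.single i t ∈ P) (h : (supportFace P v).Nonempty) :
    0 ≤ v i := by
  obtain ⟨x, hx, hmin⟩ := h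
  have := hmin _ (hP x hx 1 zero_le_one)
  simpa [dotProduct_add, dotProduct_single] using this

/-- A covector with a non-empty bounded support face is positive on the recession directions. -/
theorem pos_of_supportFace_isBounded [DecidableEq ι] {P : Set (ι → ℝ)} {v : ι → ℝ} {i : ι}
    (hP : ∀ x ∈ P, ∀ t : ℝ, 0 ≤ t → x + Pi.single i t ∈ P) (h : (supportFace P v).Nonempty)
    (hb : Bornology.IsBounded (supportFace P v)) : 0 < v i := by
  refine (nonneg_of_supportFace_nonempty hP h).lt_of_ne' fun h0 => ?_
  obtain ⟨x, hx, hmin⟩ := h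
  obtain ⟨r, hr⟩ := hb.exists_norm_le
  have hmem : ∀ t : ℝ, 0 ≤ t → x + Pi.single i t ∈ supportFace P v := fun t ht =>
    ⟨hP x hx t ht, fun y hy => by
      simpa [dotProduct_add, dotProduct_single, h0] using hmin y hy⟩
  have h1 := hr _ (hmem (|r| + |x i| + 1) (by positivity))
  have h2 := (norm_le_pi_norm _ i).trans h1
  simp only [Pi.add_apply, Pi.single_eq_same, Real.norm_eq_abs] at h2
  have h3 := le_abs_self (x i + (|r| + |x i| + 1))
  have h4 := neg_abs_le (x i)
  have h5 := le_abs_self r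
  linarith

theorem isFace_extreme {P F : Set (ι → ℝ)} (hF : IsFace P F) {x d : ι → ℝ} (hx : x ∈ F)
    (h1 : x + d ∈ P) (h2 : x - d ∈ P) : x + d ∈ F := by
  obtain ⟨-, v, rfl⟩ := hF
  refine ⟨h1, fun y hy => le_trans ?_ (hx.2 y hy)⟩
  have := hx.2 _ h2
  simp only [dotProduct_add, dotProduct_sub] at *
  linarith

end SupportFaces

/-! ### Polyhedra with recession cone the orthant -/

section LocalPolyhedra

variable {ι : Type}

/-- The real points of a finite set of rational points. -/
abbrev ratPts (S : Finset (ι → ℚ)) : Set (ι → ℝ) :=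
  (fun (a : ι → ℚ) (i : ι) => (a i : ℝ)) '' (S : Set (ι → ℚ))

theorem ratPts_finite (S : Finset (ι → ℚ)) : (ratPts S).Finite := S.finite_toSet.image _

theorem ratPts_nonempty {S : Finset (ι → ℚ)} (hS : S.Nonempty) : (ratPts S).Nonempty :=
  hS.to_set.image _

theorem zero_mem_orthant : (0 : ι → ℝ) ∈ orthant ι := fun _ => le_refl _

theorem single_mem_orthant [DecidableEq ι] {i : ι} {t : ℝ} (ht : 0 ≤ t) :
    Pi.single i t ∈ orthant ι := by
  intro j
  rcases eq_or_ne j i with rfl | h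
  · simpa using ht
  · simp [h]

theorem convex_orthant : Convex ℝ (orthant ι) := by
  intro x hx y hy a b ha hb _ i
  exact add_nonneg (mul_nonneg ha (hx i)) (mul_nonneg hb (hy i))

theorem isClosed_orthant : IsClosed (orthant ι) := by
  have : orthant ι = ⋂ i, {x : ι → ℝ | 0 ≤ x i} := by
    ext x; simp [orthant]
  rw [this]
  exact isClosed_iInter fun i => isClosed_le continuous_const (continuous_apply i)

theorem IsLocalPolyhedron.convex {P : Set (ι → ℝ)} (hP : IsLocalPolyhedron P) : Convex ℝ P := by
  obtain ⟨S, -, rfl⟩ := hP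
  exact (convex_convexHull ℝ _).add convex_orthant

theorem IsLocalPolyhedron.nonempty {P : Set (ι → ℝ)} (hP : IsLocalPolyhedron P) :
    P.Nonempty := by
  obtain ⟨S, hS, rfl⟩ := hP
  exact ((ratPts_nonempty hS).convexHull).add ⟨0, zero_mem_orthant⟩

theorem IsLocalPolyhedron.add_mem {P : Set (ι → ℝ)} (hP : IsLocalPolyhedron P) {x c : ι → ℝ}
    (hx : x ∈ P) (hc : c ∈ orthant ι) : x + c ∈ P := by
  rw [← hP.add_orthant]
  exact ⟨x, hx, c, hc, rfl⟩

theorem IsLocalPolyhedron.isClosed {P : Set (ι → ℝ)} (hP : IsLocalPolyhedron P) :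
    IsClosed P := by
  obtain ⟨S, -, rfl⟩ := hP
  exact isClosed_orthant.add_left_of_isCompact ((ratPts_finite S).isCompact_convexHull (𝕜 := ℝ))

variable [Fintype ι]

theorem exists_min_dotProduct {S : Set (ι → ℝ)} (hS : S.Finite) (hne : S.Nonempty) (v : ι → ℝ) :
    ∃ s ∈ S, ∀ t ∈ S, v ⬝ᵥ s ≤ v ⬝ᵥ t :=
  Set.exists_min_image S (fun s => v ⬝ᵥ s) hS hne

theorem IsLocalPolyhedron.supportFace_nonempty {P : Set (ι → ℝ)} (hP : IsLocalPolyhedron P)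
    {y : ι → ℝ} (hy : ∀ i, 0 ≤ y i) : (supportFace P y).Nonempty := by
  obtain ⟨S, hS, rfl⟩ := hP
  obtain ⟨s, hs, hmin⟩ := exists_min_dotProduct (ratPts_finite S) (ratPts_nonempty hS) y
  rw [polyhedronOf, supportFace_convexHull_add zero_mem_orthant
    (fun c hc => dotProduct_nonneg_orthant hy hc) hs hmin]
  exact ⟨s + 0, s, subset_convexHull _ _ ⟨hs, rfl⟩, 0, ⟨zero_mem_orthant, dotProduct_zero _⟩, rfl⟩

/-- The support face of a polytope plus the orthant in a positive direction is a polytope. -/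
theorem supportFace_convexHull_add_orthant {S : Set (ι → ℝ)} {y s₀ : ι → ℝ} (hy : ∀ i, 0 < y i)
    (hs₀ : s₀ ∈ S) (hmin : ∀ s ∈ S, y ⬝ᵥ s₀ ≤ y ⬝ᵥ s) :
    supportFace (convexHull ℝ S + orthant ι) y = convexHull ℝ {s ∈ S | y ⬝ᵥ s = y ⬝ᵥ s₀} := by
  rw [supportFace_convexHull_add zero_mem_orthant
    (fun c hc => dotProduct_nonneg_orthant (fun i => (hy i).le) hc) hs₀ hmin]
  have : {c ∈ orthant ι | y ⬝ᵥ c = 0} = {0} := by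
    ext c
    constructor
    · rintro ⟨hc, h⟩
      exact dotProduct_pos_of_pos hy hc h
    · rintro rfl
      exact ⟨zero_mem_orthant, dotProduct_zero _⟩
  rw [this, Set.singleton_zero, add_zero]

/-- A polyhedron with recession cone the orthant is cut out by halfspaces with nonnegative
covectors. -/
theorem IsLocalPolyhedron.exists_separation {P : Set (ι → ℝ)} (hP : IsLocalPolyhedron P)
    {z : ι → ℝ} (hz : z ∉ P) : ∃ y : ι → ℝ, (∀ i, 0 ≤ y i) ∧ ∀ p ∈ P, y ⬝ᵥ z < y ⬝ᵥ p := by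
  classical
  obtain ⟨f, u, h1, h2⟩ := geometric_hahn_banach_point_closed hP.convex hP.isClosed hz
  have hf : ∀ x, f x = (fun i => f (Pi.single i 1)) ⬝ᵥ x := by
    intro x
    conv_lhs => rw [← Finset.univ_sum_single x]
    rw [map_sum]
    refine Finset.sum_congr rfl fun i _ => ?_
    have : (Pi.single i (x i) : ι → ℝ) = x i • Pi.single i (1 : ℝ) := by
      rw [← Pi.single_smul, smul_eq_mul, mul_one]
    rw [this, map_smul, smul_eq_mul, mul_comm]
  refine ⟨fun i => f (Pi.single i 1), fun i => ?_, fun p hp => ?_⟩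
  · by_contra! hneg
    obtain ⟨p, hp⟩ := hP.nonempty
    -- far along the `i`-th axis the functional would become too small
    have ht : 0 ≤ (f p - u) / -f (Pi.single i 1) :=
      div_nonneg (sub_nonneg.2 (h2 p hp).le) (by linarith)
    have h3 := h2 _ (hP.add_mem hp (single_mem_orthant (i := i) ht))
    rw [map_add, hf (Pi.single i _), dotProduct_single] at h3
    have : f (Pi.single i 1) * ((f p - u) / -f (Pi.single i 1)) = -(f p - u) := by
      have := hneg.ne
      field_simp
    linarith
  · rw [← hf, ← hf]
    exact h1.trans (h2 p hp)

/-- The support function `y ↦ min_P y` of polyhedra, as a homomorphism in `P`. -/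
noncomputable def supportHom {y : ι → ℝ} (hy : ∀ i, 0 ≤ y i) : LocalPolyhedron ι →+ ℝ where
  toFun P := y ⬝ᵥ (P.2.supportFace_nonempty hy).choose
  map_zero' := by
    have h := (Subtype.property (0 : LocalPolyhedron ι)).supportFace_nonempty hy
    refine le_antisymm ?_ (dotProduct_nonneg_orthant hy h.choose_spec.1)
    simpa using h.choose_spec.2 0 zero_mem_orthant
  map_add' P Q := by
    have h1 := (P.2.supportFace_nonempty hy).choose_spec
    have h2 := (Q.2.supportFace_nonempty hy).choose_spec
    have h3 := ((P + Q).2.supportFace_nonempty hy).choose_spec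
    rw [← dotProduct_add]
    obtain ⟨p, hp, q, hq, hpq⟩ := h3.1
    refine le_antisymm (h3.2 _ ⟨_, h1.1, _, h2.1, rfl⟩) ?_
    rw [← hpq, dotProduct_add, dotProduct_add]
    exact add_le_add (h1.2 p hp) (h2.2 q hq)

theorem supportHom_le {y : ι → ℝ} (hy : ∀ i, 0 ≤ y i) (P : LocalPolyhedron ι) {p : ι → ℝ}
    (hp : p ∈ P.1) : supportHom hy P ≤ y ⬝ᵥ p :=
  (P.2.supportFace_nonempty hy).choose_spec.2 p hp

theorem supportHom_eq {y : ι → ℝ} (hy : ∀ i, 0 ≤ y i) (P : LocalPolyhedron ι) {p : ι → ℝ}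
    (hp : p ∈ supportFace P.1 y) : supportHom hy P = y ⬝ᵥ p :=
  le_antisymm (supportHom_le hy P hp.1)
    (hp.2 _ (P.2.supportFace_nonempty hy).choose_spec.1)

theorem supportHom_shift {y : ι → ℝ} (hy : ∀ i, 0 ≤ y i) (v : ι → ℚ) :
    supportHom hy (LocalPolyhedron.shift v) = y ⬝ᵥ (fun i => (v i : ℝ)) := by
  refine supportHom_eq hy _ ⟨?_, ?_⟩
  · change _ ∈ polyhedronOf {v}
    rw [polyhedronOf_singleton]
    exact ⟨_, rfl, 0, zero_mem_orthant, add_zero _⟩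
  · intro x hx
    change x ∈ polyhedronOf {v} at hx
    rw [polyhedronOf_singleton] at hx
    obtain ⟨_, rfl, c, hc, rfl⟩ := hx
    rw [dotProduct_add]
    linarith [dotProduct_nonneg_orthant hy hc]

/-- The support function on virtual polyhedra. -/
noncomputable def virtualSupport {y : ι → ℝ} (hy : ∀ i, 0 ≤ y i) : VirtualPolyhedron ι →+ ℝ :=
  Algebra.GrothendieckAddGroup.lift (supportHom hy)

theorem virtualSupport_of {y : ι → ℝ} (hy : ∀ i, 0 ≤ y i) (P : LocalPolyhedron ι) :
    virtualSupport hy (Algebra.GrothendieckAddGroup.of P) = supportHom hy P :=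
  DFunLike.congr_fun (Algebra.GrothendieckAddGroup.lift.symm_apply_apply (supportHom hy)) P

end LocalPolyhedra

/-! ### Edges of polyhedra with recession cone the orthant -/

section Edges

open Filter Topology

variable {ι : Type}

theorem vectorSpan_eq_span_singleton {V : Type*} [AddCommGroup V] [Module ℝ V] {F : Set V}
    {p q : V} (hp : p ∈ F) (hq : q ∈ F) (h : ∀ s ∈ F, ∃ t : ℝ, s = p + t • (q - p)) :
    vectorSpan ℝ F = Submodule.span ℝ {q - p} := by
  rw [vectorSpan_eq_span_vsub_set_right ℝ hp]
  refine le_antisymm (Submodule.span_le.2 ?_) (Submodule.span_mono ?_)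
  · rintro _ ⟨s, hs, rfl⟩
    obtain ⟨t, rfl⟩ := h s hs
    refine Submodule.mem_span_singleton.2 ⟨t, ?_⟩
    simp
  · rintro _ rfl
    exact ⟨q, hq, rfl⟩

theorem dimOf_eq_one {F : Set (ι → ℝ)} {p q : ι → ℝ} (hp : p ∈ F) (hq : q ∈ F) (hpq : p ≠ q)
    (h : ∀ s ∈ F, ∃ t : ℝ, s = p + t • (q - p)) : dimOf F = 1 := by
  rw [dimOf, vectorSpan_eq_span_singleton hp hq h]
  exact finrank_span_singleton (sub_ne_zero.2 hpq.symm)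

theorem convex_line (p d : ι → ℝ) : Convex ℝ {s : ι → ℝ | ∃ t : ℝ, s = p + t • d} := by
  rintro _ ⟨t, rfl⟩ _ ⟨u, rfl⟩ a b - - hab
  refine ⟨a * t + b * u, ?_⟩
  obtain rfl : a = 1 - b := by linarith
  module

variable [Fintype ι]

/-- Adding a small multiple of a covector `z` to a covector `v` replaces the face of a polytope
in the direction `v` by the face of this face in the direction `z`. -/
theorem eventually_perturb {S : Set (ι → ℝ)} (hS : S.Finite) {v z s₁ : ι → ℝ}
    (hv : ∀ s ∈ S, v ⬝ᵥ s₁ ≤ v ⬝ᵥ s) (hz : ∀ s ∈ S, v ⬝ᵥ s = v ⬝ᵥ s₁ → z ⬝ᵥ s₁ ≤ z ⬝ᵥ s) :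
    ∀ᶠ ε in 𝓝[>] (0 : ℝ), ∀ s ∈ S, (v + ε • z) ⬝ᵥ s₁ ≤ (v + ε • z) ⬝ᵥ s ∧
      ((v + ε • z) ⬝ᵥ s = (v + ε • z) ⬝ᵥ s₁ → v ⬝ᵥ s = v ⬝ᵥ s₁ ∧ z ⬝ᵥ s = z ⬝ᵥ s₁) := by
  rw [eventually_all_finite hS]
  intro s hs
  simp only [add_dotProduct, smul_dotProduct, smul_eq_mul]
  rcases (hv s hs).eq_or_lt with h | h
  · filter_upwards [self_mem_nhdsWithin] with ε hε
    have hε : 0 < ε := hε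
    have h2 := hz s hs h.symm
    refine ⟨by nlinarith, fun h3 => ⟨h.symm, ?_⟩⟩
    exact mul_left_cancel₀ hε.ne' (by linarith)
  · have hc : Tendsto (fun ε : ℝ => (v ⬝ᵥ s + ε * z ⬝ᵥ s) - (v ⬝ᵥ s₁ + ε * z ⬝ᵥ s₁)) (𝓝[>] 0)
        (𝓝 ((v ⬝ᵥ s + 0 * z ⬝ᵥ s) - (v ⬝ᵥ s₁ + 0 * z ⬝ᵥ s₁))) :=
      ((Continuous.tendsto (by fun_prop) 0).mono_left nhdsWithin_le_nhds)
    filter_upwards [hc.eventually (lt_mem_nhds (show 0 < _ by linarith))] with ε hε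
    exact ⟨by linarith, fun h => by linarith⟩

theorem eventually_pos_perturb {y : ι → ℝ} (hy : ∀ i, 0 < y i) (z : ι → ℝ) :
    ∀ᶠ ε in 𝓝[>] (0 : ℝ), ∀ i, 0 < (y + ε • z) i := by
  rw [eventually_all]
  intro i
  have hc : Tendsto (fun ε : ℝ => y i + ε * z i) (𝓝[>] 0) (𝓝 (y i + 0 * z i)) :=
    (Continuous.tendsto (by fun_prop) 0).mono_left nhdsWithin_le_nhds
  filter_upwards [hc.eventually (lt_mem_nhds (show 0 < _ by simpa using hy i))] with ε hε
  simpa using hε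

/-- Rotating a covector with the unique minimum point `p` towards a covector with a smaller value
elsewhere, one meets a covector with the minimum point `p` and another minimum point. -/
theorem exists_rotate {S : Set (ι → ℝ)} (hS : S.Finite) {p u₀ u : ι → ℝ}
    (h0 : ∀ s ∈ S, s ≠ p → u₀ ⬝ᵥ p < u₀ ⬝ᵥ s) (hu : ∃ s ∈ S, u ⬝ᵥ s < u ⬝ᵥ p) :
    ∃ t : ℝ, 0 < t ∧ t < 1 ∧ (∀ s ∈ S, ((1 - t) • u₀ + t • u) ⬝ᵥ p ≤ ((1 - t) • u₀ + t • u) ⬝ᵥ s) ∧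
      ∃ q ∈ S, q ≠ p ∧ ((1 - t) • u₀ + t • u) ⬝ᵥ q = ((1 - t) • u₀ + t • u) ⬝ᵥ p := by
  obtain ⟨s₀, hs₀, hs₀'⟩ := hu
  obtain ⟨q, ⟨hq, hqu⟩, hmin⟩ := Set.exists_min_image {s ∈ S | u ⬝ᵥ s < u ⬝ᵥ p}
    (fun s => (u₀ ⬝ᵥ s - u₀ ⬝ᵥ p) / ((u₀ ⬝ᵥ s - u₀ ⬝ᵥ p) + (u ⬝ᵥ p - u ⬝ᵥ s)))
    (hS.subset fun s hs => hs.1) ⟨s₀, hs₀, hs₀'⟩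
  have hqp : q ≠ p := by rintro rfl; exact lt_irrefl _ hqu
  have ha := h0 q hq hqp
  set a := u₀ ⬝ᵥ q - u₀ ⬝ᵥ p with ha_def
  set b := u ⬝ᵥ p - u ⬝ᵥ q with hb_def
  have ha0 : 0 < a := by linarith
  have hb0 : 0 < b := by linarith
  have ht : a / (a + b) * (a + b) = a := div_mul_cancel₀ _ (by positivity)
  have ht1 : a / (a + b) < 1 := (div_lt_one (by positivity)).2 (by linarith)
  refine ⟨a / (a + b), by positivity, ht1, fun s hs => ?_, q, hq, hqp, ?_⟩
  · simp only [add_dotProduct, smul_dotProduct, smul_eq_mul]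
    set t := a / (a + b)
    have ht0 : 0 < t := by positivity
    rcases eq_or_ne s p with rfl | hsp
    · exact le_rfl
    have h1 := h0 s hs hsp
    rcases lt_or_ge (u ⬝ᵥ s) (u ⬝ᵥ p) with h2 | h2
    · have h3 := hmin s ⟨hs, h2⟩
      have h4 := (le_div_iff₀ (by linarith)).1 h3
      change t * _ ≤ _ at h4
      nlinarith
    · nlinarith [mul_le_mul_of_nonneg_left h2 ht0.le,
        mul_le_mul_of_nonneg_left h1.le (sub_nonneg.2 ht1.le)]
  · simp only [add_dotProduct, smul_dotProduct, smul_eq_mul]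
    linear_combination (-ht)

/-- The point of a finite set of largest norm is its vertex. -/
theorem exists_strict_min {S : Set (ι → ℝ)} (hS : S.Finite) (hne : S.Nonempty) :
    ∃ p ∈ S, ∃ u : ι → ℝ, ∀ s ∈ S, s ≠ p → u ⬝ᵥ p < u ⬝ᵥ s := by
  obtain ⟨p, hp, hmax⟩ := Set.exists_max_image S (fun s => s ⬝ᵥ s) hS hne
  refine ⟨p, hp, -p, fun s hs hsp => ?_⟩
  have h1 := hmax s hs
  have h2 : 0 < (p - s) ⬝ᵥ (p - s) := by
    refine lt_of_le_of_ne (Finset.sum_nonneg fun i _ => mul_self_nonneg _) fun h => hsp ?_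
    exact (sub_eq_zero.1 (dotProduct_self_eq_zero.1 h.symm)).symm
  simp only [sub_dotProduct, dotProduct_sub, neg_dotProduct] at *
  rw [dotProduct_comm s p] at h2
  linarith

/-- If a positive covector has several minimum points on a finite set, then so does a positive
covector whose minimum points are collinear: replace a non-collinear face by a smaller one. -/
theorem exists_collinear_face {S : Set (ι → ℝ)} (hS : S.Finite) :
    ∀ (k : ℕ) (y : ι → ℝ), (∀ i, 0 < y i) → (supportFace S y).ncard = k →
      (∃ p ∈ supportFace S y, ∃ q ∈ supportFace S y, p ≠ q) →
      ∃ y' : ι → ℝ, (∀ i, 0 < y' i) ∧ ∃ p ∈ supportFace S y', ∃ q ∈ supportFace S y', p ≠ q ∧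
        ∀ s ∈ supportFace S y', ∃ t : ℝ, s = p + t • (q - p) := by
  intro k
  induction k using Nat.strong_induction_on with
  | _ k ih =>
  intro y hy hk hpq
  have hfin : (supportFace S y).Finite := hS.subset fun s hs => hs.1
  obtain ⟨p, hp, u₀, hu₀⟩ := exists_strict_min hfin (hpq.imp fun _ h => h.1)
  obtain ⟨q, hq, hqp⟩ : ∃ q ∈ supportFace S y, q ≠ p := by
    obtain ⟨a, ha, b, hb, hab⟩ := hpq
    by_cases h : a = p
    · exact ⟨b, hb, fun h' => hab (h.trans h'.symm)⟩
    · exact ⟨a, ha, h⟩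
  by_cases hcol : ∀ s ∈ supportFace S y, ∃ t : ℝ, s = p + t • (q - p)
  · exact ⟨y, hy, p, hp, q, hq, hqp.symm, hcol⟩
  push Not at hcol
  obtain ⟨s, hs, hsn⟩ := hcol
  -- a covector which is negative on `q - p` and positive on `s - p`
  obtain ⟨u, hu1, hu2⟩ : ∃ u : ι → ℝ, u ⬝ᵥ (q - p) < 0 ∧ 0 < u ⬝ᵥ (s - p) := by
    set a := q - p with ha
    set c := s - p with hc
    have haa : 0 < a ⬝ᵥ a := lt_of_le_of_ne (Finset.sum_nonneg fun i _ => mul_self_nonneg _)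
      fun h => hqp (sub_eq_zero.1 (dotProduct_self_eq_zero.1 h.symm))
    set w := c - ((c ⬝ᵥ a) / (a ⬝ᵥ a)) • a with hw
    have hwa : w ⬝ᵥ a = 0 := by
      simp only [hw, sub_dotProduct, smul_dotProduct, smul_eq_mul]
      field_simp
      ring
    have hw0 : w ≠ 0 := fun h => hsn ((c ⬝ᵥ a) / (a ⬝ᵥ a)) (by
      rw [← sub_eq_zero.1 (hw.symm.trans h), hc]; abel)
    have hww : 0 < w ⬝ᵥ w := lt_of_le_of_ne (Finset.sum_nonneg fun i _ => mul_self_nonneg _)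
      fun h => hw0 (dotProduct_self_eq_zero.1 h.symm)
    have hwc : w ⬝ᵥ c = w ⬝ᵥ w := by
      conv_rhs => rw [hw, dotProduct_sub, dotProduct_smul, ← hw, hwa]
      simp
    refine ⟨((1 + a ⬝ᵥ c) / (w ⬝ᵥ w)) • w - a, ?_, ?_⟩
    · rw [sub_dotProduct, smul_dotProduct, hwa]
      simpa using haa
    · rw [sub_dotProduct, smul_dotProduct, hwc, smul_eq_mul, div_mul_cancel₀ _ hww.ne']
      linarith
  rw [dotProduct_sub] at hu1 hu2
  obtain ⟨t, ht0, ht1, hz, q', hq', hq'p, hzq'⟩ := exists_rotate hfin hu₀ ⟨q, hq, by linarith⟩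
  set z := (1 - t) • u₀ + t • u with hz_def
  have hsp : s ≠ p := by rintro rfl; simp at hu2
  have hzs : z ⬝ᵥ p < z ⬝ᵥ s := by
    simp only [hz_def, add_dotProduct, smul_dotProduct, smul_eq_mul]
    have := hu₀ s hs hsp
    nlinarith [mul_pos (sub_pos.2 ht1) (sub_pos.2 this), mul_pos ht0 hu2]
  obtain ⟨ε, hε1, hε2⟩ := ((eventually_perturb hS (v := y) (z := z) (s₁ := p) hp.2
    (fun r hr hr' => hz r ⟨hr, fun x hx => hr' ▸ hp.2 x hx⟩)).and
      (eventually_pos_perturb hy z)).exists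
  have hp' : p ∈ supportFace S (y + ε • z) := ⟨hp.1, fun r hr => (hε1 r hr).1⟩
  have hyq : y ⬝ᵥ q' = y ⬝ᵥ p := le_antisymm (hq'.2 p hp.1) (hp.2 q' hq'.1)
  have hq'' : q' ∈ supportFace S (y + ε • z) := by
    refine ⟨hq'.1, fun r hr => le_trans (le_of_eq ?_) (hε1 r hr).1⟩
    rw [add_dotProduct, add_dotProduct, smul_dotProduct, smul_dotProduct, hyq, hzq']
  have hsub : supportFace S (y + ε • z) ⊆ supportFace S y := by
    intro r hr
    have := ((hε1 r hr.1).2 (le_antisymm (hr.2 p hp.1) (hε1 r hr.1).1)).1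
    exact ⟨hr.1, fun x hx => this ▸ hp.2 x hx⟩
  have hlt : (supportFace S (y + ε • z)).ncard < k := by
    rw [← hk]
    refine Set.ncard_lt_ncard ⟨hsub, fun h => ?_⟩ hfin
    have hr := h hs
    have := ((hε1 s hr.1).2 (le_antisymm (hr.2 p hp.1) (hε1 s hr.1).1)).2
    linarith
  exact ih _ hlt _ hε2 rfl ⟨p, hp', q', hq'', hq'p.symm⟩

theorem supportFace_polyhedronOf {S : Finset (ι → ℚ)} {y : ι → ℝ} (hy : ∀ i, 0 < y i) :
    supportFace (polyhedronOf S) y = convexHull ℝ (supportFace (ratPts S) y) := by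
  rcases S.eq_empty_or_nonempty with rfl | hS
  · simp [polyhedronOf, supportFace]
  obtain ⟨s, hs, hmin⟩ := exists_min_dotProduct (ratPts_finite S) (ratPts_nonempty hS) y
  rw [polyhedronOf, supportFace_convexHull_add_orthant hy hs hmin]
  congr 1
  ext x
  constructor
  · rintro ⟨hx, h⟩
    exact ⟨hx, fun t ht => h ▸ hmin t ht⟩
  · rintro ⟨hx, h⟩
    exact ⟨hx, le_antisymm (h s hs) (hmin x hx)⟩

theorem isBounded_supportFace_polyhedronOf {S : Finset (ι → ℚ)} {y : ι → ℝ}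
    (hy : ∀ i, 0 < y i) : Bornology.IsBounded (supportFace (polyhedronOf S) y) := by
  rw [supportFace_polyhedronOf hy, isBounded_convexHull]
  exact ((ratPts_finite S).subset fun s hs => hs.1).isBounded

/-- A polyhedron with two minimum points of a positive covector has a bounded edge. -/
theorem hasBoundedEdge_of_two_minima {S : Finset (ι → ℚ)} {y p q : ι → ℝ} (hy : ∀ i, 0 < y i)
    (hp : p ∈ supportFace (ratPts S) y) (hq : q ∈ supportFace (ratPts S) y) (hpq : p ≠ q) :
    HasBoundedEdge (polyhedronOf S) := by
  obtain ⟨y', hy', p', hp', q', hq', hpq', hcol⟩ :=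
    exists_collinear_face (ratPts_finite S) _ y hy rfl ⟨p, hp, q, hq, hpq⟩
  have hface := supportFace_polyhedronOf (S := S) hy'
  have hsub : ∀ s ∈ supportFace (polyhedronOf S) y', ∃ t : ℝ, s = p' + t • (q' - p') := by
    rw [hface]
    exact convexHull_min hcol (convex_line p' (q' - p'))
  have hp'' : p' ∈ supportFace (polyhedronOf S) y' := hface ▸ subset_convexHull _ _ hp'
  have hq'' : q' ∈ supportFace (polyhedronOf S) y' := hface ▸ subset_convexHull _ _ hq'
  exact ⟨_, ⟨⟨p', hp''⟩, y', rfl⟩, isBounded_supportFace_polyhedronOf hy',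
    dimOf_eq_one hp'' hq'' hpq' hsub⟩

/-- A polyhedron without bounded edges is a shifted orthant: otherwise two different points are
minimum points of positive covectors, and an intermediate covector has several minimum points. -/
theorem IsLocalPolyhedron.eq_shift {P : Set (ι → ℝ)} (hP : IsLocalPolyhedron P)
    (h : ¬ HasBoundedEdge P) : ∃ v : ι → ℚ, P = polyhedronOf {v} := by
  classical
  obtain ⟨S, hS, rfl⟩ := hP
  have hone : ∀ i : ι, (0 : ℝ) < (1 : ι → ℝ) i := fun _ => zero_lt_one
  obtain ⟨p, hp, hmin⟩ := exists_min_dotProduct (ratPts_finite S) (ratPts_nonempty hS) 1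
  have hstrict : ∀ s ∈ ratPts S, s ≠ p → (1 : ι → ℝ) ⬝ᵥ p < 1 ⬝ᵥ s := by
    intro s hs hsp
    refine (hmin s hs).lt_of_ne fun heq => h ?_
    exact hasBoundedEdge_of_two_minima hone ⟨hs, fun t ht => heq ▸ hmin t ht⟩ ⟨hp, hmin⟩ hsp
  have hle : ∀ s ∈ ratPts S, s - p ∈ orthant ι := by
    intro s hs i
    by_contra! hneg
    -- a positive covector for which the `i`-th coordinate dominates
    set K : ℝ := (|(1 : ι → ℝ) ⬝ᵥ (s - p)| + 1) / (-(s - p) i) with hK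
    have hK0 : 0 < K := div_pos (by positivity) (by linarith)
    have hKm : K * (s - p) i = -(|(1 : ι → ℝ) ⬝ᵥ (s - p)| + 1) := by
      rw [hK]
      have := hneg.ne
      field_simp
    have hlt : ((1 : ι → ℝ) + Pi.single i K) ⬝ᵥ (s - p) < 0 := by
      rw [add_dotProduct, single_dotProduct, hKm]
      linarith [le_abs_self ((1 : ι → ℝ) ⬝ᵥ (s - p))]
    rw [dotProduct_sub] at hlt
    obtain ⟨t, ht0, ht1, hz, q, hq, hqp, hzq⟩ :=
      exists_rotate (u := (1 : ι → ℝ) + Pi.single i K) (ratPts_finite S) hstrict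
        ⟨s, hs, by linarith⟩
    have hpos : ∀ j, 0 < ((1 - t) • (1 : ι → ℝ) + t • ((1 : ι → ℝ) + Pi.single i K) : ι → ℝ) j := by
      intro j
      have h1 := single_mem_orthant (i := i) hK0.le j
      simp only [Pi.add_apply, Pi.smul_apply, Pi.one_apply, smul_eq_mul]
      nlinarith
    generalize (1 - t) • (1 : ι → ℝ) + t • ((1 : ι → ℝ) + Pi.single i K) = z at hpos hz hzq
    exact h (hasBoundedEdge_of_two_minima hpos ⟨hp, hz⟩
      ⟨hq, fun r hr => hzq.le.trans (hz r hr)⟩ hqp.symm)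
  obtain ⟨v, hv, hvp⟩ := id hp
  refine ⟨v, ?_⟩
  rw [polyhedronOf_singleton, show (fun i => (v i : ℝ)) = p from hvp]
  ext x
  constructor
  · rintro ⟨a, ha, c, hc, rfl⟩
    have : a - p ∈ orthant ι := by
      have hconv : Convex ℝ {a : ι → ℝ | a - p ∈ orthant ι} := by
        intro x hx z hz a b ha hb hab i
        have h1 := mul_nonneg ha (hx i)
        have h2 := mul_nonneg hb (hz i)
        obtain rfl : a = 1 - b := by linarith
        simp only [Pi.sub_apply, Pi.add_apply, Pi.smul_apply, smul_eq_mul] at *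
        linarith
      exact convexHull_min (t := {a | a - p ∈ orthant ι}) hle hconv ha
    refine ⟨p, rfl, (a - p) + c, fun i => add_nonneg (this i) (hc i), ?_⟩
    change p + (a - p + c) = a + c
    abel
  · rintro ⟨_, rfl, c, hc, rfl⟩
    exact ⟨_, subset_convexHull _ _ hp, c, hc, rfl⟩

theorem eq_of_dotProduct_le {y X w : ι → ℝ} (hy : ∀ i, 0 < y i)
    (h : ∀ z : ι → ℝ, (∀ i, 0 ≤ z i) → z ⬝ᵥ w ≤ z ⬝ᵥ X) (h0 : y ⬝ᵥ w = y ⬝ᵥ X) : X = w := by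
  classical
  have hc : X - w ∈ orthant ι := fun i => by
    have := h (Pi.single i 1) (single_mem_orthant zero_le_one)
    simpa using this
  exact sub_eq_zero.1 (dotProduct_pos_of_pos hy hc (by rw [dotProduct_sub, h0, sub_self]))

/-- If a nonnegative combination of polyhedra has a linear support function, then its summands
have no bounded edges. -/
theorem not_hasBoundedEdge_of_linear {α : Type*} {s : Finset α} {c : α → ℕ}
    {P : α → LocalPolyhedron ι} {w : ι → ℝ}
    (h : ∀ (y : ι → ℝ) (hy : ∀ i, 0 ≤ y i), ∑ a ∈ s, (c a : ℝ) * supportHom hy (P a) = y ⬝ᵥ w)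
    {a : α} (ha : a ∈ s) (hca : c a ≠ 0) : ¬ HasBoundedEdge (P a).1 := by
  classical
  rintro ⟨F, ⟨hne, y, rfl⟩, hb, hdim⟩
  have hy : ∀ i, 0 < y i := fun i => pos_of_supportFace_isBounded
    (fun x hx t ht => (P a).2.add_mem hx (single_mem_orthant ht)) hne hb
  -- minimum points at `y` of all the summands, with an arbitrary choice for the summand `a`
  choose p hp using fun a => (P a).2.supportFace_nonempty (fun i => (hy i).le)
  have key : ∀ q ∈ supportFace (P a).1 y,
      ∑ b ∈ s, (c b : ℝ) • Function.update p a q b = w := by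
    intro q hq
    have hmem : ∀ b, Function.update p a q b ∈ supportFace (P b).1 y := by
      intro b
      rcases eq_or_ne b a with rfl | hb
      · simpa using hq
      · simpa [hb] using hp b
    refine eq_of_dotProduct_le hy (fun z hz => ?_) ?_
    · rw [← h z hz, dotProduct_sum]
      refine Finset.sum_le_sum fun b _ => ?_
      rw [dotProduct_smul, smul_eq_mul]
      exact mul_le_mul_of_nonneg_left (supportHom_le hz (P b) (hmem b).1) (Nat.cast_nonneg _)
    · rw [← h y (fun i => (hy i).le), dotProduct_sum]
      refine Finset.sum_congr rfl fun b _ => ?_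
      rw [dotProduct_smul, smul_eq_mul, supportHom_eq (fun i => (hy i).le) (P b) (hmem b)]
  have huniq : ∀ q ∈ supportFace (P a).1 y, ∀ q' ∈ supportFace (P a).1 y, q = q' := by
    intro q hq q' hq'
    have h1 := (key q hq).trans (key q' hq').symm
    rw [← Finset.add_sum_erase _ _ ha, ← Finset.add_sum_erase _ _ ha, Function.update_self,
      Function.update_self, Finset.sum_congr rfl (g := fun b => (c b : ℝ) • Function.update p a q' b)
      (fun b hb => by simp [Finset.ne_of_mem_erase hb])] at h1
    exact smul_right_injective _ (Nat.cast_ne_zero.2 hca) (add_right_cancel h1)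
  have : vectorSpan ℝ (supportFace (P a).1 y) = ⊥ :=
    vectorSpan_of_subsingleton ℝ fun q hq q' hq' => huniq q hq q' hq'
  rw [dimOf, this, finrank_bot] at hdim
  exact zero_ne_one hdim

end Edges

/-! ### Lattice volume -/

section LatticeVolume

open MeasureTheory

variable {ι : Type}

theorem IsLatticeBasis.exists_matrix {V : Submodule ℝ (ι → ℝ)} {k : ℕ} {b b' : Fin k → ι → ℤ}
    (hb : IsLatticeBasis V b) (hb' : IsLatticeBasis V b') :
    ∃ M : Matrix (Fin k) (Fin k) ℤ, |M.det| = 1 ∧ ∀ j, b' j = ∑ l, M j l • b l := by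
  choose M hM _ using fun j => hb.2 (b' j) (hb'.1 j)
  choose M' hM' _ using fun j => hb'.2 (b j) (hb.1 j)
  refine ⟨M, ?_, hM⟩
  have h : (Matrix.of M * Matrix.of M' : Matrix (Fin k) (Fin k) ℤ) = 1 := by
    ext i j
    have h1 : b' i = ∑ l, (Matrix.of M * Matrix.of M') i l • b' l := by
      conv_lhs => rw [hM i]
      simp only [Matrix.mul_apply, Finset.sum_smul, Matrix.of_apply]
      rw [Finset.sum_comm]
      refine Finset.sum_congr rfl fun l _ => ?_
      conv_lhs => rw [hM' l]
      simp [Finset.smul_sum, mul_smul]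
    have h2 : b' i = ∑ l, (1 : Matrix (Fin k) (Fin k) ℤ) i l • b' l := by
      simp [Matrix.one_apply]
    exact congrFun ((hb'.2 (b' i) (hb'.1 i)).unique h1 h2) j
  have := congrArg Matrix.det h
  rw [Matrix.det_mul, Matrix.det_one] at this
  exact Int.isUnit_iff_abs_eq.1 (IsUnit.of_mul_eq_one _ this)

variable [Fintype ι]

/-- The real vector of an integer vector. -/
abbrev intVec {κ : Type} (z : κ → ℤ) : κ → ℝ := fun i => (z i : ℝ)

/-- An integer vector is primitive if some integer covector takes the value `1` at it. -/
def IsPrimitive (e : ι → ℤ) : Prop := ∃ c : ι → ℤ, c ⬝ᵥ e = 1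

theorem intVec_dotProduct (c e : ι → ℤ) : intVec c ⬝ᵥ intVec e = ((c ⬝ᵥ e : ℤ) : ℝ) := by
  simp [dotProduct]

theorem IsPrimitive.ne_zero {e : ι → ℤ} (he : IsPrimitive e) : intVec e ≠ 0 := by
  obtain ⟨c, hc⟩ := he
  intro h
  have h1 := intVec_dotProduct c e
  rw [h, dotProduct_zero, hc] at h1
  simp at h1

theorem isPrimitive_of_gcd {e : ι → ℤ} (he : Finset.univ.gcd e = 1) : IsPrimitive e := by
  obtain ⟨c, hc⟩ := Finset.gcd_eq_sum_mul Finset.univ e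
  refine ⟨c, ?_⟩
  rw [dotProduct_comm, dotProduct, ← hc, he]

theorem exists_primitive {z : ι → ℤ} (hz : z ≠ 0) :
    ∃ (e : ι → ℤ) (g : ℤ), 0 < g ∧ IsPrimitive e ∧ z = g • e := by
  obtain ⟨i, hi⟩ := Function.ne_iff.1 hz
  obtain ⟨e, he1, he2⟩ := Finset.extract_gcd z (⟨i, Finset.mem_univ i⟩ : Finset.univ.Nonempty)
  refine ⟨e, Finset.univ.gcd z, lt_of_le_of_ne' Finset.Int.finsetGcd_nonneg fun h => hi ?_,
    isPrimitive_of_gcd he2, funext fun j => he1 j (Finset.mem_univ j)⟩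
  exact Finset.gcd_eq_zero_iff.1 h i (Finset.mem_univ i)

theorem map_volume_frame {d : ℕ} (p : ι → ℝ) {M : Matrix (Fin d) (Fin d) ℝ} (hM : M.det ≠ 0)
    (w : Fin d → ι → ℝ) :
    Measure.map (fun t : Fin d → ℝ => p + ∑ j, t j • ∑ k, M j k • w k) volume =
      ENNReal.ofReal |M.det⁻¹| • Measure.map (fun t : Fin d → ℝ => p + ∑ k, t k • w k) volume := by
  have hdet : (M.transpose).det ≠ 0 := by rwa [Matrix.det_transpose]
  have h1 := Real.map_matrix_volume_pi_eq_smul_volume_pi hdet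
  rw [Matrix.det_transpose] at h1
  have hm : Measurable (fun t : Fin d → ℝ => p + ∑ k, t k • w k) :=
    Continuous.measurable (by fun_prop)
  rw [← Measure.map_smul, ← h1, Measure.map_map hm
    (LinearMap.continuous_of_finiteDimensional _).measurable]
  congr 1
  ext t i
  simp only [Function.comp_apply, Matrix.toLin'_apply, Matrix.mulVec, dotProduct,
    Matrix.transpose_apply, Pi.add_apply, Finset.sum_apply, Pi.smul_apply, smul_eq_mul,
    Finset.mul_sum, Finset.sum_mul]
  rw [Finset.sum_comm]
  congr 1
  exact Finset.sum_congr rfl fun k _ => Finset.sum_congr rfl fun j _ => by ring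

theorem map_volume_translate {d : ℕ} (p : ι → ℝ) (w : Fin d → ι → ℝ) (r : Fin d → ℝ) :
    Measure.map (fun t : Fin d → ℝ => (p + ∑ k, r k • w k) + ∑ k, t k • w k) volume =
      Measure.map (fun t : Fin d → ℝ => p + ∑ k, t k • w k) volume := by
  have hm : Measurable (fun t : Fin d → ℝ => p + ∑ k, t k • w k) :=
    Continuous.measurable (by fun_prop)
  conv_rhs => rw [← map_add_left_eq_self volume r,
    Measure.map_map hm (measurable_const_add r)]
  congr 1
  ext t i
  simp [add_smul, Finset.sum_add_distrib, add_assoc]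

/-- The lattice measure, computed in any basis of the lattice. -/
theorem latticeMeasure_eq {S : Set (ι → ℝ)} {d : ℕ} (hd : dimOf S = d) {p : ι → ℝ} (hp : p ∈ S)
    {b : Fin d → ι → ℤ} (hb : IsLatticeBasis (vectorSpan ℝ S) b)
    (hspan : ∀ q ∈ S, ∃ r : Fin d → ℝ, q = p + ∑ k, r k • intVec (b k)) :
    latticeMeasure S = d.factorial •
      Measure.map (fun t : Fin d → ℝ => p + ∑ k, t k • intVec (b k)) volume := by
  subst hd
  have h : ∃ q, IsLatticeFrame S q := ⟨(p, b), hp, hb⟩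
  rw [latticeMeasure, dif_pos h]
  congr 1
  obtain ⟨hq1, hq2⟩ := h.choose_spec
  generalize h.choose = q at hq1 hq2
  obtain ⟨r, hr⟩ := hspan _ hq1
  obtain ⟨M, hM, hMb⟩ := hb.exists_matrix hq2
  set MR : Matrix (Fin (dimOf S)) (Fin (dimOf S)) ℝ := M.map (Int.castRingHom ℝ) with hMR
  have hdet : |MR.det| = 1 := by
    rw [hMR, ← RingHom.mapMatrix_apply, ← RingHom.map_det, Int.coe_castRingHom, ← Int.cast_abs, hM,
      Int.cast_one]
  have hdet0 : MR.det ≠ 0 := fun h0 => by rw [h0, abs_zero] at hdet; exact zero_ne_one hdet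
  have hq : ∀ j, (fun i => (q.2 j i : ℝ)) = ∑ l, MR j l • intVec (b l) := by
    intro j
    ext i
    have := congrFun (hMb j) i
    simp only [Finset.sum_apply, Pi.smul_apply, smul_eq_mul] at this
    rw [this]
    simp [hMR]
  simp only [hq]
  rw [map_volume_frame _ hdet0, hr, map_volume_translate, abs_inv, hdet]
  simp

theorem isLatticeBasis_singleton {e : ι → ℤ} (he : IsPrimitive e) {V : Submodule ℝ (ι → ℝ)}
    (hV : V = Submodule.span ℝ {intVec e}) : IsLatticeBasis V (fun _ : Fin 1 => e) := by
  subst hV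
  obtain ⟨c, hc⟩ := id he
  refine ⟨fun _ => Submodule.mem_span_singleton_self _, fun z hz => ?_⟩
  obtain ⟨t, ht⟩ := Submodule.mem_span_singleton.1 hz
  have h1 : t = ((c ⬝ᵥ z : ℤ) : ℝ) := by
    rw [← intVec_dotProduct, show intVec z = t • intVec e from ht.symm, dotProduct_smul,
      intVec_dotProduct, hc]
    simp
  refine ⟨fun _ => c ⬝ᵥ z, ?_, fun k hk => ?_⟩
  · ext i
    have := congrFun ht i
    simp only [Pi.smul_apply, smul_eq_mul, h1] at this
    simp only [Finset.univ_unique, Finset.sum_singleton, Pi.smul_apply, smul_eq_mul]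
    exact_mod_cast this.symm
  · ext j
    rw [Subsingleton.elim j 0]
    simp only at hk
    have hk' : z = k 0 • e := by simpa using hk
    rw [hk', dotProduct_smul, hc, smul_eq_mul, mul_one]

/-- The segment `p + [0, l] e`. -/
def latticeSegment (p : ι → ℝ) (e : ι → ℤ) (l : ℝ) : Set (ι → ℝ) :=
  (fun s : ℝ => p + s • intVec e) '' Set.Icc 0 l

/-- A set is a segment of lattice length `l` in the direction of the vector `e`. -/
def IsLatticeSegment (e : ι → ℤ) (l : ℝ) (G : Set (ι → ℝ)) : Prop :=
  0 ≤ l ∧ ∃ p, G = latticeSegment p e l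

theorem IsLatticeSegment.add {e : ι → ℤ} {l l' : ℝ} {G G' : Set (ι → ℝ)}
    (h : IsLatticeSegment e l G) (h' : IsLatticeSegment e l' G') :
    IsLatticeSegment e (l + l') (G + G') := by
  obtain ⟨hl, p, rfl⟩ := h
  obtain ⟨hl', p', rfl⟩ := h'
  refine ⟨add_nonneg hl hl', p + p', ?_⟩
  ext x
  constructor
  · rintro ⟨_, ⟨s, ⟨hs0, hs1⟩, rfl⟩, _, ⟨t, ⟨ht0, ht1⟩, rfl⟩, rfl⟩
    refine ⟨s + t, ⟨by positivity, by linarith⟩, ?_⟩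
    simp only
    module
  · rintro ⟨s, ⟨hs0, hs1⟩, rfl⟩
    refine ⟨_, ⟨min s l, ⟨le_min hs0 hl, min_le_right _ _⟩, rfl⟩, _,
      ⟨s - min s l, ⟨sub_nonneg.2 (min_le_left _ _), ?_⟩, rfl⟩, ?_⟩
    · rcases min_cases s l with h | h <;> linarith
    · simp only
      module

theorem IsLatticeSegment.smul {e : ι → ℤ} {l c : ℝ} {G : Set (ι → ℝ)} (hc : 0 < c)
    (h : IsLatticeSegment e l G) : IsLatticeSegment e (c * l) (c • G) := by
  obtain ⟨hl, p, rfl⟩ := h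
  refine ⟨mul_nonneg hc.le hl, c • p, ?_⟩
  ext x
  constructor
  · rintro ⟨_, ⟨s, ⟨hs0, hs1⟩, rfl⟩, rfl⟩
    refine ⟨c * s, ⟨by positivity, mul_le_mul_of_nonneg_left hs1 hc.le⟩, ?_⟩
    simp only
    module
  · rintro ⟨s, ⟨hs0, hs1⟩, rfl⟩
    refine ⟨_, ⟨s / c, ⟨by positivity, (div_le_iff₀' hc).2 hs1⟩, rfl⟩, ?_⟩
    simp only [smul_add, smul_smul]
    rw [mul_div_cancel₀ _ hc.ne']

theorem vectorSpan_latticeSegment {p : ι → ℝ} {e : ι → ℤ} {l : ℝ} (hl : 0 < l) :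
    vectorSpan ℝ (latticeSegment p e l) = Submodule.span ℝ {intVec e} := by
  rw [vectorSpan_eq_span_singleton (p := p) (q := p + l • intVec e)
    (show p ∈ latticeSegment p e l from ⟨0, ⟨le_rfl, hl.le⟩, by simp⟩)
    (show _ ∈ latticeSegment p e l from ⟨l, ⟨hl.le, le_rfl⟩, rfl⟩) ?_]
  · rw [add_sub_cancel_left]
    exact Submodule.span_singleton_smul_eq (IsUnit.mk0 _ hl.ne') _
  · rintro _ ⟨s, -, rfl⟩
    refine ⟨s / l, ?_⟩
    simp only [add_sub_cancel_left, smul_smul]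
    rw [div_mul_cancel₀ _ hl.ne']

theorem dimOf_latticeSegment {p : ι → ℝ} {e : ι → ℤ} (he : IsPrimitive e) {l : ℝ} (hl : 0 < l) :
    dimOf (latticeSegment p e l) = 1 := by
  rw [dimOf, vectorSpan_latticeSegment hl]
  exact finrank_span_singleton he.ne_zero

theorem latticeMeasure_latticeSegment {p : ι → ℝ} {e : ι → ℤ} (he : IsPrimitive e) {l : ℝ}
    (hl : 0 < l) : latticeMeasure (latticeSegment p e l) =
      Measure.map (fun s : ℝ => p + s • intVec e) volume := by
  rw [latticeMeasure_eq (p := p) (dimOf_latticeSegment he hl) ⟨0, ⟨le_rfl, hl.le⟩, by simp⟩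
    (isLatticeBasis_singleton he (vectorSpan_latticeSegment hl))]
  · have h1 := (volume_preserving_funUnique (Fin 1) ℝ)
    rw [← h1.map_eq, Measure.map_map (Continuous.measurable (by fun_prop)) h1.measurable]
    simp only [Nat.factorial_one, one_smul]
    congr 1
    ext t i
    simp
  · rintro _ ⟨s, -, rfl⟩
    exact ⟨fun _ => s, by simp⟩

theorem measurableEmbedding_line (p : ι → ℝ) {e : ι → ℤ} (he : IsPrimitive e) :
    MeasurableEmbedding (fun s : ℝ => p + s • intVec e) := by
  obtain ⟨c, hc⟩ := he
  refine Topology.IsClosedEmbedding.measurableEmbedding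
    (Function.LeftInverse.isClosedEmbedding (f := fun x => intVec c ⬝ᵥ (x - p)) (fun s => ?_)
      ?_ (by fun_prop))
  · simp [dotProduct_smul, intVec_dotProduct, hc]
  · unfold dotProduct
    fun_prop

theorem setIntegral_latticeSegment {E : Type*} [NormedAddCommGroup E] [NormedSpace ℝ E]
    {p : ι → ℝ} {e : ι → ℤ} (he : IsPrimitive e) {l : ℝ} (hl : 0 < l) (f : (ι → ℝ) → E) :
    ∫ x in latticeSegment p e l, f x ∂(latticeMeasure (latticeSegment p e l)) =
      ∫ s in (0 : ℝ)..l, f (p + s • intVec e) := by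
  have hm := measurableEmbedding_line p he
  rw [latticeMeasure_latticeSegment he hl, hm.setIntegral_map,
    intervalIntegral.integral_of_le hl.le, integral_Icc_eq_integral_Ioc.symm]
  congr 2
  exact Set.preimage_image_eq _ hm.injective

theorem latticeVolume_latticeSegment {p : ι → ℝ} {e : ι → ℤ} (he : IsPrimitive e) {l : ℝ}
    (hl : 0 < l) : latticeVolume (latticeSegment p e l) = l := by
  have hm := measurableEmbedding_line p he
  rw [latticeVolume, latticeMeasure_latticeSegment he hl, hm.map_apply, latticeSegment,
    Set.preimage_image_eq _ hm.injective, Real.volume_Icc, sub_zero,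
    ENNReal.toReal_ofReal hl.le]

open Classical in
/-- The lattice length of a segment, and zero for sets of other dimensions. -/
noncomputable def latticeLength (G : Set (ι → ℝ)) : ℝ :=
  if dimOf G = 1 then latticeVolume G else 0

theorem latticeLength_nonneg (G : Set (ι → ℝ)) : 0 ≤ latticeLength G := by
  rw [latticeLength]
  split_ifs
  · exact ENNReal.toReal_nonneg
  · exact le_rfl

theorem dimOf_singleton (p : ι → ℝ) : dimOf ({p} : Set (ι → ℝ)) = 0 := by
  rw [dimOf, vectorSpan_singleton, finrank_bot]

theorem latticeSegment_zero (p : ι → ℝ) (e : ι → ℤ) : latticeSegment p e 0 = {p} := by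
  simp [latticeSegment]

theorem IsLatticeSegment.latticeLength_eq {e : ι → ℤ} {l : ℝ} {G : Set (ι → ℝ)}
    (he : IsPrimitive e) (h : IsLatticeSegment e l G) : latticeLength G = l := by
  obtain ⟨hl, p, rfl⟩ := h
  rw [latticeLength]
  rcases hl.eq_or_lt with rfl | hl
  · rw [latticeSegment_zero, dimOf_singleton, if_neg zero_ne_one]
  · rw [if_pos (dimOf_latticeSegment he hl), latticeVolume_latticeSegment he hl]

/-- A compact convex subset of a line is a segment. -/
theorem isLatticeSegment_of_compact {e : ι → ℤ} (he : IsPrimitive e) {G : Set (ι → ℝ)}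
    (hne : G.Nonempty) (hcomp : IsCompact G) (hconv : Convex ℝ G)
    (h : ∀ x ∈ G, ∀ y ∈ G, ∃ t : ℝ, y = x + t • intVec e) : ∃ l, IsLatticeSegment e l G := by
  obtain ⟨x₀, hx₀⟩ := hne
  obtain ⟨c, hc⟩ := he
  have hval : ∀ t : ℝ, intVec c ⬝ᵥ (x₀ + t • intVec e - x₀) = t := fun t => by
    simp [dotProduct_smul, intVec_dotProduct, hc]
  have hcont : Continuous fun x => intVec c ⬝ᵥ (x - x₀) := by
    unfold dotProduct
    fun_prop
  have hI := eq_Icc_of_connected_compact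
    ((hconv.isConnected ⟨x₀, hx₀⟩).image _ hcont.continuousOn) (hcomp.image hcont)
  set T := (fun x => intVec c ⬝ᵥ (x - x₀)) '' G with hT
  have hmem : ∀ t, t ∈ T ↔ x₀ + t • intVec e ∈ G := by
    intro t
    constructor
    · rintro ⟨x, hx, rfl⟩
      obtain ⟨t, rfl⟩ := h x₀ hx₀ x hx
      simp only [hval]
      exact hx
    · intro ht
      exact ⟨_, ht, hval t⟩
  have h0 : (0 : ℝ) ∈ T := (hmem 0).2 (by simpa using hx₀)
  have hle : sInf T ≤ sSup T := by
    rw [hI] at h0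
    exact h0.1.trans h0.2
  refine ⟨sSup T - sInf T, by linarith, x₀ + sInf T • intVec e, ?_⟩
  ext x
  constructor
  · intro hx
    obtain ⟨t, rfl⟩ := h x₀ hx₀ x hx
    have ht := (hmem t).2 hx
    rw [hI] at ht
    refine ⟨t - sInf T, ⟨by linarith [ht.1], by linarith [ht.2]⟩, ?_⟩
    simp only
    module
  · rintro ⟨s, ⟨hs0, hs1⟩, rfl⟩
    have : x₀ + sInf T • intVec e + s • intVec e = x₀ + (sInf T + s) • intVec e := by module
    simp only [this]
    have : sInf T + s ∈ Set.Icc (sInf T) (sSup T) := ⟨by linarith, by linarith⟩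
    rw [← hI] at this
    exact (hmem _).1 this

end LatticeVolume

/-! ### Bounded faces of lattice polyhedra -/

section LatticePolyhedra

variable {κ : Type} [Fintype κ]

/-- The real points of a finite set of lattice points. -/
abbrev natPts (T : Finset (κ → ℕ)) : Set (κ → ℝ) :=
  (fun (a : κ → ℕ) (i : κ) => (a i : ℝ)) '' (T : Set (κ → ℕ))

/-- The Newton polyhedron of a finite set of lattice points, over an arbitrary index set. -/
def natPolyhedron (T : Finset (κ → ℕ)) : Set (κ → ℝ) := convexHull ℝ (natPts T) + orthant κ

theorem natPts_finite (T : Finset (κ → ℕ)) : (natPts T).Finite := T.finite_toSet.image _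

theorem natPts_subset (T : Finset (κ → ℕ)) : natPts T ⊆ natPolyhedron T := fun x hx =>
  ⟨x, subset_convexHull _ _ hx, 0, zero_mem_orthant, add_zero x⟩

theorem natPolyhedron_add_mem {T : Finset (κ → ℕ)} {x c : κ → ℝ} (hx : x ∈ natPolyhedron T)
    (hc : c ∈ orthant κ) : x + c ∈ natPolyhedron T := by
  obtain ⟨p, hp, d, hd, rfl⟩ := hx
  exact ⟨p, hp, d + c, fun i => add_nonneg (hd i) (hc i), (add_assoc _ _ _).symm⟩

theorem natPolyhedron_subset_orthant (T : Finset (κ → ℕ)) : natPolyhedron T ⊆ orthant κ := by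
  rintro _ ⟨p, hp, d, hd, rfl⟩ i
  have : p ∈ orthant κ := convexHull_min (by rintro _ ⟨a, -, rfl⟩ j; exact Nat.cast_nonneg _)
    convex_orthant hp
  exact add_nonneg (this i) (hd i)

theorem convex_natPolyhedron (T : Finset (κ → ℕ)) : Convex ℝ (natPolyhedron T) :=
  (convex_convexHull ℝ _).add convex_orthant

theorem supportFace_natPolyhedron_pos {T : Finset (κ → ℕ)} {v : κ → ℝ}
    (h : (supportFace (natPolyhedron T) v).Nonempty)
    (hb : Bornology.IsBounded (supportFace (natPolyhedron T) v)) (i : κ) : 0 < v i := by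
  classical
  exact pos_of_supportFace_isBounded
    (fun x hx t ht => natPolyhedron_add_mem hx (single_mem_orthant ht)) h hb

theorem supportFace_natPolyhedron {T : Finset (κ → ℕ)} {v : κ → ℝ} (hv : ∀ i, 0 < v i) :
    supportFace (natPolyhedron T) v =
      convexHull ℝ {x ∈ natPts T | x ∈ supportFace (natPolyhedron T) v} := by
  rcases T.eq_empty_or_nonempty with rfl | hT
  · simp [natPolyhedron, natPts, supportFace]
  obtain ⟨s, hs, hmin⟩ := exists_min_dotProduct (natPts_finite T) (hT.to_set.image _) v
  have h := supportFace_convexHull_add_orthant hv hs hmin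
  have hs' : s ∈ supportFace (natPolyhedron T) v := by
    rw [natPolyhedron, h]
    exact subset_convexHull _ _ ⟨hs, rfl⟩
  conv_lhs => rw [natPolyhedron, h]
  congr 1
  ext x
  constructor
  · rintro ⟨hx, hxv⟩
    exact ⟨hx, natPts_subset T hx, fun y hy => hxv.le.trans (hs'.2 y hy)⟩
  · rintro ⟨hx, hx'⟩
    exact ⟨hx, le_antisymm (hx'.2 s hs'.1) (hmin x hx)⟩

/-- A bounded face of a lattice polyhedron is the convex hull of lattice points. -/
theorem boundedFace_eq_convexHull {T : Finset (κ → ℕ)} {B : Set (κ → ℝ)}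
    (hB : IsFace (natPolyhedron T) B) (hb : Bornology.IsBounded B) :
    B = convexHull ℝ {x ∈ natPts T | x ∈ B} := by
  obtain ⟨hne, v, rfl⟩ := hB
  exact supportFace_natPolyhedron (supportFace_natPolyhedron_pos hne hb)

theorem boundedFace_isCompact {T : Finset (κ → ℕ)} {B : Set (κ → ℝ)}
    (hB : IsFace (natPolyhedron T) B) (hb : Bornology.IsBounded B) : IsCompact B := by
  rw [boundedFace_eq_convexHull hB hb]
  exact ((natPts_finite T).subset fun x hx => hx.1).isCompact_convexHull ℝ

theorem finite_boundedFaces (T : Finset (κ → ℕ)) :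
    {B | IsFace (natPolyhedron T) B ∧ Bornology.IsBounded B}.Finite := by
  refine Set.Finite.of_finite_image (f := fun B => {x ∈ natPts T | x ∈ B})
    ((natPts_finite T).finite_subsets.subset ?_) ?_
  · rintro _ ⟨B, -, rfl⟩
    exact fun x hx => hx.1
  · rintro B ⟨h1, h2⟩ B' ⟨h1', h2'⟩ h
    rw [boundedFace_eq_convexHull h1 h2, boundedFace_eq_convexHull h1' h2']
    exact congrArg _ h

theorem exists_intVec_of_mem_natPts {T : Finset (κ → ℕ)} {x : κ → ℝ} (hx : x ∈ natPts T) :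
    ∃ z : κ → ℤ, intVec z = x := by
  obtain ⟨a, -, rfl⟩ := hx
  exact ⟨fun i => a i, by ext i; simp⟩

theorem intVec_injective : Function.Injective (intVec : (κ → ℤ) → κ → ℝ) := fun _ _ h =>
  funext fun i => Int.cast_injective (congrFun h i)

theorem intVec_add_nsmul (p b : κ → ℤ) (k : ℕ) :
    intVec (p + k • b) = intVec p + (k : ℝ) • intVec b := by
  ext i
  change ((p i + k • b i : ℤ) : ℝ) = (p i : ℝ) + (k : ℝ) * (b i : ℝ)
  push_cast [nsmul_eq_mul]
  rfl

/-- A bounded edge of a lattice polyhedron is a lattice segment with lattice endpoints. -/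
theorem exists_edge_param {T : Finset (κ → ℕ)} {B : Set (κ → ℝ)}
    (hB : IsBoundedEdge (natPolyhedron T) B) :
    ∃ (p b : κ → ℤ) (L : ℕ), 0 < L ∧ IsPrimitive b ∧ B = latticeSegment (intVec p) b L ∧
      intVec p ∈ natPts T ∧ intVec (p + L • b) ∈ natPts T := by
  obtain ⟨hF, hb, hdim⟩ := hB
  have hconv := boundedFace_eq_convexHull hF hb
  set TB := {x ∈ natPts T | x ∈ B} with hTB
  have hTBfin : TB.Finite := (natPts_finite T).subset fun x hx => hx.1
  have hTBne : TB.Nonempty := by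
    rw [← convexHull_nonempty_iff (𝕜 := ℝ), ← hconv]
    exact hF.1
  -- two different lattice points on the edge give its direction
  obtain ⟨x, hx, y, hy, hxy⟩ : ∃ x ∈ TB, ∃ y ∈ TB, x ≠ y := by
    by_contra! hcon
    obtain ⟨x, hx⟩ := hTBne
    have : B = {x} := by
      rw [hconv, show TB = {x} from Set.eq_singleton_iff_unique_mem.2
        ⟨hx, fun y hy => hcon y hy x hx⟩, convexHull_singleton]
    rw [this, dimOf_singleton] at hdim
    exact zero_ne_one hdim
  obtain ⟨zx, hzx⟩ := exists_intVec_of_mem_natPts hx.1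
  obtain ⟨zy, hzy⟩ := exists_intVec_of_mem_natPts hy.1
  obtain ⟨e, g, hg, he, hge⟩ := exists_primitive (z := zy - zx) (fun h => hxy (by
    rw [← hzx, ← hzy, sub_eq_zero.1 h]))
  have hyx : y - x = (g : ℝ) • intVec e := by
    rw [← hzx, ← hzy]
    ext i
    have := congrFun hge i
    simp only [Pi.sub_apply, Pi.smul_apply, smul_eq_mul] at *
    exact_mod_cast this
  have hspan : Submodule.span ℝ {intVec e} = vectorSpan ℝ B := by
    have hle : Submodule.span ℝ {intVec e} ≤ vectorSpan ℝ B := by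
      rw [Submodule.span_singleton_le_iff_mem]
      have : intVec e = (g : ℝ)⁻¹ • (y - x) := by
        rw [hyx, smul_smul, inv_mul_cancel₀ (by exact_mod_cast hg.ne'), one_smul]
      rw [this]
      exact Submodule.smul_mem _ _ (vsub_mem_vectorSpan ℝ hy.2 hx.2)
    refine Submodule.eq_of_le_of_finrank_eq hle ?_
    rw [finrank_span_singleton he.ne_zero]
    exact hdim.symm
  obtain ⟨l, hl, p, hp⟩ := isLatticeSegment_of_compact he hF.1 (boundedFace_isCompact hF hb)
    (hconv ▸ convex_convexHull ℝ _) (fun x hx y hy => by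
      have := vsub_mem_vectorSpan ℝ hy hx
      rw [← hspan] at this
      obtain ⟨t, ht⟩ := Submodule.mem_span_singleton.1 this
      exact ⟨t, by rw [ht, vsub_eq_sub]; abel⟩)
  obtain ⟨c, hc⟩ := id he
  have hval : ∀ s : ℝ, intVec c ⬝ᵥ (p + s • intVec e) = intVec c ⬝ᵥ p + s := fun s => by
    rw [dotProduct_add, dotProduct_smul, intVec_dotProduct, hc]
    simp
  have hpB : p ∈ B := by rw [hp]; exact ⟨0, ⟨le_rfl, hl⟩, by simp⟩
  have hqB : p + l • intVec e ∈ B := by rw [hp]; exact ⟨l, ⟨hl, le_rfl⟩, rfl⟩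
  -- both endpoints are extremal among the lattice points of the edge
  have hpT : p ∈ TB := by
    obtain ⟨t, ht, hmin⟩ := exists_min_dotProduct hTBfin hTBne (intVec c)
    have h1 := le_dotProduct_of_mem_convexHull hmin (hconv ▸ hpB)
    have ht' := ht.2
    rw [hp] at ht'
    obtain ⟨s, ⟨hs0, -⟩, hs⟩ := ht'
    simp only at hs
    rw [← hs, hval] at h1
    obtain rfl : s = 0 := by linarith
    rw [zero_smul, add_zero] at hs
    rwa [hs]
  have hqT : p + l • intVec e ∈ TB := by
    obtain ⟨t, ht, hmin⟩ := exists_min_dotProduct hTBfin hTBne (-intVec c)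
    have h1 := le_dotProduct_of_mem_convexHull hmin (hconv ▸ hqB)
    have ht' := ht.2
    rw [hp] at ht'
    obtain ⟨s, ⟨hs0, hs1⟩, hs⟩ := ht'
    simp only at hs
    rw [← hs, neg_dotProduct, neg_dotProduct, hval, hval] at h1
    obtain rfl : s = l := by linarith
    rwa [hs]
  obtain ⟨zp, hzp⟩ := exists_intVec_of_mem_natPts hpT.1
  obtain ⟨zq, hzq⟩ := exists_intVec_of_mem_natPts hqT.1
  have hlz : l = ((c ⬝ᵥ (zq - zp) : ℤ) : ℝ) := by
    have h1 := hval l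
    rw [← hzq, ← hzp, intVec_dotProduct, intVec_dotProduct] at h1
    rw [dotProduct_sub]
    push_cast
    linarith
  have hl0 : 0 < l := by
    refine hl.lt_of_ne fun h => ?_
    rw [hp, ← h, latticeSegment_zero, dimOf_singleton] at hdim
    exact zero_ne_one hdim
  obtain ⟨L, hL⟩ := Int.eq_ofNat_of_zero_le (a := c ⬝ᵥ (zq - zp))
    (by rw [hlz] at hl; exact_mod_cast hl)
  have hlL : l = (L : ℝ) := by rw [hlz, hL]; simp
  refine ⟨zp, e, L, ?_, he, ?_, hzp ▸ hpT.1, ?_⟩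
  · rw [hlL] at hl0
    exact_mod_cast hl0
  · rw [hzp, ← hlL, hp]
  · have : intVec (zp + L • e) = p + l • intVec e := by
      rw [← hzp, hlL, intVec_add_nsmul]
    rw [this]
    exact hqT.1

/-- The lattice points of a lattice segment. -/
theorem mem_latticeSegment_iff {p b a : κ → ℤ} (hb : IsPrimitive b) {L : ℕ} :
    intVec a ∈ latticeSegment (intVec p) b L ↔ ∃ k : ℕ, k ≤ L ∧ a = p + k • b := by
  constructor
  · rintro ⟨s, ⟨hs0, hs1⟩, hs⟩
    obtain ⟨c, hc⟩ := hb
    have h1 : s = ((c ⬝ᵥ (a - p) : ℤ) : ℝ) := by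
      have := congrArg (fun x => intVec c ⬝ᵥ x) hs
      simp only [dotProduct_add, dotProduct_smul, intVec_dotProduct, hc, smul_eq_mul] at this
      rw [dotProduct_sub]
      push_cast
      simp at this
      linarith
    obtain ⟨k, hk⟩ := Int.eq_ofNat_of_zero_le (a := c ⬝ᵥ (a - p))
      (by rw [h1] at hs0; exact_mod_cast hs0)
    rw [hk] at h1
    simp only [Int.cast_natCast] at h1
    refine ⟨k, by rw [h1] at hs1; exact_mod_cast hs1, ?_⟩
    refine intVec_injective ?_
    rw [intVec_add_nsmul, ← h1]
    exact hs.symm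
  · rintro ⟨k, hk, rfl⟩
    exact ⟨k, ⟨Nat.cast_nonneg _, by exact_mod_cast hk⟩, (intVec_add_nsmul p b k).symm⟩

theorem finrank_dotProduct_eq_zero {u : κ → ℝ} (hu : u ≠ 0) (W : Submodule ℝ (κ → ℝ))
    (hW : ∀ x, x ∈ W ↔ u ⬝ᵥ x = 0) : Module.finrank ℝ W + 1 = Fintype.card κ := by
  classical
  have hf : (dotProductBilin ℝ ℝ u : (κ → ℝ) →ₗ[ℝ] ℝ) ≠ 0 := by
    intro h
    exact hu (dotProduct_self_eq_zero.1 (by simpa using LinearMap.congr_fun h u))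
  have : W = LinearMap.ker (dotProductBilin ℝ ℝ u : (κ → ℝ) →ₗ[ℝ] ℝ) := by
    ext x
    simp [hW]
  rw [this, Module.Dual.finrank_ker_add_one_of_ne_zero hf, Module.finrank_fintype_fun_eq_card]

end LatticePolyhedra

/-! ### Contributing faces of a polygon -/

section Polygons

variable {κ : Type} [Fintype κ]

theorem vectorSpan_supportFace {P : Set (κ → ℝ)} {v x : κ → ℝ}
    (hx : x ∈ vectorSpan ℝ (supportFace P v)) : v ⬝ᵥ x = 0 := by
  have : vectorSpan ℝ (supportFace P v) ≤
      LinearMap.ker (dotProductBilin ℝ ℝ v : (κ → ℝ) →ₗ[ℝ] ℝ) := by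
    rw [vectorSpan_def, Submodule.span_le]
    rintro _ ⟨a, ha, b, hb, rfl⟩
    simp [dotProduct_sub, le_antisymm (ha.2 b hb.1) (hb.2 a ha.1)]
  simpa using this hx

theorem eq_singleton_of_dimOf_eq_zero {F : Set (κ → ℝ)} (h : dimOf F = 0) {x : κ → ℝ}
    (hx : x ∈ F) : F = {x} := by
  refine Set.eq_singleton_iff_unique_mem.2 ⟨hx, fun y hy => ?_⟩
  have h1 := vsub_mem_vectorSpan ℝ hy hx
  rw [Submodule.finrank_eq_zero.1 h, Submodule.mem_bot] at h1
  exact sub_eq_zero.1 h1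

theorem boundedFace_singleton_mem {T : Finset (κ → ℕ)} {x : κ → ℝ}
    (h : IsFace (natPolyhedron T) {x}) : x ∈ natPts T := by
  have h1 := boundedFace_eq_convexHull h Bornology.isBounded_singleton
  have hne : {y ∈ natPts T | y ∈ ({x} : Set (κ → ℝ))}.Nonempty := by
    rw [← convexHull_nonempty_iff (𝕜 := ℝ), ← h1]
    exact Set.singleton_nonempty x
  obtain ⟨y, hy, rfl⟩ := hne
  exact hy

/-- A bounded face of a lattice polygon is a vertex or an edge. -/
theorem boundedFace_cases (hκ : Fintype.card κ = 2) {T : Finset (κ → ℕ)} {B : Set (κ → ℝ)}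
    (hB : IsFace (natPolyhedron T) B) (hb : Bornology.IsBounded B) :
    (∃ a : κ → ℤ, B = {intVec a}) ∨ IsBoundedEdge (natPolyhedron T) B := by
  have hdim : dimOf B ≤ 1 := by
    obtain ⟨hne, v, rfl⟩ := hB
    have hv := supportFace_natPolyhedron_pos hne hb
    have hv0 : v ≠ 0 := by
      rintro rfl
      obtain ⟨i⟩ : Nonempty κ := Fintype.card_pos_iff.1 (by omega)
      exact lt_irrefl _ (hv i)
    have h1 := finrank_dotProduct_eq_zero hv0
      (LinearMap.ker (dotProductBilin ℝ ℝ v : (κ → ℝ) →ₗ[ℝ] ℝ)) (by simp)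
    have h2 : dimOf (supportFace (natPolyhedron T) v) ≤
        Module.finrank ℝ (LinearMap.ker (dotProductBilin ℝ ℝ v : (κ → ℝ) →ₗ[ℝ] ℝ)) :=
      Submodule.finrank_mono fun x hx => by simpa using vectorSpan_supportFace hx
    omega
  rcases Nat.le_one_iff_eq_zero_or_eq_one.1 hdim with h | h
  · left
    obtain ⟨x, hx⟩ := hB.1
    have h1 := eq_singleton_of_dimOf_eq_zero h hx
    rw [h1] at hB
    obtain ⟨z, hz⟩ := exists_intVec_of_mem_natPts (boundedFace_singleton_mem hB)
    exact ⟨z, by rw [hz, h1]⟩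
  · exact Or.inr ⟨hB, hb, h⟩

theorem exists_pair (hκ : Fintype.card κ = 2) (i : κ) :
    ∃ j, j ≠ i ∧ (∀ k, k = i ∨ k = j) ∧ ∀ u x : κ → ℝ, u ⬝ᵥ x = u i * x i + u j * x j := by
  classical
  obtain ⟨a, b, hab, huniv⟩ := Finset.card_eq_two.1 (Finset.card_univ.trans hκ)
  have hall : ∀ k : κ, k = a ∨ k = b := fun k => by
    have := Finset.mem_univ k
    rw [huniv] at this
    simpa using this
  have hdot : ∀ u x : κ → ℝ, u ⬝ᵥ x = u a * x a + u b * x b := fun u x => by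
    rw [dotProduct, huniv, Finset.sum_pair hab]
  rcases hall i with rfl | rfl
  · exact ⟨b, hab.symm, hall, hdot⟩
  · exact ⟨a, hab, fun k => (hall k).symm, fun u x => by rw [hdot, add_comm]⟩

/-- A `V`-vertex of a polygon lies on a coordinate axis, at a positive integer. -/
theorem exists_axis_of_isVFace (hκ : Fintype.card κ = 2) {T : Finset (κ → ℕ)}
    (h0 : (0 : κ → ℝ) ∉ natPolyhedron T) {x : κ → ℝ} (hx : IsVFace (natPolyhedron T) {x}) :
    ∃ i j, j ≠ i ∧ (∀ k, k = i ∨ k = j) ∧ (∀ u y : κ → ℝ, u ⬝ᵥ y = u i * y i + u j * y j) ∧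
      x j = 0 ∧ ∃ c : ℕ, 0 < c ∧ x i = c := by
  obtain ⟨hF, J, hJ, hxJ⟩ := hx
  rw [dimOf_singleton, zero_add, Finset.card_eq_one] at hJ
  obtain ⟨i, rfl⟩ := hJ
  obtain ⟨j, hji, hall, hdot⟩ := exists_pair hκ i
  have hxj : x j = 0 := hxJ x rfl j (by simpa using hji)
  have hxT := boundedFace_singleton_mem hF
  refine ⟨i, j, hji, hall, hdot, hxj, ?_⟩
  obtain ⟨a, ha, rfl⟩ := id hxT
  refine ⟨a i, Nat.pos_of_ne_zero fun hai => h0 ?_, rfl⟩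
  have : (fun k => (a k : ℝ)) = 0 := by
    ext k
    rcases hall k with rfl | rfl
    · simp [hai]
    · exact hxj
  rw [← this]
  exact natPts_subset T hxT

theorem latticeDist_axis {i j : κ} (hall : ∀ k, k = i ∨ k = j) {x : κ → ℝ}
    (hdot : ∀ u y : κ → ℝ, u ⬝ᵥ y = u i * y i + u j * y j) (hxj : x j = 0) {c : ℕ}
    (hc : 0 < c) (hxi : x i = c) : latticeDist {x} = c := by
  classical
  have hset : {d : ℕ | ∃ l : κ → ℤ, Finset.univ.gcd l = 1 ∧
      (∀ i, (∀ z ∈ ({x} : Set (κ → ℝ)), z i = 0) → l i = 0) ∧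
        ∀ z ∈ ({x} : Set (κ → ℝ)), ∑ i, (l i : ℝ) * z i = d} = {c} := by
    refine Set.eq_singleton_iff_unique_mem.2 ⟨⟨Pi.single i 1, ?_, ?_, ?_⟩, ?_⟩
    · have hd : Finset.univ.gcd (Pi.single i (1 : ℤ) : κ → ℤ) ∣ 1 := by
        simpa using Finset.gcd_dvd (f := (Pi.single i (1 : ℤ) : κ → ℤ)) (Finset.mem_univ i)
      exact Int.eq_one_of_dvd_one Finset.Int.finsetGcd_nonneg hd
    · intro k hk
      have : k ≠ i := by
        rintro rfl
        have := hk x rfl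
        rw [hxi, Nat.cast_eq_zero] at this
        omega
      simp [this]
    · intro z hz
      rw [Set.mem_singleton_iff.1 hz]
      have := hdot (intVec (Pi.single i 1)) x
      rw [dotProduct] at this
      rw [this, hxj, hxi]
      simp [intVec]
    · rintro d ⟨l, hgcd, hl, hd⟩
      have hlj : l j = 0 := hl j (by rintro _ rfl; exact hxj)
      have h1 := hd x rfl
      have h2 := hdot (intVec l) x
      rw [dotProduct] at h2
      rw [h2, hxj, hxi, mul_zero, add_zero] at h1
      change (l i : ℝ) * c = d at h1
      have h3 : l i * c = d := by exact_mod_cast h1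
      have h4 : l i ∣ Finset.univ.gcd l := Finset.dvd_gcd fun k _ => by
        rcases hall k with rfl | rfl
        · exact dvd_rfl
        · simp [hlj]
      rw [hgcd] at h4
      have h5 : l i = 1 := by
        refine Int.eq_one_of_dvd_one ?_ h4
        by_contra! hneg
        have : l i * c < 0 := mul_neg_of_neg_of_pos hneg (by exact_mod_cast hc)
        omega
      rw [h5, one_mul] at h3
      exact_mod_cast h3.symm
  rw [latticeDist, hset, csInf_singleton]

theorem dvd_latticeDist_of_axis {i j : κ} {x : κ → ℝ}
    (hdot : ∀ u y : κ → ℝ, u ⬝ᵥ y = u i * y i + u j * y j) (hxj : x j = 0) {c : ℕ}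
    (hxi : x i = c) {B : Set (κ → ℝ)} (hxB : x ∈ B) : c ∣ latticeDist B := by
  rw [latticeDist]
  set S := {d : ℕ | ∃ l : κ → ℤ, Finset.univ.gcd l = 1 ∧
    (∀ i, (∀ x ∈ B, x i = 0) → l i = 0) ∧ ∀ x ∈ B, ∑ i, (l i : ℝ) * x i = d} with hS
  rcases S.eq_empty_or_nonempty with h | h
  · rw [h, Nat.sInf_empty]
    exact dvd_zero c
  · obtain ⟨l, -, -, hl⟩ := Nat.sInf_mem h
    have h1 := hl x hxB
    have h2 := hdot (intVec l) x
    rw [dotProduct] at h2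
    rw [h2, hxj, hxi, mul_zero, add_zero] at h1
    change (l i : ℝ) * c = (sInf S : ℕ) at h1
    have h3 : l i * c = (sInf S : ℕ) := by exact_mod_cast h1
    exact Int.natCast_dvd_natCast.1 ⟨l i, by rw [← h3, mul_comm]⟩

/-- A vertex on a coordinate axis lies on a bounded edge, unless the whole polygon lies beyond it:
rotate the covector until it becomes constant on an edge. -/
theorem exists_edge_of_axis {i j : κ} (hall : ∀ k, k = i ∨ k = j) {T : Finset (κ → ℕ)}
    {x : κ → ℝ} (hdot : ∀ u y : κ → ℝ, u ⬝ᵥ y = u i * y i + u j * y j) (hji : j ≠ i)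
    (hF : IsFace (natPolyhedron T) {x}) (hxj : x j = 0)
    (hT : ∃ y ∈ natPolyhedron T, y i < x i) :
    ∃ B, IsBoundedEdge (natPolyhedron T) B ∧ x ∈ B := by
  classical
  have hxT := boundedFace_singleton_mem hF
  obtain ⟨hne, u, hu⟩ := hF
  have hu0 : ∀ k, 0 < u k :=
    supportFace_natPolyhedron_pos (hu ▸ hne) (hu ▸ Bornology.isBounded_singleton)
  have hux : x ∈ supportFace (natPolyhedron T) u := hu ▸ rfl
  have hmin : ∀ y ∈ natPolyhedron T, y j = 0 → x i ≤ y i := by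
    intro y hy hyj
    have := hux.2 y hy
    rw [hdot, hdot, hxj, hyj] at this
    nlinarith [hu0 i]
  obtain ⟨t₀, ht₀, ht₀'⟩ : ∃ t ∈ natPts T, t i < x i := by
    by_contra! hcon
    obtain ⟨y, ⟨p, hp, d, hd, rfl⟩, hy⟩ := hT
    have h1 := le_dotProduct_of_mem_convexHull (v := Pi.single i 1) (r := x i)
      (fun s hs => by simpa using hcon s hs) hp
    have h2 := hd i
    simp at h1 hy
    linarith
  have hpos : ∀ t ∈ natPts T, t i < x i → 0 < t j := by
    intro t ht hti
    refine lt_of_le_of_ne (natPolyhedron_subset_orthant T (natPts_subset T ht) j) fun h => ?_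
    have := hmin t (natPts_subset T ht) h.symm
    linarith
  obtain ⟨q, ⟨hq, hqi⟩, hqmax⟩ := Set.exists_max_image {t ∈ natPts T | t i < x i}
    (fun t => (x i - t i) / t j) ((natPts_finite T).subset fun t ht => ht.1) ⟨t₀, ht₀, ht₀'⟩
  have hqj := hpos q hq hqi
  -- the covector `(1, ρ)` with `ρ` the largest slope
  set ρ := (x i - q i) / q j with hρ
  have hρ0 : 0 < ρ := div_pos (by linarith) hqj
  set w : κ → ℝ := fun k => if k = i then 1 else ρ with hw
  have hwi : w i = 1 := by simp [hw]
  have hwj : w j = ρ := by simp [hw, hji]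
  have hw0 : ∀ k, 0 < w k := fun k => by
    rcases hall k with rfl | rfl
    · rw [hwi]; exact one_pos
    · rwa [hwj]
  have hwx : w ⬝ᵥ x = x i := by rw [hdot, hwi, hxj]; ring
  have hwq : w ⬝ᵥ q = x i := by
    rw [hdot, hwi, hwj, hρ, div_mul_cancel₀ _ hqj.ne']
    ring
  have hwT : ∀ t ∈ natPts T, x i ≤ w ⬝ᵥ t := by
    intro t ht
    rw [hdot, hwi, hwj]
    rcases lt_or_ge (t i) (x i) with h | h
    · have := (div_le_iff₀ (hpos t ht h)).1 (hqmax t ⟨ht, h⟩)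
      linarith
    · have := natPolyhedron_subset_orthant T (natPts_subset T ht) j
      nlinarith
  have hwmin : ∀ y ∈ natPolyhedron T, x i ≤ w ⬝ᵥ y := by
    rintro _ ⟨p, hp, d, hd, rfl⟩
    rw [dotProduct_add]
    have h1 := le_dotProduct_of_mem_convexHull hwT hp
    have h2 := dotProduct_nonneg_orthant (fun k => (hw0 k).le) hd
    linarith
  have hxF : x ∈ supportFace (natPolyhedron T) w :=
    ⟨natPts_subset T hxT, fun y hy => hwx.le.trans (hwmin y hy)⟩
  have hqF : q ∈ supportFace (natPolyhedron T) w :=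
    ⟨natPts_subset T hq, fun y hy => hwq.le.trans (hwmin y hy)⟩
  have hxq : x ≠ q := fun h => by rw [h] at hqi; exact lt_irrefl _ hqi
  refine ⟨_, ⟨⟨⟨x, hxF⟩, w, rfl⟩, ?_, dimOf_eq_one hxF hqF hxq fun s hs => ?_⟩, hxF⟩
  · rw [supportFace_natPolyhedron hw0, isBounded_convexHull]
    exact ((natPts_finite T).subset fun t ht => ht.1).isBounded
  · refine ⟨s j / q j, ?_⟩
    have hsw : w ⬝ᵥ s = x i :=
      le_antisymm ((hs.2 x hxF.1).trans hwx.le) (hwmin s hs.1)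
    rw [hdot, hwi, hwj] at hsw
    ext k
    rcases hall k with rfl | rfl
    · simp only [Pi.add_apply, Pi.smul_apply, Pi.sub_apply, smul_eq_mul]
      rw [hρ] at hsw
      field_simp
      field_simp at hsw
      linarith
    · simp only [Pi.add_apply, Pi.smul_apply, Pi.sub_apply, smul_eq_mul, hxj]
      field_simp
      ring

theorem edge_unique_of_axis {i j : κ} (hall : ∀ k, k = i ∨ k = j) {T : Finset (κ → ℕ)}
    {x : κ → ℝ} (hdot : ∀ u y : κ → ℝ, u ⬝ᵥ y = u i * y i + u j * y j) (hxj : x j = 0)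
    {B B' : Set (κ → ℝ)} (hB : IsBoundedEdge (natPolyhedron T) B) (hxB : x ∈ B)
    (hB' : IsBoundedEdge (natPolyhedron T) B') (hxB' : x ∈ B') : B = B' := by
  have key : ∀ u u' : κ → ℝ, IsBoundedEdge (natPolyhedron T) (supportFace (natPolyhedron T) u) →
      (∀ k, 0 < u k) → x ∈ supportFace (natPolyhedron T) u →
      x ∈ supportFace (natPolyhedron T) u' → u' i * u j ≤ u' j * u i := by
    intro u u' he hu hx hx'
    obtain ⟨w, hw, hwx⟩ : ∃ w ∈ supportFace (natPolyhedron T) u, w ≠ x := by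
      by_contra! hcon
      have := he.2.2
      rw [Set.eq_singleton_iff_unique_mem.2 ⟨hx, hcon⟩, dimOf_singleton] at this
      exact zero_ne_one this
    have h1 := le_antisymm (hw.2 x hx.1) (hx.2 w hw.1)
    have h2 := hx'.2 w hw.1
    rw [hdot, hdot, hxj] at h1 h2
    have hwj : 0 < w j := by
      refine lt_of_le_of_ne (natPolyhedron_subset_orthant T hw.1 j) fun h => hwx ?_
      ext k
      rcases hall k with rfl | rfl
      · rw [← h] at h1
        exact mul_left_cancel₀ (hu k).ne' (by linarith)
      · rw [← h, hxj]
    have h3 : 0 ≤ (u' j * u i - u' i * u j) * w j := by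
      have h4 : u i * (u' i * x i) ≤ u i * (u' i * w i + u' j * w j) :=
        mul_le_mul_of_nonneg_left (by linarith) (hu i).le
      nlinarith [congrArg (fun r => u' i * r) h1]
    nlinarith [nonneg_of_mul_nonneg_left h3 hwj]
  obtain ⟨⟨hne, u, rfl⟩, hb, -⟩ := id hB
  obtain ⟨⟨hne', u', rfl⟩, hb', -⟩ := id hB'
  have hu := supportFace_natPolyhedron_pos hne hb
  have hu' := supportFace_natPolyhedron_pos hne' hb'
  have h1 := key u u' hB hu hxB hxB'
  have h2 := key u' u hB' hu' hxB' hxB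
  have hprop : ∀ y, u i * (u' ⬝ᵥ y) = u' i * (u ⬝ᵥ y) := fun y => by
    rw [hdot, hdot]
    linear_combination y j * (le_antisymm (by linarith) (by linarith) : u i * u' j = u' i * u j)
  ext y
  refine and_congr_right fun _ => forall₂_congr fun z _ => ?_
  rw [← mul_le_mul_iff_right₀ (hu' i), ← hprop, ← hprop, mul_le_mul_iff_right₀ (hu i)]

end Polygons

/-! ### The alternating sum over the contributing faces of a polygon -/

section AlternatingSum

variable {κ : Type} [Fintype κ]

open Classical in
/-- The multiplicity of a lattice point `a` of a vertex or an edge `B` in the trapezoid rule on `B`: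
`2` for the interior points of an edge, and `1` for its ends and for a vertex. -/
noncomputable def trapezoidWeight (B : Set (κ → ℝ)) (a : κ → ℤ) : ℕ :=
  if ∃ d : κ → ℝ, d ≠ 0 ∧ intVec a + d ∈ B ∧ intVec a - d ∈ B then 2 else 1

/-- The sum of the values of `φ` at the lattice points of `B`, with the weights of the trapezoid
rule. -/
noncomputable def trapezoidSum {M : Type*} [AddCommGroup M] (φ : (κ → ℤ) → M)
    (B : Set (κ → ℝ)) : M :=
  ∑ᶠ a ∈ {a : κ → ℤ | intVec a ∈ B}, trapezoidWeight B a • φ a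

theorem trapezoidWeight_pos (B : Set (κ → ℝ)) (a : κ → ℤ) : 0 < trapezoidWeight B a := by
  rw [trapezoidWeight]
  split_ifs <;> norm_num

theorem trapezoidWeight_singleton (a : κ → ℤ) : trapezoidWeight {intVec a} a = 1 := by
  rw [trapezoidWeight, if_neg]
  rintro ⟨d, hd, h1, -⟩
  exact hd (by simpa using h1)

theorem trapezoidWeight_vertex {P B : Set (κ → ℝ)} (hBP : B ⊆ P) {a : κ → ℤ}
    (ha : IsFace P {intVec a}) : trapezoidWeight B a = 1 := by
  rw [trapezoidWeight, if_neg]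
  rintro ⟨d, hd, h1, h2⟩
  exact hd (by simpa using isFace_extreme ha rfl (hBP h1) (hBP h2))

theorem trapezoidSum_singleton {M : Type*} [AddCommGroup M] (φ : (κ → ℤ) → M) (a : κ → ℤ) :
    trapezoidSum φ {intVec a} = φ a := by
  have : {b : κ → ℤ | intVec b ∈ ({intVec a} : Set (κ → ℝ))} = {a} := by
    ext b
    exact ⟨fun h => intVec_injective h, fun h => congrArg intVec h⟩
  rw [trapezoidSum, this, finsum_mem_singleton, trapezoidWeight_singleton, one_smul]

theorem segment_point_injective {p b : κ → ℤ} (hb : IsPrimitive b) :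
    Function.Injective (fun k : ℕ => p + k • b) := by
  intro k l h
  obtain ⟨c, hc⟩ := hb
  have := congrArg (fun x => c ⬝ᵥ x) h
  simp only [dotProduct_add, dotProduct_smul, hc] at this
  simpa using this

theorem latticePoints_segment {p b : κ → ℤ} (hb : IsPrimitive b) (L : ℕ) :
    {a : κ → ℤ | intVec a ∈ latticeSegment (intVec p) b L} =
      (fun k : ℕ => p + k • b) '' (Finset.range (L + 1) : Set ℕ) := by
  ext a
  rw [Set.mem_ofPred_eq, mem_latticeSegment_iff hb]
  simp [eq_comm]

theorem trapezoidWeight_segment {p b : κ → ℤ} (hb : IsPrimitive b) {L k : ℕ} (hk : k ≤ L) :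
    trapezoidWeight (latticeSegment (intVec p) b L) (p + k • b) =
      if 0 < k ∧ k < L then 2 else 1 := by
  rw [trapezoidWeight]
  congr 1
  obtain ⟨c, hc⟩ := id hb
  rw [intVec_add_nsmul]
  refine propext ⟨?_, fun ⟨h1, h2⟩ => ⟨intVec b, hb.ne_zero, ?_, ?_⟩⟩
  · rintro ⟨d, hd, ⟨s, ⟨hs0, hs1⟩, hs⟩, ⟨t, ⟨ht0, ht1⟩, ht⟩⟩
    simp only at hs ht
    have h1 : d = (s - k) • intVec b := by
      have : intVec p + (k : ℝ) • intVec b + d - (intVec p + (k : ℝ) • intVec b) = d := by abel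
      rw [← this, ← hs]
      module
    have h2 : d = (k - t) • intVec b := by
      have : intVec p + (k : ℝ) • intVec b - (intVec p + (k : ℝ) • intVec b - d) = d := by abel
      rw [← this, ← ht]
      module
    have h3 : s - k = k - t := by
      have := congrArg (fun x => intVec c ⬝ᵥ x) (h1.symm.trans h2)
      simpa [dotProduct_smul, intVec_dotProduct, hc] using this
    have h4 : s - k ≠ 0 := fun h => hd (by rw [h1, h, zero_smul])
    constructor
    · rcases Nat.eq_zero_or_pos k with rfl | h
      · exact absurd (by push_cast at h3 ⊢; linarith) h4
      · exact h
    · rcases hk.eq_or_lt with rfl | h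
      · exact absurd (by linarith) h4
      · exact h
  · have h3 : (k : ℝ) + 1 ≤ L := by exact_mod_cast h2
    refine ⟨k + 1, ⟨by positivity, h3⟩, ?_⟩
    simp only
    module
  · have h3 : (1 : ℝ) ≤ k := by exact_mod_cast h1
    have h4 : (k : ℝ) ≤ L := by exact_mod_cast hk
    refine ⟨k - 1, ⟨by linarith, by linarith⟩, ?_⟩
    simp only
    module

theorem trapezoidSum_segment {M : Type*} [AddCommGroup M] (φ : (κ → ℤ) → M) {p b : κ → ℤ}
    (hb : IsPrimitive b) {L : ℕ} (hL : 0 < L) :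
    trapezoidSum φ (latticeSegment (intVec p) b L) =
      ∑ k ∈ Finset.range L, (φ (p + k • b) + φ (p + (k + 1) • b)) := by
  rw [trapezoidSum, latticePoints_segment hb, finsum_mem_image
    (segment_point_injective hb).injOn, finsum_mem_coe_finset]
  obtain ⟨L, rfl⟩ := Nat.exists_eq_add_of_lt hL
  rw [zero_add] at *
  -- both sides are twice the sum over all points, minus the values at the ends
  rw [Finset.sum_add_distrib, Finset.sum_range_succ _ (L + 1), Finset.sum_range_succ' _ L,
    Finset.sum_range_succ' (fun k => φ (p + k • b)) L,
    Finset.sum_range_succ (fun k => φ (p + (k + 1) • b)) L,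
    trapezoidWeight_segment hb le_rfl, trapezoidWeight_segment hb (Nat.zero_le _)]
  have : ∀ k ∈ Finset.range L, trapezoidWeight (latticeSegment (intVec p) b ((L + 1 : ℕ) : ℝ))
      (p + (k + 1) • b) • φ (p + (k + 1) • b) = φ (p + (k + 1) • b) + φ (p + (k + 1) • b) := by
    intro k hk
    have hk := Finset.mem_range.1 hk
    rw [trapezoidWeight_segment hb (by omega), if_pos ⟨by omega, by omega⟩, two_smul]
  rw [Finset.sum_congr rfl this, Finset.sum_add_distrib]
  simp only [lt_irrefl, and_false, false_and, if_false, one_smul]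
  abel

theorem finite_latticePoints (hκ : Fintype.card κ = 2) {T : Finset (κ → ℕ)} {B : Set (κ → ℝ)}
    (hB : IsFace (natPolyhedron T) B) (hb : Bornology.IsBounded B) :
    {a : κ → ℤ | intVec a ∈ B}.Finite := by
  rcases boundedFace_cases hκ hB hb with ⟨a, rfl⟩ | hE
  · refine (Set.finite_singleton a).subset fun b hb => ?_
    exact intVec_injective hb
  · obtain ⟨p, b, L, -, hprim, rfl, -⟩ := exists_edge_param hE
    rw [latticePoints_segment hprim]
    exact (Finset.finite_toSet _).image _

/-- The lattice points whose fibers remain in the alternating sum. -/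
def IsSpecial (P : Set (κ → ℝ)) (m : ℕ) (a : κ → ℤ) : Prop :=
  (∃ B, IsBoundedEdge P B ∧ intVec a ∈ B ∧ m ∣ latticeDist B) ∧
    ¬ (IsVFace P {intVec a} ∧ m ∣ latticeDist {intVec a})

/-- Bounded `V`-faces with a lattice distance divisible by `m`. -/
def contributingFaces (P : Set (κ → ℝ)) (m : ℕ) : Set (Set (κ → ℝ)) :=
  {B | IsVFace P B ∧ Bornology.IsBounded B ∧ m ∣ latticeDist B}

theorem mem_contributingFaces_edge (hκ : Fintype.card κ = 2) {P B : Set (κ → ℝ)} {m : ℕ}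
    (hB : IsBoundedEdge P B) (hm : m ∣ latticeDist B) : B ∈ contributingFaces P m :=
  ⟨⟨hB.1, Finset.univ, by rw [hB.2.2, Finset.card_univ, hκ],
    fun _ _ i hi => absurd (Finset.mem_univ i) hi⟩, hB.2.1, hm⟩

/-- A contributing vertex lies on exactly one edge, and this edge is contributing as well. -/
theorem exists_unique_edge_of_vertex (hκ : Fintype.card κ = 2) {T : Finset (κ → ℕ)}
    (h0 : (0 : κ → ℝ) ∉ natPolyhedron T) {m : ℕ}
    (hnt : ∀ (i : κ) (c : ℕ), 0 < c → IsLeast ((fun x => x i) '' natPolyhedron T) (c : ℝ) →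
      ¬ m ∣ c) {a : κ → ℤ} (ha : {intVec a} ∈ contributingFaces (natPolyhedron T) m) :
    ∃ B, IsBoundedEdge (natPolyhedron T) B ∧ intVec a ∈ B ∧ m ∣ latticeDist B ∧
      ∀ B', IsBoundedEdge (natPolyhedron T) B' → intVec a ∈ B' → B' = B := by
  obtain ⟨hV, -, hdvd⟩ := ha
  obtain ⟨i, j, hji, hall, hdot, haj, c, hc, hai⟩ := exists_axis_of_isVFace hκ h0 hV
  rw [latticeDist_axis hall hdot haj hc hai] at hdvd
  have haP : intVec a ∈ natPolyhedron T := by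
    obtain ⟨-, v, hv⟩ := hV.1
    have : intVec a ∈ supportFace (natPolyhedron T) v := hv ▸ rfl
    exact this.1
  have hT : ∃ y ∈ natPolyhedron T, y i < intVec a i := by
    by_contra! hcon
    refine hnt i c hc ⟨⟨_, haP, hai⟩, ?_⟩ hdvd
    rintro _ ⟨y, hy, rfl⟩
    rw [← hai]
    exact hcon y hy
  obtain ⟨B, hB, haB⟩ := exists_edge_of_axis hall hdot hji hV.1 haj hT
  exact ⟨B, hB, haB, hdvd.trans (dvd_latticeDist_of_axis hdot haj hai haB),
    fun B' hB' haB' => edge_unique_of_axis hall hdot haj hB' haB' hB haB⟩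

/-- In the alternating sum over the contributing faces, the vertices cancel with ends of edges, so
that it becomes a negative combination of the values at the special points. -/
theorem exists_multiplicity (hκ : Fintype.card κ = 2) {T : Finset (κ → ℕ)}
    (h0 : (0 : κ → ℝ) ∉ natPolyhedron T) {m : ℕ}
    (hnt : ∀ (i : κ) (c : ℕ), 0 < c → IsLeast ((fun x => x i) '' natPolyhedron T) (c : ℝ) →
      ¬ m ∣ c) :
    ∃ (S : Finset (κ → ℤ)) (c : (κ → ℤ) → ℕ),
      (∀ a, a ∈ S ↔ IsSpecial (natPolyhedron T) m a) ∧ (∀ a ∈ S, 0 < c a) ∧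
      ∀ {M : Type} [AddCommGroup M] (φ : (κ → ℤ) → M),
        ∑ᶠ B ∈ contributingFaces (natPolyhedron T) m, ((-1 : ℤ) ^ dimOf B) • trapezoidSum φ B =
          -∑ a ∈ S, c a • φ a := by
  classical
  set P := natPolyhedron T with hP
  have hfin : (contributingFaces P m).Finite :=
    (finite_boundedFaces T).subset fun B hB => ⟨hB.1.1, hB.2.1⟩
  set F := hfin.toFinset with hF
  have hmemF : ∀ B, B ∈ F ↔ B ∈ contributingFaces P m := fun B => hfin.mem_toFinset
  have hpts : (⋃ B ∈ F, {a : κ → ℤ | intVec a ∈ B}).Finite :=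
    Set.Finite.biUnion F.finite_toSet fun B hB =>
      finite_latticePoints hκ ((hmemF B).1 hB).1.1 ((hmemF B).1 hB).2.1
  set S₀ := hpts.toFinset with hS₀
  have hmemS : ∀ a, a ∈ S₀ ↔ ∃ B ∈ F, intVec a ∈ B := fun a => by
    rw [hS₀, hpts.mem_toFinset]
    simp
  set w : Set (κ → ℝ) → (κ → ℤ) → ℤ := fun B a =>
    (-1) ^ dimOf B * if intVec a ∈ B then (trapezoidWeight B a : ℤ) else 0 with hw
  set μ : (κ → ℤ) → ℤ := fun a => ∑ B ∈ F, w B a with hμ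
  have hedge : ∀ B a, IsBoundedEdge P B → w B a ≤ 0 ∧ (intVec a ∈ B → w B a < 0) := by
    intro B a hB
    have h1 := trapezoidWeight_pos B a
    simp only [hw, hB.2.2, pow_one]
    split_ifs with h
    · exact ⟨by omega, fun _ => by omega⟩
    · exact ⟨by omega, fun h' => absurd h' h⟩
  have hcases : ∀ B ∈ F, (∃ a : κ → ℤ, B = {intVec a}) ∨ IsBoundedEdge P B := fun B hB =>
    boundedFace_cases hκ ((hmemF B).1 hB).1.1 ((hmemF B).1 hB).2.1
  have hspecial : ∀ a, IsSpecial P m a → a ∈ S₀ ∧ μ a < 0 := by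
    rintro a ⟨⟨B, hB, haB, hmB⟩, hnV⟩
    have hBF : B ∈ F := (hmemF B).2 (mem_contributingFaces_edge hκ hB hmB)
    refine ⟨(hmemS a).2 ⟨B, hBF, haB⟩, Finset.sum_neg' (fun B' hB' => ?_)
      ⟨B, hBF, (hedge B a hB).2 haB⟩⟩
    rcases hcases B' hB' with ⟨b, rfl⟩ | hE
    · have : intVec a ∉ ({intVec b} : Set (κ → ℝ)) := by
        intro h
        rw [← Set.mem_singleton_iff.1 h] at hB'
        have h1 := (hmemF _).1 hB'
        exact hnV ⟨h1.1, h1.2.2⟩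
      simp [hw, this]
    · exact (hedge B' a hE).1
  have hnot : ∀ a, ¬ IsSpecial P m a → μ a = 0 := by
    intro a ha
    by_cases hV : {intVec a} ∈ F
    · obtain ⟨B, hB, haB, hmB, huniq⟩ :=
        exists_unique_edge_of_vertex hκ h0 hnt ((hmemF _).1 hV)
      have hBF : B ∈ F := (hmemF B).2 (mem_contributingFaces_edge hκ hB hmB)
      have hne : ({intVec a} : Set (κ → ℝ)) ≠ B := by
        rintro rfl
        have := hB.2.2
        rw [dimOf_singleton] at this
        exact zero_ne_one this
      have hsub : ({{intVec a}, B} : Finset (Set (κ → ℝ))) ⊆ F := by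
        intro B' hB'
        rcases Finset.mem_insert.1 hB' with rfl | h
        · exact hV
        · rwa [Finset.mem_singleton.1 h]
      simp only [hμ]
      rw [← Finset.sum_subset hsub, Finset.sum_pair hne]
      · have h1 : trapezoidWeight B a = 1 := by
          refine trapezoidWeight_vertex (P := P) ?_ ((hmemF _).1 hV).1.1
          obtain ⟨-, v, rfl⟩ := hB.1
          exact fun x hx => hx.1
        simp [hw, haB, h1, hB.2.2, dimOf_singleton, trapezoidWeight_singleton]
      · intro B' hB' hB''
        have : intVec a ∉ B' := by
          intro haB'
          apply hB''
          rcases hcases B' hB' with ⟨b, rfl⟩ | hE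
          · rw [← Set.mem_singleton_iff.1 haB']
            exact Finset.mem_insert_self _ _
          · rw [huniq B' hE haB']
            exact Finset.mem_insert_of_mem (Finset.mem_singleton_self B)
        simp [hw, this]
    · refine Finset.sum_eq_zero fun B hB => ?_
      have : intVec a ∉ B := by
        intro haB
        rcases hcases B hB with ⟨b, rfl⟩ | hE
        · rw [← Set.mem_singleton_iff.1 haB] at hB
          exact hV hB
        · refine ha ⟨⟨B, hE, haB, ((hmemF B).1 hB).2.2⟩, fun h => hV ((hmemF _).2 ?_)⟩
          exact ⟨h.1, Bornology.isBounded_singleton, h.2⟩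
      simp [hw, this]
  refine ⟨S₀.filter (IsSpecial P m), fun a => (-μ a).toNat, fun a => ?_, fun a ha => ?_, ?_⟩
  · rw [Finset.mem_filter]
    exact ⟨fun h => h.2, fun h => ⟨(hspecial a h).1, h⟩⟩
  · have := (hspecial a (Finset.mem_filter.1 ha).2).2
    simp only
    omega
  · intro M _ φ
    have hsum : ∀ B ∈ F, ((-1 : ℤ) ^ dimOf B) • trapezoidSum φ B = ∑ a ∈ S₀, w B a • φ a := by
      intro B hB
      have h1 : trapezoidSum φ B =
          ∑ a ∈ S₀, (if intVec a ∈ B then (trapezoidWeight B a : ℤ) else 0) • φ a := by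
        rw [trapezoidSum]
        have hset : {a : κ → ℤ | intVec a ∈ B} = (S₀.filter (fun a => intVec a ∈ B) : Set _) := by
          ext a
          rw [Finset.coe_filter]
          exact ⟨fun h => ⟨(hmemS a).2 ⟨B, hB, h⟩, h⟩, fun h => h.2⟩
        rw [hset, finsum_mem_coe_finset, Finset.sum_filter]
        refine Finset.sum_congr rfl fun a _ => ?_
        split_ifs
        · rw [natCast_zsmul]
        · rw [zero_smul]
      rw [h1, Finset.smul_sum]
      exact Finset.sum_congr rfl fun a _ => by rw [smul_smul]
    rw [← hfin.coe_toFinset, finsum_mem_coe_finset, Finset.sum_congr rfl hsum, Finset.sum_comm,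
      Finset.sum_filter, ← Finset.sum_neg_distrib]
    refine Finset.sum_congr rfl fun a _ => ?_
    rw [← Finset.sum_smul]
    change μ a • φ a = _
    split_ifs with h
    · have h1 := (hspecial a h).2
      rw [← natCast_zsmul, Int.toNat_of_nonneg (by omega), neg_smul, neg_neg]
    · rw [hnot a h, zero_smul, neg_zero]

end AlternatingSum

/-! ### Hyperplane sections of polytopes -/

section Crossing

variable {E : Type*} [AddCommGroup E] [Module ℝ E]

/-- The point of the line through `x` and `y` at which the affine function `f` vanishes. -/
noncomputable def crossing (f : E → ℝ) (x y : E) : E :=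
  (f y - f x)⁻¹ • (f y • x - f x • y)

theorem crossing_convex_left {f : E → ℝ}
    (hf : ∀ (x y : E) (a b : ℝ), a + b = 1 → f (a • x + b • y) = a * f x + b * f y)
    {K : Set E} (hK : Convex ℝ K) {y : E} (hy : 0 < f y) :
    Convex ℝ {x | f x ≤ 0 ∧ crossing f x y ∈ K} := by
  rintro x₁ ⟨h1, h1'⟩ x₂ ⟨h2, h2'⟩ a b ha hb hab
  have hfx := hf x₁ x₂ a b hab
  have hle : f (a • x₁ + b • x₂) ≤ 0 := by rw [hfx]; nlinarith
  refine ⟨hle, ?_⟩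
  have hd : 0 < f y - f (a • x₁ + b • x₂) := by linarith
  have hd1 : f y - f x₁ ≠ 0 := by linarith
  have hd2 : f y - f x₂ ≠ 0 := by linarith
  have key := hK h1' h2' (a := a * (f y - f x₁) / (f y - f (a • x₁ + b • x₂)))
    (b := b * (f y - f x₂) / (f y - f (a • x₁ + b • x₂)))
    (div_nonneg (mul_nonneg ha (by linarith)) hd.le)
    (div_nonneg (mul_nonneg hb (by linarith)) hd.le) (by
      rw [← add_div, div_eq_one_iff_eq hd.ne', hfx]
      linear_combination f y * hab)
  convert key using 1
  rw [crossing, crossing, crossing, smul_smul, smul_smul,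
    show a * (f y - f x₁) / (f y - f (a • x₁ + b • x₂)) * (f y - f x₁)⁻¹ =
      (f y - f (a • x₁ + b • x₂))⁻¹ * a by field_simp,
    show b * (f y - f x₂) / (f y - f (a • x₁ + b • x₂)) * (f y - f x₂)⁻¹ =
      (f y - f (a • x₁ + b • x₂))⁻¹ * b by field_simp, mul_smul, mul_smul, ← smul_add]
  congr 1
  rw [hfx]
  module

theorem crossing_convex_right {f : E → ℝ}
    (hf : ∀ (x y : E) (a b : ℝ), a + b = 1 → f (a • x + b • y) = a * f x + b * f y)
    {K : Set E} (hK : Convex ℝ K) {x : E} (hx : f x ≤ 0) :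
    Convex ℝ {y | 0 < f y ∧ crossing f x y ∈ K} := by
  rintro y₁ ⟨h1, h1'⟩ y₂ ⟨h2, h2'⟩ a b ha hb hab
  have hfy := hf y₁ y₂ a b hab
  have hlt : 0 < f (a • y₁ + b • y₂) := by
    rw [hfy]
    rcases ha.eq_or_lt with rfl | ha'
    · obtain rfl : b = 1 := by linarith
      linarith
    · nlinarith [mul_pos ha' h1, mul_nonneg hb h2.le]
  refine ⟨hlt, ?_⟩
  have hd : 0 < f (a • y₁ + b • y₂) - f x := by linarith
  have hd1 : f y₁ - f x ≠ 0 := by linarith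
  have hd2 : f y₂ - f x ≠ 0 := by linarith
  have key := hK h1' h2' (a := a * (f y₁ - f x) / (f (a • y₁ + b • y₂) - f x))
    (b := b * (f y₂ - f x) / (f (a • y₁ + b • y₂) - f x))
    (div_nonneg (mul_nonneg ha (by linarith)) hd.le)
    (div_nonneg (mul_nonneg hb (by linarith)) hd.le) (by
      rw [← add_div, div_eq_one_iff_eq hd.ne', hfy]
      linear_combination (-f x) * hab)
  convert key using 1
  rw [crossing, crossing, crossing, smul_smul, smul_smul,
    show a * (f y₁ - f x) / (f (a • y₁ + b • y₂) - f x) * (f y₁ - f x)⁻¹ =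
      (f (a • y₁ + b • y₂) - f x)⁻¹ * a by field_simp,
    show b * (f y₂ - f x) / (f (a • y₁ + b • y₂) - f x) * (f y₂ - f x)⁻¹ =
      (f (a • y₁ + b • y₂) - f x)⁻¹ * b by field_simp, mul_smul, mul_smul, ← smul_add]
  congr 1
  rw [hfy]
  module

/-- The points at which the segments between points of `D` meet the hyperplane `f = 0`. -/
def crossings (f : E → ℝ) (D : Set E) : Set E :=
  {x ∈ D | f x = 0} ∪ (fun q : E × E => crossing f q.1 q.2) '' {q | (q.1 ∈ D ∧ f q.1 ≤ 0) ∧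
    q.2 ∈ D ∧ 0 < f q.2}

theorem crossings_finite {f : E → ℝ} {D : Set E} (hD : D.Finite) : (crossings f D).Finite :=
  (hD.subset fun _ h => h.1).union
    (((hD.prod hD).subset fun _ h => ⟨h.1.1, h.2.1⟩).image _)

theorem crossing_eq {f : E → ℝ} {x y : E} {a b : ℝ} (hab : a + b = 1)
    (h : a * f x + b * f y = 0) (hxy : f x < f y) : crossing f x y = a • x + b • y := by
  have hd : f y - f x ≠ 0 := by linarith
  obtain rfl : a = 1 - b := by linarith
  have hb : b * (f y - f x) = -f x := by linear_combination h
  rw [crossing, inv_smul_eq_iff₀ hd, smul_add, smul_smul, smul_smul,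
    show (f y - f x) * (1 - b) = f y by linear_combination -hb,
    show (f y - f x) * b = -f x by linear_combination hb]
  module

theorem mem_convexHull_crossings {f : E → ℝ}
    (hf : ∀ (x y : E) (a b : ℝ), a + b = 1 → f (a • x + b • y) = a * f x + b * f y)
    {D : Set E} {z : E} (hz : z ∈ convexHull ℝ D) (hfz : f z = 0)
    (h1 : ∃ x ∈ D, f x ≤ 0) : z ∈ convexHull ℝ (crossings f D) := by
  set K := convexHull ℝ (crossings f D) with hK
  have hKc : Convex ℝ K := convex_convexHull ℝ _
  have hsplit : D = {x ∈ D | f x ≤ 0} ∪ {x ∈ D | 0 < f x} := by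
    ext x
    constructor
    · intro hx
      rcases le_or_gt (f x) 0 with h | h
      · exact Or.inl ⟨hx, h⟩
      · exact Or.inr ⟨hx, h⟩
    · rintro (h | h) <;> exact h.1
  by_cases h2 : ∃ x ∈ D, 0 < f x
  · obtain ⟨x, hx, hfx⟩ := h1
    obtain ⟨y, hy, hfy⟩ := h2
    rw [hsplit, convexHull_union (show {x ∈ D | f x ≤ 0}.Nonempty from ⟨x, hx, hfx⟩)
      (show {x ∈ D | 0 < f x}.Nonempty from ⟨y, hy, hfy⟩)] at hz
    obtain ⟨p, hp, q, hq, a, b, ha, hb, hab, rfl⟩ := mem_convexJoin.1 hz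
    have hDy : ∀ y ∈ {x ∈ D | 0 < f x}, p ∈ {x | f x ≤ 0 ∧ crossing f x y ∈ K} := fun y hy =>
      convexHull_min (t := {x | f x ≤ 0 ∧ crossing f x y ∈ K})
        (fun x hx => ⟨hx.2, subset_convexHull _ _ (Or.inr ⟨(x, y), ⟨hx, hy⟩, rfl⟩)⟩)
        (crossing_convex_left hf hKc hy.2) hp
    have hp0 : f p ≤ 0 := (hDy y ⟨hy, hfy⟩).1
    obtain ⟨hq0, hpq⟩ : q ∈ {y | 0 < f y ∧ crossing f p y ∈ K} :=
      convexHull_min (t := {y | 0 < f y ∧ crossing f p y ∈ K}) (fun y hy => ⟨hy.2, (hDy y hy).2⟩) (crossing_convex_right hf hKc hp0) hq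
    rw [hf _ _ _ _ hab] at hfz
    rwa [crossing_eq hab hfz (by linarith)] at hpq
  · -- all the points lie on one side of the hyperplane
    push Not at h2
    have hconv : Convex ℝ {x | f x ≤ 0 ∧ (f x = 0 → x ∈ K)} := by
      rintro x ⟨hx, hx'⟩ y ⟨hy, hy'⟩ a b ha hb hab
      have h3 := hf x y a b hab
      have hax := mul_nonpos_of_nonneg_of_nonpos ha hx
      have hby := mul_nonpos_of_nonneg_of_nonpos hb hy
      refine ⟨by rw [h3]; linarith, fun h0 => ?_⟩
      rw [h3] at h0
      rcases mul_eq_zero.1 (show a * f x = 0 by linarith) with rfl | h4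
      · obtain rfl : b = 1 := by linarith
        simpa using hy' (by linarith)
      rcases mul_eq_zero.1 (show b * f y = 0 by linarith) with rfl | h5
      · obtain rfl : a = 1 := by linarith
        simpa using hx' h4
      exact hKc (hx' h4) (hy' h5) ha hb hab
    exact (convexHull_min (t := {x | f x ≤ 0 ∧ (f x = 0 → x ∈ K)}) (fun x hx => ⟨h2 x hx,
      fun h0 => subset_convexHull _ _ (Or.inl ⟨hx, h0⟩)⟩) hconv hz).2 hfz

end Crossing

/-! ### Fibers of Newton polyhedra -/

section Fibers

variable {n : ℕ} {I : Finset (Fin n)}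

/-- The point of `ℝ^n` with the given projections to `ℝ^I` and `ℝ^Ī`. -/
def glue (I : Finset (Fin n)) {R : Type} (x : {i // i ∈ I} → R) (a : {i // i ∉ I} → R) : Fin n → R :=
  fun i => if h : i ∈ I then x ⟨i, h⟩ else a ⟨i, h⟩

/-- The projection along `ℝ^I` as a linear map. -/
def projAlongLin (I : Finset (Fin n)) : (Fin n → ℝ) →ₗ[ℝ] ({i // i ∉ I} → ℝ) where
  toFun := projAlong I
  map_add' _ _ := rfl
  map_smul' _ _ := rfl

@[simp] theorem projTo_glue (x : {i // i ∈ I} → ℝ) (a : {i // i ∉ I} → ℝ) :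
    projTo I (glue I x a) = x := by
  ext ⟨i, hi⟩
  simp [projTo, glue, hi]

@[simp] theorem projAlong_glue (x : {i // i ∈ I} → ℝ) (a : {i // i ∉ I} → ℝ) :
    projAlong I (glue I x a) = a := by
  ext ⟨i, hi⟩
  simp [projAlong, glue, hi]

theorem glue_proj (z : Fin n → ℝ) : glue I (projTo I z) (projAlong I z) = z := by
  ext i
  by_cases hi : i ∈ I <;> simp [projTo, projAlong, glue, hi]

theorem glue_ext {z w : Fin n → ℝ} (h1 : projTo I z = projTo I w)
    (h2 : projAlong I z = projAlong I w) : z = w := by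
  rw [← glue_proj (I := I) z, h1, h2, glue_proj]

theorem projAlong_add (z w : Fin n → ℝ) :
    projAlong I (z + w) = projAlong I z + projAlong I w := rfl

theorem projAlong_smul (c : ℝ) (z : Fin n → ℝ) : projAlong I (c • z) = c • projAlong I z := rfl

theorem dotProduct_proj (v z : Fin n → ℝ) :
    v ⬝ᵥ z = projTo I v ⬝ᵥ projTo I z + projAlong I v ⬝ᵥ projAlong I z := by
  rw [dotProduct, ← Fintype.sum_subtype_add_sum_subtype (fun i => i ∈ I)]
  unfold dotProduct
  congr! 1
  exact Finset.sum_congr (by ext; simp) fun _ _ => rfl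

theorem mem_fiberAt {N : Set (Fin n → ℝ)} {a : {i // i ∉ I} → ℝ} {x : {i // i ∈ I} → ℝ} :
    x ∈ fiberAt I N a ↔ glue I x a ∈ N := by
  constructor
  · rintro ⟨z, ⟨hz, rfl⟩, rfl⟩
    rwa [glue_proj]
  · intro h
    exact ⟨_, ⟨h, projAlong_glue x a⟩, projTo_glue x a⟩

/-- The projections of the points of `A`. -/
def projPts (I : Finset (Fin n)) (A : Finset (Fin n → ℕ)) : Finset ({i // i ∉ I} → ℕ) :=
  A.image fun a i => a i

theorem natPts_projPts (A : Finset (Fin n → ℕ)) :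
    natPts (projPts I A) = projAlong I '' natPts A := by
  rw [natPts, projPts, Finset.coe_image, Set.image_image, Set.image_image]
  rfl

theorem orthant_proj : projAlong I '' orthant (Fin n) = orthant {i // i ∉ I} := by
  ext x
  constructor
  · rintro ⟨z, hz, rfl⟩ i
    exact hz i
  · intro hx
    refine ⟨glue I 0 x, fun i => ?_, projAlong_glue _ _⟩
    by_cases hi : i ∈ I
    · simp [glue, hi]
    · simpa [glue, hi] using hx ⟨i, hi⟩

/-- The projection of a Newton polyhedron is the Newton polyhedron of the projected points. -/
theorem projAlong_newtonPolyhedron (A : Finset (Fin n → ℕ)) :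
    projAlong I '' newtonPolyhedron A = natPolyhedron (projPts I A) := by
  rw [natPolyhedron, natPts_projPts, ← orthant_proj, newtonPolyhedron]
  change projAlongLin I '' _ = convexHull ℝ (projAlongLin I '' _) + projAlongLin I '' _
  rw [Set.image_add, LinearMap.image_convexHull]

/-- The part of a set over a given set. -/
def overFace (I : Finset (Fin n)) (N : Set (Fin n → ℝ)) (B : Set ({i // i ∉ I} → ℝ)) :
    Set (Fin n → ℝ) :=
  {z | z ∈ N ∧ projAlong I z ∈ B}

/-- The orthant of `ℝ^I`, in `ℝ^n`. -/
def coneOver (I : Finset (Fin n)) : Set (Fin n → ℝ) := {c | c ∈ orthant (Fin n) ∧ projAlong I c = 0}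

theorem projTo_coneOver {c : Fin n → ℝ} (hc : c ∈ coneOver I) : projTo I c ∈ orthant {i // i ∈ I} :=
  fun i => hc.1 i

theorem glue_mem_coneOver {x : {i // i ∈ I} → ℝ} (hx : x ∈ orthant {i // i ∈ I}) :
    glue I x 0 ∈ coneOver I := by
  refine ⟨fun i => ?_, projAlong_glue _ _⟩
  by_cases hi : i ∈ I
  · simpa [glue, hi] using hx ⟨i, hi⟩
  · simp [glue, hi]

theorem overFace_supportFace {N : Set (Fin n → ℝ)} (u : {i // i ∉ I} → ℝ) :
    overFace I N (supportFace (projAlong I '' N) u) = supportFace N (glue I 0 u) := by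
  ext z
  have hdot : ∀ w, glue I 0 u ⬝ᵥ w = u ⬝ᵥ projAlong I w := fun w => by
    rw [dotProduct_proj (I := I)]
    simp
  constructor
  · rintro ⟨hz, -, h⟩
    refine ⟨hz, fun y hy => ?_⟩
    rw [hdot, hdot]
    exact h _ ⟨y, hy, rfl⟩
  · rintro ⟨hz, h⟩
    refine ⟨hz, ⟨z, hz, rfl⟩, ?_⟩
    rintro _ ⟨y, hy, rfl⟩
    rw [← hdot, ← hdot]
    exact h y hy

/-- The part of a Newton polyhedron over a bounded face of its projection is the sum of a lattice
polytope and the orthant of `ℝ^I`. -/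
theorem overFace_eq {A : Finset (Fin n → ℕ)} {B : Set ({i // i ∉ I} → ℝ)}
    (hB : IsFace (projAlong I '' newtonPolyhedron A) B) (hb : Bornology.IsBounded B) :
    overFace I (newtonPolyhedron A) B =
      convexHull ℝ {x ∈ natPts A | projAlong I x ∈ B} + coneOver I := by
  obtain ⟨hne, u, rfl⟩ := hB
  have hu : ∀ i, 0 < u i := by
    rw [projAlong_newtonPolyhedron] at hne hb
    exact supportFace_natPolyhedron_pos hne hb
  have hA : A.Nonempty := by
    rw [Finset.nonempty_iff_ne_empty]
    rintro rfl
    obtain ⟨x, ⟨z, hz, -⟩, -⟩ := hne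
    simp [newtonPolyhedron] at hz
  have hdot : ∀ w, glue I 0 u ⬝ᵥ w = u ⬝ᵥ projAlong I w := fun w => by
    rw [dotProduct_proj (I := I)]
    simp
  obtain ⟨s, hs, hmin⟩ := exists_min_dotProduct (natPts_finite A) (hA.to_set.image _) (glue I 0 u)
  have h0 : ∀ c ∈ orthant (Fin n), 0 ≤ glue I 0 u ⬝ᵥ c := fun c hc => by
    rw [hdot]
    exact dotProduct_nonneg_orthant (fun i => (hu i).le) (fun i => hc i)
  have h := supportFace_convexHull_add zero_mem_orthant h0 hs hmin
  rw [overFace_supportFace]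
  have hcone : {c | c ∈ orthant (Fin n) ∧ glue I 0 u ⬝ᵥ c = 0} = coneOver I := by
    ext c
    refine and_congr_right fun hc => ?_
    rw [hdot]
    exact ⟨fun h => dotProduct_pos_of_pos hu (fun i => hc i) h, fun h => by rw [h, dotProduct_zero]⟩
  have hsF : s ∈ supportFace (newtonPolyhedron A) (glue I 0 u) := by
    rw [newtonPolyhedron, h]
    exact ⟨s, subset_convexHull _ _ ⟨hs, rfl⟩, 0, ⟨zero_mem_orthant, dotProduct_zero _⟩, add_zero _⟩
  have hset : {x | x ∈ natPts A ∧ glue I 0 u ⬝ᵥ x = glue I 0 u ⬝ᵥ s} =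
      {x | x ∈ natPts A ∧ projAlong I x ∈ supportFace (projAlong I '' newtonPolyhedron A) u} := by
    ext x
    refine and_congr_right fun hx => ?_
    have hxN : x ∈ newtonPolyhedron A := natPts_subset A hx
    rw [show projAlong I x ∈ supportFace (projAlong I '' newtonPolyhedron A) u ↔
      x ∈ supportFace (newtonPolyhedron A) (glue I 0 u) by
        rw [← overFace_supportFace]; exact ⟨fun h => ⟨hxN, h⟩, fun h => h.2⟩]
    constructor
    · intro hxs
      exact ⟨hxN, fun y hy => hxs.le.trans (hsF.2 y hy)⟩
    · intro hxF
      exact le_antisymm (hxF.2 s hsF.1) (hmin x hx)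
  rw [← hset, ← hcone, ← h]
  rfl

theorem exists_finset_ratPts {ι : Type} {X : Set (ι → ℝ)} (hX : X.Finite)
    (h : ∀ x ∈ X, ∃ q : ι → ℚ, (fun i => (q i : ℝ)) = x) : ∃ S : Finset (ι → ℚ), ratPts S = X := by
  classical
  choose! g hg using h
  refine ⟨hX.toFinset.image g, ?_⟩
  rw [ratPts, Finset.coe_image, Set.image_image, hX.coe_toFinset]
  ext x
  constructor
  · rintro ⟨y, hy, rfl⟩
    simpa only [hg y hy] using hy
  · intro hx
    exact ⟨x, hx, hg x hx⟩

/-- The fiber over a point of a bounded face which is cut out by an integer affine function is a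
polyhedron with rational vertices. -/
theorem isLocalPolyhedron_fiberAt {A : Finset (Fin n → ℕ)} {B : Set ({i // i ∉ I} → ℝ)}
    (hB : IsFace (projAlong I '' newtonPolyhedron A) B) (hb : Bornology.IsBounded B)
    {a : {i // i ∉ I} → ℝ} (g : {i // i ∉ I} → ℤ) (r : ℤ)
    (ha : ∀ y ∈ B, y = a ↔ intVec g ⬝ᵥ y = r)
    (hle : ∃ x ∈ natPts A, projAlong I x ∈ B ∧ intVec g ⬝ᵥ projAlong I x ≤ r)
    (haB : a ∈ B) : IsLocalPolyhedron (fiberAt I (newtonPolyhedron A) a) := by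
  set D := {x ∈ natPts A | projAlong I x ∈ B} with hD
  have hover := overFace_eq hB hb
  have hDfin : D.Finite := (natPts_finite A).subset fun x hx => hx.1
  set f : (Fin n → ℝ) → ℝ := fun z => intVec g ⬝ᵥ projAlong I z - r with hf
  have hfaff : ∀ (x y : Fin n → ℝ) (a b : ℝ), a + b = 1 →
      f (a • x + b • y) = a * f x + b * f y := by
    intro x y a b hab
    simp only [hf, projAlong_add, projAlong_smul, dotProduct_add, dotProduct_smul, smul_eq_mul]
    linear_combination (r : ℝ) * hab
  have hDint : ∀ x ∈ D, ∃ (z : Fin n → ℤ) (k : ℤ), intVec z = x ∧ f x = k := by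
    intro x hx
    obtain ⟨z, rfl⟩ := exists_intVec_of_mem_natPts hx.1
    refine ⟨z, g ⬝ᵥ (fun i => z i) - r, rfl, ?_⟩
    simp only [hf, Int.cast_sub, ← intVec_dotProduct]
    rfl
  obtain ⟨S, hS⟩ := exists_finset_ratPts (X := projTo I '' crossings f D)
    ((crossings_finite hDfin).image _) (by
      rintro _ ⟨x, hx | ⟨⟨p, q⟩, ⟨hp, hq⟩, rfl⟩, rfl⟩
      · obtain ⟨z, -, rfl, -⟩ := hDint x hx.1
        exact ⟨fun i => z i, by ext i; simp [projTo]⟩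
      · obtain ⟨zp, kp, hzp, hkp⟩ := hDint p hp.1
        obtain ⟨zq, kq, hzq, hkq⟩ := hDint q hq.1
        refine ⟨fun i => ((kq : ℚ) - kp)⁻¹ * (kq * zp i - kp * zq i), ?_⟩
        simp only at hp hq hzp hzq
        ext i
        simp only [crossing, hkp, hkq, map_smul, map_sub]
        rw [← hzp, ← hzq]
        simp [projTo])
  have hsub : fiberAt I (newtonPolyhedron A) a ⊆ polyhedronOf S := by
    rintro x hx
    rw [mem_fiberAt] at hx
    have hz : glue I x a ∈ overFace I (newtonPolyhedron A) B := ⟨hx, by rwa [projAlong_glue]⟩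
    rw [hover] at hz
    obtain ⟨p, hp, c, hc, hpc⟩ := hz
    have hpa : projAlong I p = a := by
      have := congrArg (projAlong I) hpc
      rw [projAlong_glue] at this
      simpa [projAlong_add, hc.2] using this
    have hfp : f p = 0 := by
      simp only [hf, hpa, sub_eq_zero]
      exact (ha a haB).1 rfl
    have h1 := mem_convexHull_crossings hfaff hp hfp (by
      obtain ⟨x, hx, hxB, hle⟩ := hle
      exact ⟨x, ⟨hx, hxB⟩, by simpa [hf] using hle⟩)
    refine ⟨projTo I p, ?_, projTo I c, projTo_coneOver hc, ?_⟩
    · change _ ∈ convexHull ℝ (ratPts S)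
      rw [hS, ← LinearMap.image_convexHull]
      exact ⟨p, h1, rfl⟩
    · have := congrArg (projTo I) hpc
      rw [projTo_glue] at this
      simpa using this
  refine ⟨S, ?_, Set.Subset.antisymm hsub ?_⟩
  · by_contra hS0
    rw [Finset.not_nonempty_iff_eq_empty] at hS0
    obtain ⟨-, u, rfl⟩ := hB
    obtain ⟨⟨z, hz, rfl⟩, -⟩ := haB
    have := hsub ⟨z, ⟨hz, rfl⟩, rfl⟩
    rw [hS0] at this
    simp [polyhedronOf] at this
  · rintro _ ⟨p, hp, c, hc, rfl⟩
    change p ∈ convexHull ℝ (ratPts S) at hp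
    have hcr : crossings f D ⊆ {z | z ∈ convexHull ℝ D ∧ f z = 0} := by
      rintro _ (hx | ⟨⟨p, q⟩, ⟨⟨hp, hp0⟩, hq, hq0⟩, rfl⟩)
      · exact ⟨subset_convexHull _ _ hx.1, hx.2⟩
      · simp only at hp hp0 hq hq0
        have hd : 0 < f q - f p := by linarith
        have hab : f q / (f q - f p) + -f p / (f q - f p) = 1 := by
          field_simp
          ring
        have h0 : f q / (f q - f p) * f p + -f p / (f q - f p) * f q = 0 := by
          field_simp
          ring
        simp only
        rw [crossing_eq hab h0 (by linarith)]
        exact ⟨convex_convexHull ℝ D (subset_convexHull _ _ hp) (subset_convexHull _ _ hq)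
          (by positivity) (div_nonneg (by linarith) hd.le) hab, by rw [hfaff _ _ _ _ hab, h0]⟩
    have hconv : Convex ℝ {z | z ∈ convexHull ℝ D ∧ f z = 0} := by
      rintro x ⟨hx, hx0⟩ y ⟨hy, hy0⟩ s t hs ht hst
      exact ⟨convex_convexHull ℝ D hx hy hs ht hst, by rw [hfaff _ _ _ _ hst, hx0, hy0]; simp⟩
    rw [hS, ← LinearMap.image_convexHull] at hp
    obtain ⟨z, hz, rfl⟩ := hp
    obtain ⟨hzD, hz0⟩ := convexHull_min hcr hconv hz
    have hzN : z ∈ overFace I (newtonPolyhedron A) B := by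
      rw [hover]
      exact ⟨z, hzD, 0, ⟨zero_mem_orthant, rfl⟩, add_zero z⟩
    have hza : projAlong I z = a := (ha _ hzN.2).2 (sub_eq_zero.1 hz0)
    refine ⟨z + glue I c 0, ⟨natPolyhedron_add_mem hzN.1 (glue_mem_coneOver hc).1, ?_⟩, by simp⟩
    rw [projAlong_add, projAlong_glue, hza, add_zero]

end Fibers

/-! ### The fibers over an edge -/

section EdgeFibers

variable {n : ℕ} {I : Finset (Fin n)} {A : Finset (Fin n → ℕ)} {p b : {i // i ∉ I} → ℤ} {L : ℕ}

/-- The segment `p + [0, L] b` is a bounded edge of the projection of the Newton polyhedron, with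
the primitive direction `b` and the ends among the projections of the points of `A`. -/
structure IsEdgeParam (I : Finset (Fin n)) (A : Finset (Fin n → ℕ)) (p b : {i // i ∉ I} → ℤ)
    (L : ℕ) : Prop where
  edge : IsBoundedEdge (projAlong I '' newtonPolyhedron A) (latticeSegment (intVec p) b L)
  pos : 0 < L
  prim : IsPrimitive b
  left_mem : intVec p ∈ natPts (projPts I A)
  right_mem : intVec (p + L • b) ∈ natPts (projPts I A)

theorem exists_isEdgeParam {B : Set ({i // i ∉ I} → ℝ)}
    (hB : IsBoundedEdge (projAlong I '' newtonPolyhedron A) B) :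
    ∃ p b L, IsEdgeParam I A p b L ∧ B = latticeSegment (intVec p) b L := by
  have hB' := hB
  rw [projAlong_newtonPolyhedron] at hB'
  obtain ⟨p, b, L, hL, hb, rfl, h1, h2⟩ := exists_edge_param hB'
  exact ⟨p, b, L, ⟨hB, hL, hb, h1, h2⟩, rfl⟩

/-- The fiber of the Newton polyhedron over the point `p + t b`. -/
def edgeFiber (I : Finset (Fin n)) (A : Finset (Fin n → ℕ)) (p b : {i // i ∉ I} → ℤ) (t : ℝ) :
    Set ({i // i ∈ I} → ℝ) :=
  fiberAt I (newtonPolyhedron A) (intVec p + t • intVec b)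

theorem mem_edgeFiber {t : ℝ} {x : {i // i ∈ I} → ℝ} :
    x ∈ edgeFiber I A p b t ↔ glue I x (intVec p + t • intVec b) ∈ newtonPolyhedron A := mem_fiberAt

theorem glue_combo (x y : {i // i ∈ I} → ℝ) (a c : {i // i ∉ I} → ℝ) (s t : ℝ) :
    s • glue I x a + t • glue I y c = glue I (s • x + t • y) (s • a + t • c) := by
  refine glue_ext (I := I) ?_ ?_
  · simp
  · simp [projAlong_add, projAlong_smul]

theorem intVec_zero {κ : Type} : intVec (0 : κ → ℤ) = 0 := by
  ext i
  simp

theorem edgeFiber_convex_combo {t u s r : ℝ} (hs : 0 ≤ s) (hr : 0 ≤ r) (hsr : s + r = 1)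
    {x y : {i // i ∈ I} → ℝ} (hx : x ∈ edgeFiber I A p b t) (hy : y ∈ edgeFiber I A p b u) :
    s • x + r • y ∈ edgeFiber I A p b (s * t + r * u) := by
  rw [mem_edgeFiber] at *
  have := convex_natPolyhedron A hx hy hs hr hsr
  rw [glue_combo] at this
  have e : s • (intVec p + t • intVec b) + r • (intVec p + u • intVec b) =
      intVec p + (s * t + r * u) • intVec b := by
    obtain rfl : s = 1 - r := by linarith
    module
  rwa [e] at this

theorem convex_edgeFiber (t : ℝ) : Convex ℝ (edgeFiber I A p b t) := by
  intro x hx y hy s r hs hr hsr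
  have := edgeFiber_convex_combo hs hr hsr hx hy
  rwa [← add_mul, hsr, one_mul] at this

theorem edgeFiber_add_mem {t : ℝ} {x c : {i // i ∈ I} → ℝ} (hx : x ∈ edgeFiber I A p b t)
    (hc : c ∈ orthant {i // i ∈ I}) : x + c ∈ edgeFiber I A p b t := by
  rw [mem_edgeFiber] at *
  have := natPolyhedron_add_mem hx (glue_mem_coneOver hc).1
  have h := glue_combo x c (intVec p + t • intVec b) 0 1 1
  simp only [one_smul, add_zero] at h
  rwa [h] at this

theorem glue_mem_overFace {t : ℝ} (ht : t ∈ Set.Icc (0 : ℝ) L) {x : {i // i ∈ I} → ℝ}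
    (hx : x ∈ edgeFiber I A p b t) : glue I x (intVec p + t • intVec b) ∈
      overFace I (newtonPolyhedron A) (latticeSegment (intVec p) b L) :=
  ⟨mem_edgeFiber.1 hx, by rw [projAlong_glue]; exact ⟨t, ht, rfl⟩⟩

theorem exists_edgeFiber_of_mem_overFace {z : Fin n → ℝ}
    (hz : z ∈ overFace I (newtonPolyhedron A) (latticeSegment (intVec p) b L)) :
    ∃ t ∈ Set.Icc (0 : ℝ) L, projAlong I z = intVec p + t • intVec b ∧
      projTo I z ∈ edgeFiber I A p b t := by
  obtain ⟨hzN, t, ht, hzt⟩ := hz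
  refine ⟨t, ht, hzt.symm, ?_⟩
  rw [mem_edgeFiber, show intVec p + t • intVec b = projAlong I z from hzt, glue_proj]
  exact hzN

/-- Between consecutive lattice points of an edge the fibers are interpolated linearly: a point of
the polytope over the edge lies on a segment between points of the polytope over the two sides, and
this segment passes over both lattice points. -/
theorem IsEdgeParam.interpolate (h : IsEdgeParam I A p b L) {k : ℕ} (hk : k < L) {τ : ℝ}
    (h0 : 0 < τ) (h1 : τ < 1) : edgeFiber I A p b (k + τ) =
      (1 - τ) • edgeFiber I A p b k + τ • edgeFiber I A p b ((k + 1 : ℕ) : ℝ) := by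
  have hkL : ((k : ℝ) + 1) ≤ L := by exact_mod_cast hk
  have hk0 : (0 : ℝ) ≤ k := Nat.cast_nonneg k
  apply Set.Subset.antisymm
  · intro x hx
    have hz := glue_mem_overFace (L := L) ⟨by linarith, by linarith⟩ hx
    have hover := overFace_eq h.edge.1 h.edge.2.1
    rw [hover] at hz
    obtain ⟨z, hz, c, hc, hzc⟩ := hz
    obtain ⟨g, hg⟩ := id h.prim
    -- the position of a point over the edge
    set f : (Fin n → ℝ) → ℝ := fun w => intVec g ⬝ᵥ (projAlong I w - intVec p) with hf
    have hfval : ∀ (w : Fin n → ℝ) (t : ℝ), projAlong I w = intVec p + t • intVec b → f w = t := by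
      intro w t hw
      simp only [hf, hw, add_sub_cancel_left, dotProduct_smul, intVec_dotProduct, hg]
      simp
    set D := {x ∈ natPts A | projAlong I x ∈ latticeSegment (intVec p) b L} with hD
    have hDk : ∀ w ∈ D, ∃ l : ℕ, l ≤ L ∧ projAlong I w = intVec p + (l : ℝ) • intVec b := by
      rintro w ⟨hw, hwB⟩
      obtain ⟨v, rfl⟩ := exists_intVec_of_mem_natPts hw
      have : projAlong I (intVec v) = intVec (fun i : {i // i ∉ I} => v i) := rfl
      rw [this, mem_latticeSegment_iff h.prim] at hwB
      obtain ⟨l, hl, hvl⟩ := hwB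
      exact ⟨l, hl, by rw [this, hvl, intVec_add_nsmul]⟩
    have hends : ∀ q ∈ natPts (projPts I A), q ∈ latticeSegment (intVec p) b L →
        ∃ w ∈ D, projAlong I w = q := by
      intro q hq hqB
      rw [natPts_projPts] at hq
      obtain ⟨w, hw, rfl⟩ := hq
      exact ⟨w, ⟨hw, hqB⟩, rfl⟩
    have hsplit : D = {w ∈ D | f w ≤ k} ∪ {w ∈ D | (k : ℝ) + 1 ≤ f w} := by
      ext w
      constructor
      · intro hw
        obtain ⟨l, -, hl⟩ := hDk w hw
        rcases le_or_gt l k with h2 | h2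
        · exact Or.inl ⟨hw, by rw [hfval w l hl]; exact_mod_cast h2⟩
        · exact Or.inr ⟨hw, by rw [hfval w l hl]; exact_mod_cast h2⟩
      · rintro (h2 | h2) <;> exact h2.1
    have hneL : {w ∈ D | f w ≤ k}.Nonempty := by
      obtain ⟨w, hw, hwp⟩ := hends _ h.left_mem ⟨0, ⟨le_rfl, Nat.cast_nonneg L⟩, by simp⟩
      exact ⟨w, hw, by rw [hfval w 0 (by rw [hwp, zero_smul, add_zero])]; exact hk0⟩
    have hneR : {w ∈ D | (k : ℝ) + 1 ≤ f w}.Nonempty := by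
      obtain ⟨w, hw, hwp⟩ := hends _ h.right_mem
        ⟨L, ⟨Nat.cast_nonneg L, le_rfl⟩, (intVec_add_nsmul p b L).symm⟩
      exact ⟨w, hw, by rw [hfval w L (by rw [hwp, intVec_add_nsmul])]; exact hkL⟩
    rw [hsplit, convexHull_union hneL hneR] at hz
    obtain ⟨zL, hzL, zR, hzR, s, r, hs, hr, hsr, rfl⟩ := mem_convexJoin.1 hz
    have hDN : ∀ w ∈ convexHull ℝ D, w ∈ overFace I (newtonPolyhedron A)
        (latticeSegment (intVec p) b L) := fun w hw => by
      rw [hover]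
      exact ⟨w, hw, 0, ⟨zero_mem_orthant, rfl⟩, add_zero w⟩
    obtain ⟨tL, htL, hpL, hxL⟩ := exists_edgeFiber_of_mem_overFace
      (hDN zL (convexHull_mono (fun w hw => hw.1) hzL))
    obtain ⟨tR, htR, hpR, hxR⟩ := exists_edgeFiber_of_mem_overFace
      (hDN zR (convexHull_mono (fun w hw => hw.1) hzR))
    have hconv : ∀ r : ℝ, Convex ℝ {w | f w ≤ r} ∧ Convex ℝ {w | r ≤ f w} := by
      intro r
      have hlin : ∀ (x y : Fin n → ℝ) (s u : ℝ), s + u = 1 →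
          f (s • x + u • y) = s * f x + u * f y := by
        intro x y s u hsu
        simp only [hf, projAlong_add, projAlong_smul, dotProduct_sub, dotProduct_add,
          dotProduct_smul, smul_eq_mul]
        linear_combination (intVec g ⬝ᵥ intVec p) * hsu
      constructor
      · intro x hx y hy s u hs hu hsu
        simp only [Set.mem_ofPred_eq, hlin x y s u hsu] at *
        obtain rfl : s = 1 - u := by linarith
        nlinarith
      · intro x hx y hy s u hs hu hsu
        simp only [Set.mem_ofPred_eq, hlin x y s u hsu] at *
        obtain rfl : s = 1 - u := by linarith
        nlinarith
    have htLk : tL ≤ k := by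
      have : zL ∈ {w | f w ≤ k} := convexHull_min (fun w hw => hw.2) (hconv k).1 hzL
      rwa [Set.mem_ofPred_eq, hfval zL tL hpL] at this
    have htRk : (k : ℝ) + 1 ≤ tR := by
      have : zR ∈ {w | (k : ℝ) + 1 ≤ f w} :=
        convexHull_min (fun w hw => hw.2) (hconv (k + 1)).2 hzR
      rwa [Set.mem_ofPred_eq, hfval zR tR hpR] at this
    have hpos : s * tL + r * tR = k + τ := by
      have e1 : projAlong I (s • zL + r • zR) = intVec p + (k + τ) • intVec b := by
        have := congrArg (projAlong I) hzc
        rw [projAlong_glue] at this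
        simpa [projAlong_add, hc.2] using this
      have e2 : projAlong I (s • zL + r • zR) = intVec p + (s * tL + r * tR) • intVec b := by
        rw [projAlong_add, projAlong_smul, projAlong_smul, hpL, hpR]
        obtain rfl : s = 1 - r := by linarith
        module
      rw [← hfval _ _ e2, hfval _ _ e1]
    have hd : 0 < tR - tL := by linarith
    -- the points of the segment from `zL` to `zR` over the two lattice points
    have hpt : ∀ t : ℝ, tL ≤ t → t ≤ tR →
        ((tR - t) / (tR - tL)) • projTo I zL + ((t - tL) / (tR - tL)) • projTo I zR ∈
          edgeFiber I A p b t := by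
      intro t ht1 ht2
      have := edgeFiber_convex_combo (s := (tR - t) / (tR - tL)) (r := (t - tL) / (tR - tL))
        (div_nonneg (by linarith) hd.le) (div_nonneg (by linarith) hd.le)
        (by field_simp; ring) hxL hxR
      have e : (tR - t) / (tR - tL) * tL + (t - tL) / (tR - tL) * tR = t := by
        field_simp
        ring
      rwa [e] at this
    have hxk := hpt k htLk (by linarith)
    have hxk1 := hpt ((k + 1 : ℕ) : ℝ) (by push_cast; linarith) (by push_cast; linarith)
    refine ⟨_, Set.smul_mem_smul_set (edgeFiber_add_mem hxk (projTo_coneOver hc)), _,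
      Set.smul_mem_smul_set (edgeFiber_add_mem hxk1 (projTo_coneOver hc)), ?_⟩
    have hxz := congrArg (projTo I) hzc
    rw [projTo_glue] at hxz
    simp only [map_add, map_smul] at hxz
    rw [← hxz]
    have hr' : r = (k + τ - tL) / (tR - tL) := by
      rw [eq_div_iff hd.ne', ← hpos]
      linear_combination (-tL) * hsr
    have hs' : s = (tR - (k + τ)) / (tR - tL) := by
      rw [eq_div_iff hd.ne', ← hpos]
      linear_combination tR * hsr
    have e1 : (1 - τ) * ((tR - k) / (tR - tL)) + τ * ((tR - ((k + 1 : ℕ) : ℝ)) / (tR - tL)) = s := by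
      rw [hs']
      push_cast
      field_simp
      ring
    have e2 : (1 - τ) * ((k - tL) / (tR - tL)) + τ * ((((k + 1 : ℕ) : ℝ) - tL) / (tR - tL)) = r := by
      rw [hr']
      push_cast
      field_simp
      ring
    rw [← e1, ← e2]
    module
  · rintro _ ⟨_, ⟨x, hx, rfl⟩, _, ⟨y, hy, rfl⟩, rfl⟩
    have := edgeFiber_convex_combo (by linarith) h0.le (by ring) hx hy (s := 1 - τ)
    have e : (1 - τ) * (k : ℝ) + τ * ((k + 1 : ℕ) : ℝ) = k + τ := by
      push_cast
      ring
    rwa [e] at this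

theorem IsEdgeParam.isLocalPolyhedron (h : IsEdgeParam I A p b L) {k : ℕ} (hk : k ≤ L) :
    IsLocalPolyhedron (edgeFiber I A p b k) := by
  obtain ⟨g, hg⟩ := id h.prim
  have hval : ∀ t : ℝ, intVec g ⬝ᵥ (intVec p + t • intVec b) = ((g ⬝ᵥ p : ℤ) : ℝ) + t := fun t => by
    rw [dotProduct_add, dotProduct_smul, intVec_dotProduct, intVec_dotProduct, hg]
    simp
  have hkL : (k : ℝ) ≤ L := by exact_mod_cast hk
  refine isLocalPolyhedron_fiberAt h.edge.1 h.edge.2.1 g (g ⬝ᵥ p + k) ?_ ?_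
    ⟨k, ⟨Nat.cast_nonneg k, hkL⟩, rfl⟩
  · rintro _ ⟨t, -, rfl⟩
    simp only [hval]
    push_cast
    constructor
    · intro h1
      have := congrArg (fun x => intVec g ⬝ᵥ x) h1
      simpa only [hval] using this
    · intro h1
      rw [add_left_cancel h1]
  · have h1 := h.left_mem
    rw [natPts_projPts] at h1
    obtain ⟨x, hx, hxp⟩ := h1
    refine ⟨x, hx, ?_, ?_⟩
    · rw [hxp]
      exact ⟨0, ⟨le_rfl, Nat.cast_nonneg L⟩, by simp⟩
    · rw [hxp, intVec_dotProduct]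
      push_cast
      linarith [(Nat.cast_nonneg k : (0 : ℝ) ≤ k)]

/-- The fiber over a lattice vertex of the projection is a polyhedron with rational vertices. -/
theorem isLocalPolyhedron_vertexFiber {a : {i // i ∉ I} → ℝ}
    (ha : IsFace (projAlong I '' newtonPolyhedron A) {a}) :
    IsLocalPolyhedron (fiberAt I (newtonPolyhedron A) a) := by
  refine isLocalPolyhedron_fiberAt ha Bornology.isBounded_singleton 0 0 ?_ ?_ rfl
  · rintro y rfl
    simp [intVec_zero]
  · have h1 := ha
    rw [projAlong_newtonPolyhedron] at h1
    have h2 := boundedFace_singleton_mem h1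
    rw [natPts_projPts] at h2
    obtain ⟨x, hx, rfl⟩ := h2
    exact ⟨x, hx, rfl, by simp [intVec_zero]⟩

/-- A polyhedron of the required form, as an element of the semigroup. -/
def LocalPolyhedron.mk {ι : Type} (P : Set (ι → ℝ)) (h : IsLocalPolyhedron P) : LocalPolyhedron ι :=
  ⟨P, h⟩

open Classical in
/-- The fiber over a point, as an element of the semigroup of polyhedra (zero if it is not a
polyhedron of the required form). -/
noncomputable def localFiber (I : Finset (Fin n)) (A : Finset (Fin n → ℕ))
    (a : {i // i ∉ I} → ℝ) : LocalPolyhedron {i // i ∈ I} :=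
  if h : IsLocalPolyhedron (fiberAt I (newtonPolyhedron A) a) then .mk _ h else 0

theorem localFiber_val {a : {i // i ∉ I} → ℝ}
    (h : IsLocalPolyhedron (fiberAt I (newtonPolyhedron A) a)) :
    (localFiber I A a).1 = fiberAt I (newtonPolyhedron A) a := by
  rw [localFiber, dif_pos h]
  rfl

theorem ofSet_val {ι : Type} (P : LocalPolyhedron ι) :
    VirtualPolyhedron.ofSet P.1 = Algebra.GrothendieckAddGroup.of P := by
  rw [VirtualPolyhedron.ofSet, dif_pos P.2]
  rfl

end EdgeFibers

/-! ### Fiber polyhedra -/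

section PiecewiseLinear

open intervalIntegral

variable {E : Type*} [NormedAddCommGroup E] [NormedSpace ℝ E]

/-- The piecewise linear interpolation of the sequence `c` on `[0, L]`. -/
noncomputable def piecewiseLinear (c : ℕ → E) (L : ℕ) (t : ℝ) : E :=
  c 0 + ∑ j ∈ Finset.range L, max 0 (min 1 (t - j)) • (c (j + 1) - c j)

theorem continuous_piecewiseLinear (c : ℕ → E) (L : ℕ) : Continuous (piecewiseLinear c L) := by
  unfold piecewiseLinear
  fun_prop

theorem piecewiseLinear_eq (c : ℕ → E) {L k : ℕ} (hk : k < L) {t : ℝ} (h0 : k ≤ t)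
    (h1 : t ≤ k + 1) : piecewiseLinear c L t = c k + (t - k) • (c (k + 1) - c k) := by
  have hlow : ∀ M : ℕ, M ≤ k →
      c 0 + ∑ j ∈ Finset.range M, max 0 (min 1 (t - j)) • (c (j + 1) - c j) = c M := by
    intro M
    induction M with
    | zero => intro _; simp
    | succ M ih =>
      intro hM
      have hM' : ((M : ℝ) + 1) ≤ k := by exact_mod_cast hM
      rw [Finset.sum_range_succ, ← add_assoc, ih (by omega), min_eq_left (by linarith),
        max_eq_right zero_le_one, one_smul]
      abel
  have hhigh : ∀ M : ℕ, k + 1 ≤ M →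
      c 0 + ∑ j ∈ Finset.range M, max 0 (min 1 (t - j)) • (c (j + 1) - c j) =
        c k + (t - k) • (c (k + 1) - c k) := by
    intro M hM
    induction M, hM using Nat.le_induction with
    | base =>
      rw [Finset.sum_range_succ, ← add_assoc, hlow k le_rfl, min_eq_right (by linarith),
        max_eq_right (by linarith)]
    | succ M hM ih =>
      have hM' : ((k : ℝ) + 1) ≤ M := by exact_mod_cast hM
      rw [Finset.sum_range_succ, ← add_assoc, ih, min_eq_right (by linarith),
        max_eq_left (by linarith), zero_smul, add_zero]
  exact hhigh L hk

theorem integral_affine [CompleteSpace E] (k : ℕ) (x y : E) :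
    ∫ t in (k : ℝ)..((k + 1 : ℕ) : ℝ), (x + (t - k) • (y - x)) = (2 : ℝ)⁻¹ • (x + y) := by
  have h1 : IntervalIntegrable (fun t : ℝ => (t - k) • (y - x)) MeasureTheory.volume k
      ((k + 1 : ℕ) : ℝ) := Continuous.intervalIntegrable (by fun_prop) _ _
  rw [integral_add intervalIntegrable_const h1, intervalIntegral.integral_smul_const, intervalIntegral.integral_const]
  have h2 : ∫ t in (k : ℝ)..((k + 1 : ℕ) : ℝ), (t - (k : ℝ)) = 2⁻¹ := by
    rw [integral_comp_sub_right (fun t : ℝ => t), integral_id]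
    push_cast
    ring
  rw [h2]
  push_cast
  module

theorem integral_piecewiseLinear [CompleteSpace E] (c : ℕ → E) (L : ℕ) :
    (2 : ℝ) • ∫ t in (0 : ℝ)..L, piecewiseLinear c L t =
      ∑ k ∈ Finset.range L, (c k + c (k + 1)) := by
  have h := sum_integral_adjacent_intervals (f := piecewiseLinear c L)
    (μ := MeasureTheory.volume) (a := fun k : ℕ => (k : ℝ)) (n := L)
    (fun k _ => (continuous_piecewiseLinear c L).intervalIntegrable _ _)
  rw [Nat.cast_zero] at h
  rw [← h, Finset.smul_sum]
  refine Finset.sum_congr rfl fun k hk => ?_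
  have hk := Finset.mem_range.1 hk
  rw [integral_congr (g := fun t => c k + (t - k) • (c (k + 1) - c k)) fun t ht => ?_,
    integral_affine, smul_smul, mul_inv_cancel₀ two_ne_zero, one_smul]
  rw [Set.uIcc_of_le (by push_cast; linarith)] at ht
  exact piecewiseLinear_eq c hk ht.1 (by simpa using ht.2)

end PiecewiseLinear

section FiberPolyhedra

open MeasureTheory

variable {n : ℕ} {I : Finset (Fin n)} {A : Finset (Fin n → ℕ)} {p b : {i // i ∉ I} → ℤ} {L : ℕ}

theorem latticeMeasure_singleton {ι : Type} [Fintype ι] (a : ι → ℝ) :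
    latticeMeasure {a} = Measure.dirac a := by
  rw [latticeMeasure_eq (dimOf_singleton a) (p := a) rfl (b := Fin.elim0)]
  · have h : (fun t : Fin 0 → ℝ => a + ∑ k, t k • intVec (Fin.elim0 k : ι → ℤ)) = fun _ => a := by
      funext t
      simp
    rw [h, Measure.map_const, Nat.factorial_zero, one_smul, Measure.volume_pi_eq_dirac 0]
    simp
  · rw [vectorSpan_singleton]
    refine ⟨fun j => j.elim0, fun z hz => ⟨Fin.elim0, ?_, fun c _ => Subsingleton.elim _ _⟩⟩
    have hz0 : intVec z = 0 := hz
    rw [← intVec_zero] at hz0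
    simpa using intVec_injective hz0
  · rintro q rfl
    exact ⟨0, by simp⟩

theorem fiberPolyhedron_singleton {N : Set (Fin n → ℝ)} (a : {i // i ∉ I} → ℝ) :
    fiberPolyhedron I N {a} = fiberAt I N a := by
  have hint : ∀ s : ({i // i ∉ I} → ℝ) → Fin n → ℝ,
      (1 + dimOf ({a} : Set ({i // i ∉ I} → ℝ)) : ℝ) • ∫ x in {a}, s x ∂(latticeMeasure {a}) =
        s a := by
    intro s
    rw [latticeMeasure_singleton, dimOf_singleton, Measure.restrict_singleton]
    simp
  ext x
  constructor
  · rintro ⟨s, -, hs, rfl⟩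
    rw [hint]
    exact ⟨s a, hs a rfl, rfl⟩
  · rintro ⟨z, hz, rfl⟩
    refine ⟨fun _ => z, continuousOn_const, ?_, ?_⟩
    · rintro _ rfl
      exact hz
    · rw [hint]

theorem LocalPolyhedron.mem_sum {ι : Type} {α : Type*} (s : Finset α)
    (P : α → LocalPolyhedron ι) {q : ι → ℝ} (hs : s.Nonempty) :
    q ∈ (∑ a ∈ s, P a).1 ↔ ∃ x : α → ι → ℝ, (∀ a ∈ s, x a ∈ (P a).1) ∧ q = ∑ a ∈ s, x a := by
  classical
  induction hs using Finset.Nonempty.cons_induction generalizing q with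
  | singleton a =>
    simp only [Finset.sum_singleton, Finset.mem_singleton]
    exact ⟨fun h => ⟨fun _ => q, by rintro _ rfl; exact h, rfl⟩, fun ⟨x, hx, h⟩ => h ▸ hx a rfl⟩
  | cons a s ha hs ih =>
    rw [Finset.sum_cons]
    constructor
    · rintro ⟨u, hu, w, hw, rfl⟩
      obtain ⟨x, hx, rfl⟩ := ih.1 hw
      refine ⟨Function.update x a u, fun c hc => ?_, ?_⟩
      · rcases Finset.mem_cons.1 hc with rfl | hc
        · simpa using hu
        · rw [Function.update_of_ne (ne_of_mem_of_not_mem hc ha)]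
          exact hx c hc
      · rw [Finset.sum_cons, Function.update_self]
        congr 1
        refine Finset.sum_congr rfl fun c hc => ?_
        rw [Function.update_of_ne (ne_of_mem_of_not_mem hc ha)]
    · rintro ⟨x, hx, rfl⟩
      rw [Finset.sum_cons]
      exact ⟨_, hx a (Finset.mem_cons_self a s), _,
        ih.2 ⟨x, fun c hc => hx c (Finset.mem_cons_of_mem hc), rfl⟩, rfl⟩

/-- The trapezoid sum of the fibers over an edge. -/
noncomputable def edgeSum (I : Finset (Fin n)) (A : Finset (Fin n → ℕ)) (p b : {i // i ∉ I} → ℤ)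
    (L : ℕ) : LocalPolyhedron {i // i ∈ I} :=
  ∑ k ∈ Finset.range L,
    (localFiber I A (intVec (p + k • b)) + localFiber I A (intVec (p + (k + 1) • b)))

theorem IsEdgeParam.localFiber_val (h : IsEdgeParam I A p b L) {k : ℕ} (hk : k ≤ L) :
    (localFiber I A (intVec (p + k • b))).1 = edgeFiber I A p b k := by
  have h1 := h.isLocalPolyhedron hk
  rw [edgeFiber, ← intVec_add_nsmul] at h1
  rw [_root_.localFiber_val h1, edgeFiber, intVec_add_nsmul]

theorem IsEdgeParam.mem_edgeSum (h : IsEdgeParam I A p b L) {q : {i // i ∈ I} → ℝ} :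
    q ∈ (edgeSum I A p b L).1 ↔ ∃ u w : ℕ → {i // i ∈ I} → ℝ,
      (∀ k < L, u k ∈ edgeFiber I A p b k ∧ w k ∈ edgeFiber I A p b ((k + 1 : ℕ) : ℝ)) ∧
        q = ∑ k ∈ Finset.range L, (u k + w k) := by
  rw [edgeSum, LocalPolyhedron.mem_sum _ _ (Finset.nonempty_range_iff.2 h.pos.ne')]
  have hmem : ∀ k < L, ∀ x, x ∈ (localFiber I A (intVec (p + k • b)) +
      localFiber I A (intVec (p + (k + 1) • b))).1 ↔
        x ∈ edgeFiber I A p b k + edgeFiber I A p b ((k + 1 : ℕ) : ℝ) := by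
    intro k hk x
    rw [← h.localFiber_val hk.le, ← h.localFiber_val hk]
    rfl
  constructor
  · rintro ⟨x, hx, rfl⟩
    have h1 : ∀ k, ∃ u w, k < L → u ∈ edgeFiber I A p b k ∧
        w ∈ edgeFiber I A p b ((k + 1 : ℕ) : ℝ) ∧ u + w = x k := by
      intro k
      by_cases hk : k < L
      · obtain ⟨u, hu, w, hw, huw⟩ := (hmem k hk _).1 (hx k (Finset.mem_range.2 hk))
        exact ⟨u, w, fun _ => ⟨hu, hw, huw⟩⟩
      · exact ⟨0, 0, fun h => absurd h hk⟩
    choose u w huw using h1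
    exact ⟨u, w, fun k hk => ⟨(huw k hk).1, (huw k hk).2.1⟩,
      Finset.sum_congr rfl fun k hk => (huw k (Finset.mem_range.1 hk)).2.2.symm⟩
  · rintro ⟨u, w, huw, rfl⟩
    refine ⟨fun k => u k + w k, fun k hk => ?_, rfl⟩
    have hk := Finset.mem_range.1 hk
    exact (hmem k hk _).2 ⟨_, (huw k hk).1, _, (huw k hk).2, rfl⟩

/-- The points of an element of the trapezoid sum can be chosen equal at the lattice points shared
by two unit segments, by convexity of the fibers. -/
theorem IsEdgeParam.exists_vertices (h : IsEdgeParam I A p b L) {q : {i // i ∈ I} → ℝ}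
    (hq : q ∈ (edgeSum I A p b L).1) : ∃ c : ℕ → {i // i ∈ I} → ℝ,
      (∀ k ≤ L, c k ∈ edgeFiber I A p b k) ∧ q = ∑ k ∈ Finset.range L, (c k + c (k + 1)) := by
  obtain ⟨u, w, huw, rfl⟩ := h.mem_edgeSum.1 hq
  obtain ⟨M, rfl⟩ := Nat.exists_eq_add_of_lt h.pos
  rw [zero_add] at *
  refine ⟨fun k => if k = 0 then u 0 else if k = M + 1 then w M else
    (2 : ℝ)⁻¹ • (w (k - 1) + u k), fun k hk => ?_, ?_⟩
  · simp only
    split_ifs with h1 h2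
    · rw [h1]; exact (huw 0 (by omega)).1
    · rw [h2]; exact (huw M (by omega)).2
    · have h3 := (huw (k - 1) (by omega)).2
      rw [Nat.sub_add_cancel (by omega)] at h3
      rw [smul_add]
      exact convex_edgeFiber _ h3 (huw k (by omega)).1 (by norm_num) (by norm_num) (by norm_num)
  · have hin : ∀ k ∈ Finset.range M, (if k + 1 = 0 then u 0 else if k + 1 = M + 1 then w M else
        (2 : ℝ)⁻¹ • (w (k + 1 - 1) + u (k + 1))) = (2 : ℝ)⁻¹ • (w k + u (k + 1)) := by
      intro k hk
      have := Finset.mem_range.1 hk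
      rw [if_neg (by omega), if_neg (by omega), Nat.add_sub_cancel]
    rw [Finset.sum_add_distrib, Finset.sum_add_distrib, Finset.sum_range_succ' (fun k => u k),
      Finset.sum_range_succ (fun k => w k), Finset.sum_range_succ', Finset.sum_range_succ,
      Finset.sum_congr rfl hin]
    beta_reduce
    rw [if_pos rfl, if_neg (by omega), if_pos rfl, ← Finset.smul_sum,
      Finset.sum_add_distrib]
    module

/-- The fiber polyhedron over an edge is the trapezoid sum of the fibers over its lattice points. -/
theorem IsEdgeParam.fiberPolyhedron_eq (h : IsEdgeParam I A p b L) :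
    fiberPolyhedron I (newtonPolyhedron A) (latticeSegment (intVec p) b L) =
      (edgeSum I A p b L).1 := by
  have hL : (0 : ℝ) < L := by exact_mod_cast h.pos
  have hint : ∀ s : ({i // i ∉ I} → ℝ) → Fin n → ℝ,
      (1 + dimOf (latticeSegment (intVec p) b L) : ℝ) • ∫ x in latticeSegment (intVec p) b L,
        s x ∂(latticeMeasure (latticeSegment (intVec p) b L)) =
          (2 : ℝ) • ∫ t in (0 : ℝ)..L, s (intVec p + t • intVec b) := by
    intro s
    rw [setIntegral_latticeSegment h.prim hL, dimOf_latticeSegment h.prim hL]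
    norm_num
  have hmemB : ∀ t ∈ Set.Icc (0 : ℝ) L, intVec p + t • intVec b ∈ latticeSegment (intVec p) b L :=
    fun t ht => ⟨t, ht, rfl⟩
  ext q
  constructor
  · rintro ⟨s, hs, hsN, rfl⟩
    rw [hint]
    by_contra hq
    obtain ⟨y, hy, hlt⟩ := (edgeSum I A p b L).2.exists_separation hq
    have hσ : ∀ t ∈ Set.Icc (0 : ℝ) L, projTo I (s (intVec p + t • intVec b)) ∈
        edgeFiber I A p b t := by
      intro t ht
      obtain ⟨h1, h2⟩ := hsN _ (hmemB t ht)
      exact ⟨_, ⟨h1, h2⟩, rfl⟩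
    have hcont : ContinuousOn (fun t : ℝ => s (intVec p + t • intVec b)) (Set.Icc 0 L) :=
      hs.comp (by fun_prop) hmemB
    set Λ : (Fin n → ℝ) →L[ℝ] ℝ := LinearMap.toContinuousLinearMap
      ((dotProductBilin ℝ ℝ y : ({i // i ∈ I} → ℝ) →ₗ[ℝ] ℝ) ∘ₗ projTo I) with hΛ
    have hΛv : ∀ z, Λ z = y ⬝ᵥ projTo I z := fun z => by simp [hΛ]
    -- minimum points of `y` on the fibers over the lattice points
    have hmin : ∀ k : ℕ, ∃ x : {i // i ∈ I} → ℝ, k ≤ L → x ∈ supportFace (edgeFiber I A p b k) y := by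
      intro k
      by_cases hk : k ≤ L
      · obtain ⟨x, hx⟩ := (h.isLocalPolyhedron hk).supportFace_nonempty hy
        exact ⟨x, fun _ => hx⟩
      · exact ⟨0, fun h => absurd h hk⟩
    choose x hx using hmin
    have h1 := hlt (∑ k ∈ Finset.range L, (x k + x (k + 1))) (h.mem_edgeSum.2
      ⟨x, fun k => x (k + 1), fun k hk => ⟨(hx k hk.le).1, (hx (k + 1) hk).1⟩, rfl⟩)
    have hcontU : ContinuousOn (fun t : ℝ => s (intVec p + t • intVec b)) (Set.uIcc 0 L) := by
      rwa [Set.uIcc_of_le hL.le]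
    rw [map_smul, dotProduct_smul, ← hΛv, ← ContinuousLinearMap.intervalIntegral_comp_comm Λ
      hcontU.intervalIntegrable, dotProduct_sum, smul_eq_mul] at h1
    have hΛcont : ContinuousOn (fun t : ℝ => Λ (s (intVec p + t • intVec b))) (Set.Icc 0 L) :=
      Λ.continuous.comp_continuousOn hcont
    have hsub : ∀ k < L, Set.Icc (k : ℝ) ((k + 1 : ℕ) : ℝ) ⊆ Set.Icc 0 L := fun k hk =>
      Set.Icc_subset_Icc (Nat.cast_nonneg k) (by exact_mod_cast hk)
    have hii : ∀ k < L, IntervalIntegrable (fun t : ℝ => Λ (s (intVec p + t • intVec b))) volume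
        (k : ℝ) ((k + 1 : ℕ) : ℝ) := fun k hk => by
      refine ContinuousOn.intervalIntegrable ?_
      rw [Set.uIcc_of_le (by push_cast; linarith)]
      exact hΛcont.mono (hsub k hk)
    have h2 := intervalIntegral.sum_integral_adjacent_intervals
      (f := fun t : ℝ => Λ (s (intVec p + t • intVec b)))
      (μ := volume) (a := fun k : ℕ => (k : ℝ)) (n := L) hii
    rw [Nat.cast_zero] at h2
    rw [← h2, Finset.mul_sum] at h1
    refine absurd h1 (not_lt.2 (Finset.sum_le_sum fun k hk => ?_))
    have hk := Finset.mem_range.1 hk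
    have hle : ∀ t ∈ Set.Ioo (k : ℝ) ((k + 1 : ℕ) : ℝ),
        y ⬝ᵥ x k + (t - k) • (y ⬝ᵥ x (k + 1) - y ⬝ᵥ x k) ≤
          Λ (s (intVec p + t • intVec b)) := by
      rintro t ⟨ht0, ht1⟩
      push_cast at ht1
      have h3 := hσ t (hsub k hk ⟨ht0.le, by push_cast; linarith⟩)
      rw [show t = k + (t - k) by ring,
        h.interpolate hk (sub_pos.2 ht0) (by linarith)] at h3
      obtain ⟨_, ⟨v, hv, rfl⟩, _, ⟨w, hw, rfl⟩, hvw⟩ := h3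
      rw [hΛv, show t = k + (t - k) by ring, ← hvw]
      simp only [dotProduct_add, dotProduct_smul, smul_eq_mul]
      have h4 := mul_le_mul_of_nonneg_left ((hx k hk.le).2 v hv)
        (show 0 ≤ 1 - (t - k) by linarith)
      have h5 := mul_le_mul_of_nonneg_left ((hx (k + 1) hk).2 w hw) (sub_pos.2 ht0).le
      have h6 : (k : ℝ) + (t - k) - k = t - k := by ring
      rw [h6]
      linarith
    have h7 := intervalIntegral.integral_mono_on_of_le_Ioo (by push_cast; linarith)
      (Continuous.intervalIntegrable (by fun_prop) _ _) (hii k hk) hle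
    rw [integral_affine] at h7
    rw [dotProduct_add]
    simp only [smul_eq_mul] at h7 ⊢
    linarith
  · intro hq
    obtain ⟨c, hc, rfl⟩ := h.exists_vertices hq
    obtain ⟨g, hg⟩ := id h.prim
    have hpos : ∀ t : ℝ, intVec g ⬝ᵥ (intVec p + t • intVec b - intVec p) = t := fun t => by
      rw [add_sub_cancel_left, dotProduct_smul, intVec_dotProduct, hg]
      simp
    have hS : ∀ t ∈ Set.Icc (0 : ℝ) L, piecewiseLinear c L t ∈ edgeFiber I A p b t := by
      rintro t ⟨ht0, ht1⟩
      obtain ⟨k, hkL, hk0, hk1⟩ : ∃ k : ℕ, k < L ∧ (k : ℝ) ≤ t ∧ t ≤ k + 1 := by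
        rcases ht1.eq_or_lt with rfl | ht1
        · refine ⟨L - 1, Nat.sub_lt h.pos one_pos, ?_, ?_⟩ <;>
          · rw [Nat.cast_pred h.pos]
            linarith
        · exact ⟨⌊t⌋₊, (Nat.floor_lt ht0).2 ht1, Nat.floor_le ht0, (Nat.lt_floor_add_one t).le⟩
      rw [piecewiseLinear_eq c hkL hk0 hk1]
      have h1 := edgeFiber_convex_combo (s := 1 - (t - k)) (r := t - k) (by linarith)
        (by linarith) (by ring) (hc k hkL.le) (hc (k + 1) hkL)
      have e : (1 - (t - k)) * (k : ℝ) + (t - k) * ((k + 1 : ℕ) : ℝ) = t := by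
        push_cast
        ring
      rw [e] at h1
      convert h1 using 1
      module
    refine ⟨fun x => glue I (piecewiseLinear c L (intVec g ⬝ᵥ (x - intVec p))) x, ?_, ?_, ?_⟩
    · refine Continuous.continuousOn (continuous_pi fun i => ?_)
      have hcg : Continuous fun x : {i // i ∉ I} → ℝ => intVec g ⬝ᵥ (x - intVec p) := by
        unfold dotProduct
        fun_prop
      unfold glue
      split_ifs with hi
      · exact (continuous_apply _).comp ((continuous_piecewiseLinear c L).comp hcg)
      · exact continuous_apply _
    · rintro _ ⟨t, ht, rfl⟩
      simp only [hpos, projAlong_glue, and_true]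
      exact mem_edgeFiber.1 (hS t ht)
    · rw [hint, map_smul, ← integral_piecewiseLinear]
      congr 1
      have hcont : Continuous fun t : ℝ => glue I (piecewiseLinear c L
          (intVec g ⬝ᵥ (intVec p + t • intVec b - intVec p))) (intVec p + t • intVec b) := by
        simp only [hpos]
        refine continuous_pi fun i => ?_
        unfold glue
        split_ifs with hi
        · exact (continuous_apply _).comp (continuous_piecewiseLinear c L)
        · fun_prop
      have h1 := ContinuousLinearMap.intervalIntegral_comp_comm
        (LinearMap.toContinuousLinearMap (projTo I)) (hcont.intervalIntegrable (μ := volume) 0 L)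
      simp only [LinearMap.coe_toContinuousLinearMap', projTo_glue, hpos] at h1 ⊢
      exact h1

end FiberPolyhedra

/-! ### Positivity and triviality of the virtual polyhedron -/

section Psi

variable {n : ℕ} {I : Finset (Fin n)} {A : Finset (Fin n → ℕ)} {m : ℕ}

theorem card_compl_subtype (hI : Iᶜ.card = 2) : Fintype.card {i // i ∉ I} = 2 := by
  rw [← hI]
  exact Fintype.card_of_subtype _ (by simp)

theorem coordOrder_eq {i : Fin n} (hi : i ∉ I) {c : ℕ}
    (hc : IsLeast ((fun x => x ⟨i, hi⟩) '' natPolyhedron (projPts I A)) (c : ℝ)) :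
    coordOrder (newtonPolyhedron A) i = c := by
  rw [← projAlong_newtonPolyhedron] at hc
  refine IsGreatest.csSup_eq ⟨fun x hx => ?_, fun d hd => ?_⟩
  · exact hc.2 ⟨_, ⟨x, hx, rfl⟩, rfl⟩
  · obtain ⟨_, ⟨x, hx, rfl⟩, hxc⟩ := hc.1
    have : (d : ℝ) ≤ c := (hd x hx).trans_eq hxc
    exact_mod_cast this

theorem hasSpecialPoint_iff : HasSpecialPoint I (newtonPolyhedron A) m ↔
    ∃ a, IsSpecial (natPolyhedron (projPts I A)) m a ∧
      HasBoundedEdge (fiberAt I (newtonPolyhedron A) (intVec a)) := by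
  rw [← projAlong_newtonPolyhedron]
  exact ⟨fun ⟨a, h1, h2, h3⟩ => ⟨a, ⟨h1, h2⟩, h3⟩, fun ⟨a, ⟨h1, h2⟩, h3⟩ => ⟨a, h1, h2, h3⟩⟩

/-- The multiplicities with which the lattice points of the bounded edges enter the alternating sum
of the trapezoid sums over the contributing faces. -/
theorem exists_newton_multiplicity (hI : Iᶜ.card = 2)
    (h0 : (0 : {i // i ∉ I} → ℝ) ∉ projAlong I '' newtonPolyhedron A)
    (hnt : ∀ i ∉ I, coordOrder (newtonPolyhedron A) i ≠ 0 →
      ¬ m ∣ coordOrder (newtonPolyhedron A) i) :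
    ∃ (S : Finset ({i // i ∉ I} → ℤ)) (c : ({i // i ∉ I} → ℤ) → ℕ),
      (∀ a, a ∈ S ↔ IsSpecial (natPolyhedron (projPts I A)) m a) ∧ (∀ a ∈ S, 0 < c a) ∧
      ∀ {M : Type} [AddCommGroup M] (φ : ({i // i ∉ I} → ℤ) → M),
        ∑ᶠ B ∈ {B | IsContributing I (newtonPolyhedron A) m B},
          ((-1 : ℤ) ^ dimOf B) • trapezoidSum φ B = -∑ a ∈ S, c a • φ a := by
  rw [projAlong_newtonPolyhedron] at h0
  obtain ⟨S, c, h1, h2, h3⟩ := exists_multiplicity (card_compl_subtype hI) h0 (m := m)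
    fun i c hc hleast => by
      have := coordOrder_eq i.2 hleast
      have h := hnt i i.2
      rw [this] at h
      exact h hc.ne'
  refine ⟨S, c, h1, h2, fun φ => ?_⟩
  have : {B | IsContributing I (newtonPolyhedron A) m B} =
      contributingFaces (natPolyhedron (projPts I A)) m := by
    rw [← projAlong_newtonPolyhedron]
    rfl
  rw [this]
  exact h3 φ

theorem IsContributing.cases {B : Set ({i // i ∉ I} → ℝ)} (hI : Iᶜ.card = 2)
    (hB : IsContributing I (newtonPolyhedron A) m B) :
    (∃ a, B = {intVec a} ∧ IsFace (projAlong I '' newtonPolyhedron A) {intVec a}) ∨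
      ∃ p b L, IsEdgeParam I A p b L ∧ B = latticeSegment (intVec p) b L := by
  have h1 := hB.1.1
  rw [projAlong_newtonPolyhedron] at h1
  rcases boundedFace_cases (card_compl_subtype hI) h1 hB.2.1 with ⟨a, rfl⟩ | hE
  · exact .inl ⟨a, rfl, hB.1.1⟩
  · rw [← projAlong_newtonPolyhedron] at hE
    exact .inr (exists_isEdgeParam hE)

theorem IsContributing.isLocalPolyhedron {B : Set ({i // i ∉ I} → ℝ)} (hI : Iᶜ.card = 2)
    (hB : IsContributing I (newtonPolyhedron A) m B) :
    IsLocalPolyhedron (fiberPolyhedron I (newtonPolyhedron A) B) := by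
  rcases hB.cases hI with ⟨a, rfl, ha⟩ | ⟨p, b, L, h, rfl⟩
  · rw [fiberPolyhedron_singleton]
    exact isLocalPolyhedron_vertexFiber ha
  · rw [h.fiberPolyhedron_eq]
    exact (edgeSum I A p b L).2

theorem IsContributing.ofSet_fiberPolyhedron {B : Set ({i // i ∉ I} → ℝ)} (hI : Iᶜ.card = 2)
    (hB : IsContributing I (newtonPolyhedron A) m B) :
    VirtualPolyhedron.ofSet (fiberPolyhedron I (newtonPolyhedron A) B) =
      trapezoidSum (fun a => Algebra.GrothendieckAddGroup.of (localFiber I A (intVec a))) B := by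
  rcases hB.cases hI with ⟨a, rfl, ha⟩ | ⟨p, b, L, h, rfl⟩
  · rw [fiberPolyhedron_singleton, trapezoidSum_singleton,
      ← localFiber_val (isLocalPolyhedron_vertexFiber ha), ofSet_val]
  · rw [h.fiberPolyhedron_eq, trapezoidSum_segment _ h.prim h.pos, ofSet_val, edgeSum, map_sum]
    simp only [map_add]

theorem IsSpecial.isLocalPolyhedron {a : {i // i ∉ I} → ℤ}
    (ha : IsSpecial (natPolyhedron (projPts I A)) m a) :
    IsLocalPolyhedron (fiberAt I (newtonPolyhedron A) (intVec a)) := by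
  obtain ⟨⟨B, hB, haB, -⟩, -⟩ := ha
  rw [← projAlong_newtonPolyhedron] at hB
  obtain ⟨p, b, L, h, rfl⟩ := exists_isEdgeParam hB
  obtain ⟨k, hk, rfl⟩ := (mem_latticeSegment_iff h.prim).1 haB
  have := h.isLocalPolyhedron hk
  rwa [edgeFiber, ← intVec_add_nsmul] at this

theorem virtualPsi_eq (hI : Iᶜ.card = 2) {S : Finset ({i // i ∉ I} → ℤ)}
    {c : ({i // i ∉ I} → ℤ) → ℕ}
    (hS : ∀ {M : Type} [AddCommGroup M] (φ : ({i // i ∉ I} → ℤ) → M),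
        ∑ᶠ B ∈ {B | IsContributing I (newtonPolyhedron A) m B},
          ((-1 : ℤ) ^ dimOf B) • trapezoidSum φ B = -∑ a ∈ S, c a • φ a) :
    -virtualPsi I (newtonPolyhedron A) m =
      Algebra.GrothendieckAddGroup.of (∑ a ∈ S, c a • localFiber I A (intVec a)) := by
  rw [virtualPsi, finsum_mem_congr rfl fun B hB => by rw [IsContributing.ofSet_fiberPolyhedron hI hB],
    hS, neg_neg, map_sum]
  simp only [map_nsmul]

theorem LocalPolyhedron.shift_zero {ι : Type} : (LocalPolyhedron.shift 0 : LocalPolyhedron ι) = 0 := by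
  refine Subtype.ext ?_
  change polyhedronOf {0} = orthant ι
  have h : (fun i => ((0 : ι → ℚ) i : ℝ)) = (0 : ι → ℝ) := by
    ext i
    simp
  rw [polyhedronOf_singleton, h, Set.singleton_zero, zero_add]

theorem LocalPolyhedron.shift_add {ι : Type} (v w : ι → ℚ) :
    LocalPolyhedron.shift (v + w) = LocalPolyhedron.shift v + LocalPolyhedron.shift w := by
  refine Subtype.ext ?_
  change polyhedronOf {v + w} = polyhedronOf {v} + polyhedronOf {w}
  simp only [polyhedronOf_singleton]
  rw [add_add_add_comm, orthant_add_orthant, Set.singleton_add_singleton]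
  congr 2
  ext i
  simp

/-- Shifted orthants, as a homomorphism. -/
def shiftHom (ι : Type) : (ι → ℚ) →+ LocalPolyhedron ι where
  toFun := LocalPolyhedron.shift
  map_zero' := LocalPolyhedron.shift_zero
  map_add' := LocalPolyhedron.shift_add

theorem VirtualPolyhedron.isTrivial_neg {ι : Type} {X : VirtualPolyhedron ι} (h : X.IsTrivial) :
    (-X).IsTrivial := by
  obtain ⟨v, rfl⟩ := h
  refine ⟨-v, neg_eq_of_add_eq_zero_right ?_⟩
  rw [← map_add, ← LocalPolyhedron.shift_add, add_neg_cancel, LocalPolyhedron.shift_zero, map_zero]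

theorem virtualPsi_isTrivial_iff (hI : Iᶜ.card = 2)
    (h0 : (0 : {i // i ∉ I} → ℝ) ∉ projAlong I '' newtonPolyhedron A)
    (hnt : ∀ i ∉ I, coordOrder (newtonPolyhedron A) i ≠ 0 →
      ¬ m ∣ coordOrder (newtonPolyhedron A) i) :
    ¬ (virtualPsi I (newtonPolyhedron A) m).IsTrivial ↔
      HasSpecialPoint I (newtonPolyhedron A) m := by
  obtain ⟨S, c, hS, hc, hsum⟩ := exists_newton_multiplicity hI h0 hnt
  have hψ := virtualPsi_eq hI hsum
  rw [hasSpecialPoint_iff]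
  refine ⟨fun h => ?_, fun ⟨a, ha, hE⟩ h => ?_⟩
  · by_contra! hno
    refine h ?_
    have hshift : ∀ a ∈ S, ∃ v, localFiber I A (intVec a) = LocalPolyhedron.shift v := by
      intro a ha
      have ha := (hS a).1 ha
      obtain ⟨v, hv⟩ := ha.isLocalPolyhedron.eq_shift (hno a ha)
      exact ⟨v, Subtype.ext ((localFiber_val ha.isLocalPolyhedron).trans hv)⟩
    choose! v hv using hshift
    rw [← neg_neg (virtualPsi _ _ _)]
    refine VirtualPolyhedron.isTrivial_neg ⟨∑ a ∈ S, c a • v a, ?_⟩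
    rw [hψ]
    congr 1
    change _ = shiftHom _ _
    rw [map_sum]
    refine Finset.sum_congr rfl fun a ha => ?_
    rw [map_nsmul, hv a ha]
    rfl
  · obtain ⟨w, hw⟩ := VirtualPolyhedron.isTrivial_neg h
    rw [hψ] at hw
    have haS := (hS a).2 ha
    refine not_hasBoundedEdge_of_linear (s := S) (P := fun a => localFiber I A (intVec a)) (c := c)
      (w := fun i => (w i : ℝ)) ?_ haS (hc a haS).ne' ?_
    · intro y hy
      have h1 := congrArg (virtualSupport hy) hw
      rw [virtualSupport_of, virtualSupport_of, map_sum, supportHom_shift] at h1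
      rw [← h1]
      refine Finset.sum_congr rfl fun a _ => ?_
      rw [map_nsmul, nsmul_eq_mul]
    · rwa [localFiber_val ha.isLocalPolyhedron]

end Psi

/-! ### Faces with the recession cone of a coordinate plane -/

section VIFaces

variable {n : ℕ} {I : Finset (Fin n)} {A : Finset (Fin n → ℕ)} {m : ℕ}
  {B : Set ({i // i ∉ I} → ℝ)}

theorem surjective_projAlongLin : Function.Surjective (projAlongLin I) := fun a =>
  ⟨glue I 0 a, projAlong_glue _ _⟩

theorem projAlong_image_overFace {N : Set (Fin n → ℝ)} (hB : B ⊆ projAlong I '' N) :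
    projAlong I '' overFace I N B = B := by
  ext b
  constructor
  · rintro ⟨z, hz, rfl⟩
    exact hz.2
  · intro hb
    obtain ⟨z, hz, rfl⟩ := hB hb
    exact ⟨z, ⟨hz, hb⟩, rfl⟩

theorem overFace_add_mem {z c : Fin n → ℝ} (hz : z ∈ overFace I (newtonPolyhedron A) B)
    (hc : c ∈ coneOver I) : z + c ∈ overFace I (newtonPolyhedron A) B := by
  refine ⟨natPolyhedron_add_mem hz.1 hc.1, ?_⟩
  rw [projAlong_add, hc.2, add_zero]
  exact hz.2

theorem single_mem_coneOver {i : Fin n} (hi : i ∈ I) {t : ℝ} (ht : 0 ≤ t) :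
    Pi.single i t ∈ coneOver I := by
  refine ⟨single_mem_orthant ht, ?_⟩
  ext ⟨j, hj⟩
  have : j ≠ i := fun h => hj (h ▸ hi)
  simp [projAlong, this]

theorem finrank_ker_projAlongLin :
    Module.finrank ℝ (LinearMap.ker (projAlongLin I)) = I.card := by
  have h1 := (projAlongLin I).finrank_range_add_finrank_ker
  rw [LinearMap.range_eq_top.2 surjective_projAlongLin, finrank_top, Module.finrank_fintype_fun_eq_card,
    Module.finrank_fintype_fun_eq_card, Fintype.card_subtype_compl, Fintype.card_coe,
    Fintype.card_fin] at h1
  have h2 := Finset.card_le_univ I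
  rw [Fintype.card_fin] at h2
  omega

theorem ker_projAlongLin_le (hne : B.Nonempty) (hB : B ⊆ projAlong I '' newtonPolyhedron A) :
    LinearMap.ker (projAlongLin I) ≤ vectorSpan ℝ (overFace I (newtonPolyhedron A) B) := by
  obtain ⟨b, hb⟩ := hne
  obtain ⟨z, hz, rfl⟩ := hB hb
  intro x hx
  have hx0 : projAlong I x = 0 := hx
  have hsingle : ∀ i ∈ I, Pi.single i (1 : ℝ) ∈
      vectorSpan ℝ (overFace I (newtonPolyhedron A) B) := by
    intro i hi
    have h1 := vsub_mem_vectorSpan ℝ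
      (overFace_add_mem (B := B) ⟨hz, hb⟩ (single_mem_coneOver hi zero_le_one)) ⟨hz, hb⟩
    simpa using h1
  have hsum : x = ∑ i, x i • Pi.single i (1 : ℝ) := by
    ext j
    simp [Finset.sum_apply, Pi.single_apply]
  rw [hsum]
  refine Submodule.sum_mem _ fun i _ => ?_
  by_cases hi : i ∈ I
  · exact Submodule.smul_mem _ _ (hsingle i hi)
  · have : x i = 0 := congrFun hx0 ⟨i, hi⟩
    rw [this, zero_smul]
    exact Submodule.zero_mem _

theorem map_vectorSpan_projAlongLin (S : Set (Fin n → ℝ)) :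
    (vectorSpan ℝ S).map (projAlongLin I) = vectorSpan ℝ (projAlong I '' S) :=
  (projAlongLin I).toAffineMap.map_vectorSpan

theorem finrank_map_add_finrank_inf_ker {V W : Type*} [AddCommGroup V] [Module ℝ V]
    [FiniteDimensional ℝ V] [AddCommGroup W] [Module ℝ W] (f : V →ₗ[ℝ] W) (U : Submodule ℝ V) :
    Module.finrank ℝ (U.map f) + Module.finrank ℝ (U ⊓ LinearMap.ker f : Submodule ℝ V) =
      Module.finrank ℝ U := by
  have h := (f.domRestrict U).finrank_range_add_finrank_ker
  rw [LinearMap.range_domRestrict, LinearMap.ker_domRestrict] at h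
  rw [← h]
  congr 1
  rw [← Submodule.finrank_map_subtype_eq, Submodule.map_comap_subtype]

theorem dimOf_overFace (hne : B.Nonempty) (hB : B ⊆ projAlong I '' newtonPolyhedron A) :
    dimOf (overFace I (newtonPolyhedron A) B) = I.card + dimOf B := by
  have h := finrank_map_add_finrank_inf_ker (projAlongLin I)
    (vectorSpan ℝ (overFace I (newtonPolyhedron A) B))
  rw [inf_eq_right.2 (ker_projAlongLin_le hne hB), finrank_ker_projAlongLin,
    map_vectorSpan_projAlongLin, projAlong_image_overFace hB] at h
  rw [dimOf, ← h, dimOf, add_comm]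

theorem gcd_eq_one_iff_isPrimitive {κ : Type} [Fintype κ] {l : κ → ℤ} :
    Finset.univ.gcd l = 1 ↔ IsPrimitive l := by
  refine ⟨isPrimitive_of_gcd, fun ⟨c, hc⟩ => ?_⟩
  rw [← Finset.normalize_gcd, normalize_eq_one]
  refine isUnit_of_dvd_one ?_
  rw [← hc]
  exact Finset.dvd_sum fun i hi => (Finset.gcd_dvd hi).mul_left _

theorem glue_dotProduct {R : Type} [CommRing R] (x x' : {i // i ∈ I} → R)
    (a a' : {i // i ∉ I} → R) : glue I x a ⬝ᵥ glue I x' a' = x ⬝ᵥ x' + a ⬝ᵥ a' := by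
  rw [dotProduct, ← Fintype.sum_subtype_add_sum_subtype (fun i => i ∈ I)]
  congr 1
  · refine Finset.sum_congr (by ext; simp) fun i _ => ?_
    simp [glue, i.2]
  · refine Finset.sum_congr (by ext; simp) fun i _ => ?_
    simp [glue, i.2]

theorem intVec_glue (x : {i // i ∈ I} → ℤ) (a : {i // i ∉ I} → ℤ) :
    intVec (glue I x a) = glue I (intVec x) (intVec a) := by
  ext i
  by_cases hi : i ∈ I <;> simp [glue, hi]

theorem glue_surjective {R : Type} (z : Fin n → R) : ∃ x a, z = glue I x a := by
  refine ⟨fun i => z i, fun i => z i, ?_⟩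
  ext i
  by_cases hi : i ∈ I <;> simp [glue, hi]

theorem isPrimitive_glue_zero_left {a : {i // i ∉ I} → ℤ} :
    IsPrimitive (glue I 0 a) ↔ IsPrimitive a := by
  constructor
  · rintro ⟨c, hc⟩
    obtain ⟨x, c, rfl⟩ := glue_surjective (I := I) c
    rw [glue_dotProduct, dotProduct_zero, zero_add] at hc
    exact ⟨c, hc⟩
  · rintro ⟨c, hc⟩
    exact ⟨glue I 0 c, by rw [glue_dotProduct, hc, dotProduct_zero, zero_add]⟩

/-- A covector constant on the part of `N` over `B` vanishes on `ℝ^I`, so it is a covector constant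
on `B`. -/
theorem latticeDist_overFace (hne : B.Nonempty) (hB : B ⊆ projAlong I '' newtonPolyhedron A) :
    latticeDist (overFace I (newtonPolyhedron A) B) = latticeDist B := by
  have hz : ∀ b ∈ B, ∃ z ∈ overFace I (newtonPolyhedron A) B, projAlong I z = b := fun b hb => by
    rw [← projAlong_image_overFace hB] at hb
    exact hb
  have hsum : ∀ {κ : Type} [Fintype κ] (l : κ → ℤ) (x : κ → ℝ),
      ∑ i, (l i : ℝ) * x i = intVec l ⬝ᵥ x := fun l x => rfl
  rw [latticeDist, latticeDist]
  congr 1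
  ext d
  simp only [Set.mem_ofPred_eq, gcd_eq_one_iff_isPrimitive, hsum]
  constructor
  · rintro ⟨l, h1, h2, h3⟩
    obtain ⟨x, a, rfl⟩ := glue_surjective (I := I) l
    have hx : x = 0 := by
      obtain ⟨b, hb⟩ := hne
      obtain ⟨z, hz, -⟩ := hz b hb
      ext i
      have h4 := h3 _ (overFace_add_mem hz (single_mem_coneOver i.2 zero_le_one))
      rw [dotProduct_add, h3 z hz, dotProduct_single] at h4
      simpa [glue, i.2] using h4
    subst hx
    rw [isPrimitive_glue_zero_left] at h1
    refine ⟨a, h1, fun i hi => ?_, fun b hb => ?_⟩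
    · have := h2 i fun z hz => hi _ hz.2
      simpa [glue, i.2] using this
    · obtain ⟨z, hz, rfl⟩ := hz b hb
      rw [← h3 z hz, ← glue_proj (I := I) z, intVec_glue, glue_dotProduct, intVec_zero,
        zero_dotProduct, zero_add, projAlong_glue]
  · rintro ⟨a, h1, h2, h3⟩
    refine ⟨glue I 0 a, isPrimitive_glue_zero_left.2 h1, fun i hi => ?_, fun z hz => ?_⟩
    · by_cases hiI : i ∈ I
      · simp [glue, hiI]
      · have := h2 ⟨i, hiI⟩ fun b hb => by
          obtain ⟨z, hz, rfl⟩ := hz b hb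
          exact hi z hz
        simpa [glue, hiI] using this
    · rw [← h3 _ hz.2, ← glue_proj (I := I) z, intVec_glue, glue_dotProduct, intVec_zero,
        zero_dotProduct, zero_add, projAlong_glue]

theorem mem_of_isBounded_projAlong {K : Finset (Fin n)} {Γ : Set (Fin n → ℝ)} (hne : Γ.Nonempty)
    (hK : Bornology.IsBounded (projAlong K '' Γ)) {i : Fin n}
    (hi : ∀ z ∈ Γ, ∀ t : ℝ, 0 ≤ t → z + Pi.single i t ∈ Γ) : i ∈ K := by
  by_contra hiK
  obtain ⟨z, hz⟩ := hne
  obtain ⟨r, hr⟩ := hK.exists_norm_le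
  have h1 := hr _ ⟨_, hi z hz (r + |z i| + 1) ?_, rfl⟩
  · have h2 := (norm_le_pi_norm _ ⟨i, hiK⟩).trans h1
    simp only [projAlong, Pi.add_apply, Pi.single_eq_same, Real.norm_eq_abs] at h2
    have h3 := (abs_le.1 h2).2
    have h4 := neg_abs_le (z i)
    linarith
  · have := (norm_nonneg _).trans (hr _ ⟨z, hz, rfl⟩)
    positivity

theorem isVIFace_overFace (hB : IsVFace (projAlong I '' newtonPolyhedron A) B)
    (hb : Bornology.IsBounded B) :
    IsVIFace I (newtonPolyhedron A) (overFace I (newtonPolyhedron A) B) := by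
  obtain ⟨⟨hne, u, rfl⟩, J, hJ, hJ0⟩ := hB
  have hsub : supportFace (projAlong I '' newtonPolyhedron A) u ⊆
    projAlong I '' newtonPolyhedron A := fun x hx => hx.1
  have himage := projAlong_image_overFace hsub
  have hneΓ := hne
  rw [← himage, Set.image_nonempty] at hneΓ
  refine ⟨⟨⟨hneΓ, _, overFace_supportFace u⟩, I ∪ J.map (Function.Embedding.subtype _), ?_, ?_⟩,
    ?_, fun K hK i hi => ?_⟩
  · rw [Finset.card_union_of_disjoint, Finset.card_map, hJ, dimOf_overFace hne hsub, add_assoc]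
    rw [Finset.disjoint_left]
    intro i hi hiJ
    obtain ⟨j, -, rfl⟩ := Finset.mem_map.1 hiJ
    exact j.2 hi
  · intro z hz i hi
    rw [Finset.mem_union, not_or] at hi
    exact hJ0 _ hz.2 ⟨i, hi.1⟩ fun h => hi.2 (Finset.mem_map.2 ⟨_, h, rfl⟩)
  · change Bornology.IsBounded (projAlong I '' _)
    rwa [himage]
  · exact mem_of_isBounded_projAlong hneΓ hK fun z hz t ht =>
      overFace_add_mem hz (single_mem_coneOver hi ht)

theorem IsVIFace.exists_overFace {Γ : Set (Fin n → ℝ)} (hΓ : IsVIFace I (newtonPolyhedron A) Γ) :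
    ∃ B, IsVFace (projAlong I '' newtonPolyhedron A) B ∧ Bornology.IsBounded B ∧
      Γ = overFace I (newtonPolyhedron A) B := by
  obtain ⟨⟨⟨hne, v, rfl⟩, J, hJ, hJ0⟩, hbd, hmin⟩ := hΓ
  change Bornology.IsBounded (projAlong I '' _) at hbd
  have hrec : ∀ z ∈ newtonPolyhedron A, ∀ i : Fin n, ∀ t : ℝ, 0 ≤ t →
      z + Pi.single i t ∈ newtonPolyhedron A := fun z hz i t ht =>
    natPolyhedron_add_mem hz (single_mem_orthant ht)
  have hv : ∀ i, 0 ≤ v i := fun i =>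
    nonneg_of_supportFace_nonempty (fun z hz t ht => hrec z hz i t ht) hne
  -- a coordinate of `I` with a positive value of `v` is bounded on the face
  have hvI : ∀ i ∈ I, v i = 0 := by
    intro i hi
    by_contra hvi
    have hpos := (hv i).lt_of_ne' hvi
    obtain ⟨z₀, hz₀⟩ := id hne
    obtain ⟨r, hr⟩ := hbd.exists_norm_le
    have hle : I ≤ I.erase i := by
      refine hmin ?_
      change Bornology.IsBounded (projAlong (I.erase i) '' _)
      refine (Metric.isBounded_closedBall (x := 0) (r := max r (v ⬝ᵥ z₀ / v i))).subset ?_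
      rintro _ ⟨z, hz, rfl⟩
      have hzN := natPolyhedron_subset_orthant A hz.1
      rw [mem_closedBall_zero_iff, pi_norm_le_iff_of_nonneg
        (le_max_of_le_left ((norm_nonneg _).trans (hr _ ⟨z, hz, rfl⟩)))]
      rintro ⟨j, hj⟩
      by_cases hjI : j ∈ I
      · obtain rfl : j = i := by
          by_contra hne
          exact hj (Finset.mem_erase.2 ⟨hne, hjI⟩)
        refine le_max_of_le_right ?_
        change ‖z j‖ ≤ _
        rw [Real.norm_of_nonneg (hzN j), le_div_iff₀ hpos, mul_comm]
        refine le_trans ?_ (hz.2 z₀ hz₀.1)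
        exact Finset.single_le_sum (f := fun k => v k * z k)
          (fun k _ => mul_nonneg (hv k) (hzN k)) (Finset.mem_univ j)
      · exact le_max_of_le_left ((norm_le_pi_norm (projAlong I z) ⟨j, hjI⟩).trans
          (hr _ ⟨z, hz, rfl⟩))
    exact Finset.notMem_erase i I (hle hi)
  have hglue : v = glue I 0 (projAlong I v) := by
    refine glue_ext (I := I) ?_ ?_
    · rw [projTo_glue]
      ext i
      exact hvI i i.2
    · rw [projAlong_glue]
  have hΓ : supportFace (newtonPolyhedron A) v = overFace I (newtonPolyhedron A)
      (supportFace (projAlong I '' newtonPolyhedron A) (projAlong I v)) := by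
    rw [overFace_supportFace, ← hglue]
  have hsub : supportFace (projAlong I '' newtonPolyhedron A) (projAlong I v) ⊆
    projAlong I '' newtonPolyhedron A := fun x hx => hx.1
  rw [hΓ] at hne hbd hJ hJ0
  rw [projAlong_image_overFace hsub] at hbd
  have hneB : (supportFace (projAlong I '' newtonPolyhedron A) (projAlong I v)).Nonempty := by
    rw [← projAlong_image_overFace hsub]
    exact hne.image _
  refine ⟨_, ⟨⟨hneB, _, rfl⟩, J.subtype (· ∉ I), ?_, ?_⟩, hbd, hΓ⟩
  · have hIJ : I ⊆ J := by
      intro i hi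
      by_contra hiJ
      obtain ⟨z, hz⟩ := hne
      have h1 := hJ0 _ (overFace_add_mem hz (single_mem_coneOver hi zero_le_one)) i hiJ
      rw [Pi.add_apply, hJ0 z hz i hiJ] at h1
      simp at h1
    have h1 : (J.subtype (· ∉ I)).card = (J \ I).card := by
      rw [Finset.card_subtype]
      congr 1
      ext i
      simp
    rw [dimOf_overFace hneB hsub] at hJ
    rw [h1, Finset.card_sdiff_of_subset hIJ]
    omega
  · rintro _ hx ⟨i, hi⟩ hiJ
    rw [← projAlong_image_overFace hsub] at hx
    obtain ⟨z, hz, rfl⟩ := hx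
    exact hJ0 z hz i fun h => hiJ (Finset.mem_subtype.2 h)

/-- The `V_I`-faces of `N` correspond to the bounded `V`-faces of the projection. -/
theorem tropicalWeight_eq (y : {i // i ∈ I} → ℝ) :
    tropicalWeight I (newtonPolyhedron A) m y =
      ∑ᶠ B ∈ {B | IsContributing I (newtonPolyhedron A) m B}, (-1 : ℝ) ^ dimOf B *
        pushDualFan I (overFace I (newtonPolyhedron A) B) (dimOf B + 1) y := by
  have hsub : ∀ {B}, IsFace (projAlong I '' newtonPolyhedron A) B →
      B ⊆ projAlong I '' newtonPolyhedron A := by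
    rintro _ ⟨-, v, rfl⟩ x hx
    exact hx.1
  symm
  refine finsum_mem_eq_of_bijOn (overFace I (newtonPolyhedron A)) ⟨?_, ?_, ?_⟩ ?_
  · intro B hB
    refine ⟨isVIFace_overFace hB.1 hB.2.1, ?_⟩
    rw [latticeDist_overFace hB.1.1.1 (hsub hB.1.1)]
    exact hB.2.2
  · intro B hB B' hB' h
    rw [← projAlong_image_overFace (hsub hB.1.1), h, projAlong_image_overFace (hsub hB'.1.1)]
  · rintro Γ ⟨hΓ, hm⟩
    obtain ⟨B, hB, hb, rfl⟩ := hΓ.exists_overFace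
    rw [latticeDist_overFace hB.1.1 (hsub hB.1)] at hm
    exact ⟨B, ⟨hB, hb, hm⟩, rfl⟩
  · intro B hB
    rw [dimOf_overFace hB.1.1.1 (hsub hB.1.1), Nat.add_sub_cancel_left]

end VIFaces

/-! ### Lattice indices of coordinate projections -/

section LatticeIndex

variable {n : ℕ} {I : Finset (Fin n)} {b : {i // i ∉ I} → ℤ}
  {V : Submodule ℝ (Fin n → ℝ)} {e : {i // i ∈ I} → ℤ} {f : Fin n → ℤ} {r : ℕ}

theorem intVec_zsmul {κ : Type} (k : ℤ) (z : κ → ℤ) : intVec (k • z) = (k : ℝ) • intVec z := by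
  ext i
  simp [intVec]

theorem intVec_sub {κ : Type} (z w : κ → ℤ) : intVec (z - w) = intVec z - intVec w := by
  ext i
  simp [intVec]

/-- The integer vectors of the plane `V` have a basis of a primitive vector `e` of `ℝ^I` and a vector
`f` with the projection `r b` along `ℝ^I`. -/
structure IsAdaptedBasis (I : Finset (Fin n)) (b : {i // i ∉ I} → ℤ)
    (V : Submodule ℝ (Fin n → ℝ)) (e : {i // i ∈ I} → ℤ) (f : Fin n → ℤ) (r : ℕ) : Prop where
  prim : IsPrimitive e
  pos : 0 < r
  proj : projAlong I (intVec f) = (r : ℝ) • intVec b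
  basis : IsLatticeBasis V ![glue I e 0, f]
  span : ∀ x ∈ V, ∃ s t : ℝ, x = s • intVec (glue I e 0) + t • intVec f

theorem isPrimitive_glue_zero_right : IsPrimitive (glue I e 0) ↔ IsPrimitive e := by
  constructor
  · rintro ⟨c, hc⟩
    obtain ⟨c, a, rfl⟩ := glue_surjective (I := I) c
    rw [glue_dotProduct, dotProduct_zero, add_zero] at hc
    exact ⟨c, hc⟩
  · rintro ⟨c, hc⟩
    exact ⟨glue I c 0, by rw [glue_dotProduct, hc, dotProduct_zero, add_zero]⟩

theorem exists_isAdaptedBasis (hb : IsPrimitive b) {Z : Set (Fin n → ℤ)}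
    (hV : V = Submodule.span ℝ (intVec '' Z)) (hdim : Module.finrank ℝ V = 2)
    (hproj : ∀ x ∈ V, ∃ t : ℝ, projAlong I x = t • intVec b)
    (hker : Module.finrank ℝ (V ⊓ LinearMap.ker (projAlongLin I) : Submodule ℝ (Fin n → ℝ)) = 1) :
    ∃ e f r, IsAdaptedBasis I b V e f r := by
  obtain ⟨c, hc⟩ := id hb
  -- the coefficient of `b` in the projection
  let β : (Fin n → ℤ) →+ ℤ :=
    { toFun := fun z => c ⬝ᵥ fun i => z i
      map_zero' := by simp [dotProduct]
      map_add' := fun z w => dotProduct_add c (fun i => z i) fun i => w i }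
  have hβ : ∀ z, intVec z ∈ V → projAlong I (intVec z) = (β z : ℝ) • intVec b := by
    intro z hz
    obtain ⟨t, ht⟩ := hproj _ hz
    have h1 : intVec c ⬝ᵥ projAlong I (intVec z) = (β z : ℝ) :=
      intVec_dotProduct c fun i => z i
    rw [ht, dotProduct_smul, intVec_dotProduct, hc] at h1
    rw [ht, ← h1]
    simp
  have hsub : ∀ z ∈ Z, intVec z ∈ V := fun z hz => by
    rw [hV]
    exact Submodule.subset_span ⟨z, hz, rfl⟩
  obtain ⟨g, hgZ, hg⟩ : ∃ g ∈ Z, β g ≠ 0 := by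
    by_contra! h
    have hle : V ≤ LinearMap.ker (projAlongLin I) := by
      refine hV.le.trans (Submodule.span_le.2 ?_)
      rintro _ ⟨z, hz, rfl⟩
      change projAlong I (intVec z) = 0
      rw [hβ z (hsub z hz), h z hz]
      simp
    rw [inf_eq_left.2 hle, hdim] at hker
    norm_num at hker
  obtain ⟨z, hzZ, hz⟩ : ∃ z ∈ Z, intVec z ∉ Submodule.span ℝ {intVec g} := by
    by_contra! h
    have hle : V ≤ Submodule.span ℝ {intVec g} := by
      refine hV.le.trans (Submodule.span_le.2 ?_)
      rintro _ ⟨z, hz, rfl⟩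
      exact h z hz
    have h1 := (Submodule.finrank_mono hle).trans (finrank_span_le_card (R := ℝ) {intVec g})
    simp at h1
    omega
  have hcomb : ∀ (k l : ℤ) (z w : Fin n → ℤ),
      intVec (k • z - l • w) = (k : ℝ) • intVec z - (l : ℝ) • intVec w := by
    intro k l z w
    rw [intVec_sub, intVec_zsmul, intVec_zsmul]
  obtain ⟨e, hprim, heV⟩ : ∃ e : {i // i ∈ I} → ℤ, IsPrimitive e ∧ intVec (glue I e 0) ∈ V := by
    have h1 : intVec (β g • z - β z • g) ∈ V := by
      rw [hcomb]
      exact V.sub_mem (V.smul_mem _ (hsub z hzZ)) (V.smul_mem _ (hsub g hgZ))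
    obtain ⟨x, a, hxa⟩ := glue_surjective (I := I) (β g • z - β z • g)
    have ha : a = 0 := by
      have h2 := hβ _ h1
      rw [map_sub, map_zsmul, map_zsmul, smul_eq_mul, smul_eq_mul, mul_comm, sub_self, hxa,
        intVec_glue, projAlong_glue, Int.cast_zero, zero_smul, ← intVec_zero] at h2
      exact intVec_injective h2
    subst ha
    have hx : x ≠ 0 := by
      rintro rfl
      refine hz (Submodule.mem_span_singleton.2 ⟨(β z : ℝ) / β g, ?_⟩)
      have h2 := congrArg intVec hxa
      have hg0 : glue I (0 : {i // i ∈ I} → ℤ) 0 = 0 := by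
        ext i
        by_cases hi : i ∈ I <;> simp [glue, hi]
      rw [hcomb, hg0, intVec_zero, sub_eq_zero] at h2
      have hg' : (β g : ℝ) ≠ 0 := Int.cast_ne_zero.2 hg
      rw [div_eq_inv_mul, mul_smul, ← h2, smul_smul, inv_mul_cancel₀ hg', one_smul]
    obtain ⟨e, q, hq, he, rfl⟩ := exists_primitive hx
    refine ⟨e, he, ?_⟩
    have hq' : (q : ℝ) ≠ 0 := Int.cast_ne_zero.2 hq.ne'
    have h2 : intVec (glue I e 0) = (q : ℝ)⁻¹ • intVec (glue I (q • e) 0) := by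
      ext i
      by_cases hi : i ∈ I <;> simp [intVec, glue, hi, hq']
    rw [h2, ← hxa]
    exact V.smul_mem _ h1
  have hV0 : V ⊓ LinearMap.ker (projAlongLin I) = Submodule.span ℝ {intVec (glue I e 0)} := by
    symm
    refine Submodule.eq_of_le_of_finrank_eq ?_ ?_
    · rw [Submodule.span_singleton_le_iff_mem]
      refine ⟨heV, ?_⟩
      change projAlong I (intVec (glue I e 0)) = 0
      rw [intVec_glue, projAlong_glue, intVec_zero]
    · rw [hker]
      exact finrank_span_singleton (isPrimitive_glue_zero_right.2 hprim).ne_zero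
  have hex : ∃ r : ℕ, 0 < r ∧ ∃ f, intVec f ∈ V ∧ β f = r := by
    refine ⟨(β g).natAbs, Int.natAbs_pos.2 hg, ?_⟩
    rcases Int.natAbs_eq (β g) with h | h
    · exact ⟨g, hsub g hgZ, h⟩
    · refine ⟨-g, ?_, by rw [map_neg]; omega⟩
      have : intVec (-g) = -intVec g := by
        ext i
        simp [intVec]
      rw [this]
      exact V.neg_mem (hsub g hgZ)
  classical
  obtain ⟨hr, f, hfV, hf⟩ := Nat.find_spec hex
  set r := Nat.find hex
  have hr' : (r : ℝ) ≠ 0 := by exact_mod_cast hr.ne'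
  have hfproj : projAlong I (intVec f) = (r : ℝ) • intVec b := by
    rw [hβ f hfV, hf, Int.cast_natCast]
  have hone : ∀ (k : ℤ) (z : Fin n → ℤ), intVec (z - k • f) = intVec z - (k : ℝ) • intVec f := by
    intro k z
    rw [intVec_sub, intVec_zsmul]
  have hdvd : ∀ z, intVec z ∈ V → ∃ q : ℤ, β z = q * r := by
    intro z hz
    refine ⟨β z / r, ?_⟩
    have h1 : intVec (z - (β z / r) • f) ∈ V := by
      rw [hone]
      exact V.sub_mem hz (V.smul_mem _ hfV)
    have h2 : β (z - (β z / r) • f) = β z % r := by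
      rw [map_sub, map_zsmul, hf, smul_eq_mul, Int.emod_def, mul_comm]
    have h3 := Int.emod_nonneg (β z) (b := r) (by omega)
    have h4 := Int.emod_lt_of_pos (β z) (b := r) (by omega)
    by_contra hne
    have h5 : β z % r ≠ 0 := fun h => hne (Int.ediv_mul_cancel (Int.dvd_of_emod_eq_zero h)).symm
    refine Nat.find_min hex (m := (β z % r).natAbs) (by omega) ⟨by omega, _, h1, ?_⟩
    rw [h2]
    omega
  refine ⟨e, f, r, hprim, hr, hfproj, ⟨fun j => ?_, fun z hz => ?_⟩, fun x hx => ?_⟩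
  · fin_cases j
    · exact heV
    · exact hfV
  · obtain ⟨q, hq⟩ := hdvd z hz
    have h1 : intVec (z - q • f) ∈ V ⊓ LinearMap.ker (projAlongLin I) := by
      have hmem : intVec (z - q • f) ∈ V := by
        rw [hone]
        exact V.sub_mem hz (V.smul_mem _ hfV)
      refine ⟨hmem, ?_⟩
      change projAlong I (intVec (z - q • f)) = 0
      rw [hβ _ hmem, map_sub, map_zsmul, hf, hq, smul_eq_mul, sub_self]
      simp
    obtain ⟨t, ht, -⟩ := (isLatticeBasis_singleton (isPrimitive_glue_zero_right.2 hprim) hV0).2 _ h1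
    rw [Fin.sum_univ_one] at ht
    refine ⟨![t 0, q], ?_, fun c' hc' => ?_⟩
    · beta_reduce
      rw [Fin.sum_univ_two]
      change z = t 0 • glue I e 0 + q • f
      rw [← ht, sub_add_cancel]
    · beta_reduce at hc'
      rw [Fin.sum_univ_two] at hc'
      have hc'' : z = c' 0 • glue I e 0 + c' 1 • f := hc'
      have hβe : β (glue I e 0) = 0 := by
        change c ⬝ᵥ (fun i : {i // i ∉ I} => glue I e 0 i) = 0
        have : (fun i : {i // i ∉ I} => glue I e 0 i) = 0 := by
          ext i
          simp [glue, i.2]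
        rw [this, dotProduct_zero]
      have h2 := congrArg β hc''
      rw [map_add, map_zsmul, map_zsmul, hβe, smul_zero, zero_add, hf, hq, smul_eq_mul] at h2
      have h3 : q = c' 1 := mul_right_cancel₀ (by exact_mod_cast hr.ne') h2
      obtain ⟨d, hd⟩ := (isPrimitive_glue_zero_right (I := I)).2 hprim
      have h4 := congrArg (fun w => d ⬝ᵥ w) ht
      rw [hc'', h3, add_sub_cancel_right] at h4
      simp only [dotProduct_smul, hd, smul_eq_mul, mul_one] at h4
      ext j
      fin_cases j
      · exact h4
      · exact h3.symm
  · obtain ⟨t, ht⟩ := hproj x hx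
    have h1 : x - (t / r) • intVec f ∈ V ⊓ LinearMap.ker (projAlongLin I) := by
      refine ⟨V.sub_mem hx (V.smul_mem _ hfV), ?_⟩
      change projAlongLin I _ = 0
      rw [map_sub, map_smul]
      change projAlong I x - (t / r) • projAlong I (intVec f) = 0
      rw [ht, hfproj, smul_smul, div_mul_cancel₀ _ hr', sub_self]
    rw [hV0] at h1
    obtain ⟨s, hs⟩ := Submodule.mem_span_singleton.1 h1
    exact ⟨s, t / r, by rw [hs, sub_add_cancel]⟩

/-- A covector vanishing on the first basis vector and equal to one on the second: the lattice of
integer vectors in a subspace is saturated. -/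
theorem IsAdaptedBasis.exists_dual (h : IsAdaptedBasis I b V e f r) :
    ∃ c : Fin n → ℤ, c ⬝ᵥ glue I e 0 = 0 ∧ c ⬝ᵥ f = 1 := by
  obtain ⟨c₀, hc₀⟩ := (isPrimitive_glue_zero_right (I := I)).2 h.prim
  have huniq : ∀ s t s' t' : ℤ, s • glue I e 0 + t • f = s' • glue I e 0 + t' • f → t = t' := by
    intro s t s' t' hst
    have hmem : intVec (s • glue I e 0 + t • f) ∈ V := by
      have : intVec (s • glue I e 0 + t • f) = (s : ℝ) • intVec (glue I e 0) + (t : ℝ) • intVec f := by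
        ext i
        simp [intVec]
      rw [this]
      exact V.add_mem (V.smul_mem _ (h.basis.1 0)) (V.smul_mem _ (h.basis.1 1))
    have := (h.basis.2 _ hmem).unique (y₁ := ![s, t]) (y₂ := ![s', t'])
      (by rw [Fin.sum_univ_two]; rfl) (by rw [Fin.sum_univ_two]; exact hst)
    exact congrFun this 1
  have hne : f - (c₀ ⬝ᵥ f) • glue I e 0 ≠ 0 := by
    intro h0
    have := huniq 0 1 (c₀ ⬝ᵥ f) 0 (by rw [zero_smul, one_smul, zero_add, zero_smul, add_zero,
      ← sub_eq_zero, h0])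
    exact one_ne_zero this
  obtain ⟨w, g, hg, hw, hfw⟩ := exists_primitive hne
  have hwV : intVec w ∈ V := by
    have hg' : (g : ℝ) ≠ 0 := Int.cast_ne_zero.2 hg.ne'
    have h1 : intVec w = (g : ℝ)⁻¹ • (intVec f - ((c₀ ⬝ᵥ f : ℤ) : ℝ) • intVec (glue I e 0)) := by
      have h2 : (g : ℝ) • intVec w = intVec f - ((c₀ ⬝ᵥ f : ℤ) : ℝ) • intVec (glue I e 0) := by
        rw [← intVec_zsmul, ← hfw, intVec_sub, intVec_zsmul]
      rw [← h2, smul_smul, inv_mul_cancel₀ hg', one_smul]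
    rw [h1]
    exact V.smul_mem _ (V.sub_mem (h.basis.1 1) (V.smul_mem _ (h.basis.1 0)))
  obtain ⟨k, hk, -⟩ := h.basis.2 w hwV
  rw [Fin.sum_univ_two] at hk
  have hk' : w = k 0 • glue I e 0 + k 1 • f := hk
  have h1 : g * k 1 = 1 := by
    refine (huniq (-(c₀ ⬝ᵥ f)) 1 (g * k 0) (g * k 1) ?_).symm
    rw [mul_smul, mul_smul, ← smul_add, ← hk', ← hfw, neg_smul, one_smul]
    abel
  obtain rfl : g = 1 := Int.eq_one_of_mul_eq_one_right hg.le h1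
  rw [one_smul] at hfw
  obtain ⟨d, hd⟩ := hw
  refine ⟨d - (d ⬝ᵥ glue I e 0) • c₀, ?_, ?_⟩
  · rw [sub_dotProduct, smul_dotProduct, hc₀]
    simp
  · rw [← hfw, dotProduct_sub, dotProduct_smul] at hd
    rw [sub_dotProduct, smul_dotProduct, ← hd, smul_eq_mul, smul_eq_mul]
    ring

theorem IsAdaptedBasis.mem_normalSpan {F : Set (Fin n → ℝ)}
    (h : IsAdaptedBasis I b (vectorSpan ℝ F) e f r) {v : Fin n → ℝ} :
    v ∈ normalSpan F ↔ v ⬝ᵥ intVec (glue I e 0) = 0 ∧ v ⬝ᵥ intVec f = 0 := by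
  constructor
  · intro hv
    exact ⟨hv _ (h.basis.1 0), hv _ (h.basis.1 1)⟩
  · rintro ⟨h1, h2⟩ x hx
    obtain ⟨s, t, rfl⟩ := h.span x hx
    rw [dotProduct_add, dotProduct_smul, dotProduct_smul, h1, h2]
    simp

theorem mem_integerVectors {κ : Type} {v : κ → ℝ} :
    v ∈ integerVectors κ ↔ ∃ z : κ → ℤ, v = intVec z := by
  constructor
  · intro hv
    choose z hz using hv
    exact ⟨z, funext hz⟩
  · rintro ⟨z, rfl⟩ i
    exact ⟨z i, rfl⟩

/-- The index of the restriction of covectors is the multiple `r` of the primitive vector `b`. -/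
theorem IsAdaptedBasis.pushIndex_eq {F : Set (Fin n → ℝ)} (hb : IsPrimitive b)
    (h : IsAdaptedBasis I b (vectorSpan ℝ F) e f r) : pushIndex I F = r := by
  obtain ⟨cb, hcb⟩ := id hb
  obtain ⟨fI, fJ, rfl⟩ := glue_surjective (I := I) f
  have hfJ : fJ = (r : ℤ) • b := by
    refine intVec_injective ?_
    have := h.proj
    rw [intVec_glue, projAlong_glue] at this
    rw [this, intVec_zsmul, Int.cast_natCast]
  subst hfJ
  have hr' : (r : ℝ) ≠ 0 := by exact_mod_cast h.pos.ne'
  let φ : ({i // i ∈ I} → ℤ) →+ ZMod r :=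
    { toFun := fun y => ((y ⬝ᵥ fI : ℤ) : ZMod r)
      map_zero' := by simp
      map_add' := fun y w => by rw [add_dotProduct, Int.cast_add] }
  let K : AddSubgroup ({i // i ∈ I} → ℤ) :=
    { carrier := {y | y ⬝ᵥ e = 0}
      add_mem' := fun {y w} hy hw => by
        change (y + w) ⬝ᵥ e = 0
        rw [add_dotProduct, show y ⬝ᵥ e = 0 from hy, show w ⬝ᵥ e = 0 from hw, add_zero]
      zero_mem' := zero_dotProduct e
      neg_mem' := fun {y} hy => by
        change (-y) ⬝ᵥ e = 0
        rw [neg_dotProduct, show y ⬝ᵥ e = 0 from hy, neg_zero] }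
  let Ψ : ({i // i ∈ I} → ℤ) →+ ({i // i ∈ I} → ℝ) := (Int.castAddHom ℝ).compLeft _
  have hnormal : ∀ (y : {i // i ∈ I} → ℝ) (μ : {i // i ∉ I} → ℝ), glue I y μ ∈ normalSpan F ↔
      y ⬝ᵥ intVec e = 0 ∧ y ⬝ᵥ intVec fI + (r : ℝ) * (μ ⬝ᵥ intVec b) = 0 := by
    intro y μ
    rw [h.mem_normalSpan, intVec_glue, intVec_glue, glue_dotProduct, glue_dotProduct, intVec_zero,
      dotProduct_zero, add_zero]
    have : intVec ((r : ℤ) • b) = (r : ℝ) • intVec b := by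
      rw [intVec_zsmul, Int.cast_natCast]
    rw [this, dotProduct_smul, smul_eq_mul]
  have h2 : (Submodule.map (projTo I) (normalSpan F)).toAddSubgroup ⊓ integerVectors {i // i ∈ I} =
      K.map Ψ := by
    ext y
    constructor
    · rintro ⟨⟨v, hv, rfl⟩, hy⟩
      obtain ⟨z, hz⟩ := mem_integerVectors.1 hy
      refine ⟨z, ?_, hz.symm⟩
      have hv' : v ∈ normalSpan F := hv
      rw [← glue_proj (I := I) v, hnormal, hz, intVec_dotProduct] at hv'
      exact_mod_cast hv'.1
    · rintro ⟨z, hz, rfl⟩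
      refine ⟨⟨glue I (intVec z) ((-(intVec z ⬝ᵥ intVec fI) / r) • intVec cb), ?_, ?_⟩,
        mem_integerVectors.2 ⟨z, rfl⟩⟩
      · refine (hnormal _ _).2 ⟨?_, ?_⟩
        · rw [intVec_dotProduct, show z ⬝ᵥ e = 0 from hz, Int.cast_zero]
        · rw [smul_dotProduct, intVec_dotProduct cb, hcb]
          simp only [Int.cast_one, smul_eq_mul, mul_one]
          field_simp
          ring
      · exact projTo_glue _ _
  have h1 : ((normalSpan F).toAddSubgroup ⊓ integerVectors (Fin n)).map
      (projTo I).toAddMonoidHom = (φ.ker ⊓ K).map Ψ := by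
    ext y
    constructor
    · rintro ⟨v, ⟨hv, hvZ⟩, rfl⟩
      obtain ⟨z, rfl⟩ := mem_integerVectors.1 hvZ
      obtain ⟨x, a, rfl⟩ := glue_surjective (I := I) z
      have hv' : intVec (glue I x a) ∈ normalSpan F := hv
      rw [intVec_glue, hnormal, intVec_dotProduct, intVec_dotProduct, intVec_dotProduct] at hv'
      have h3 : x ⬝ᵥ fI + r * (a ⬝ᵥ b) = 0 := by exact_mod_cast hv'.2
      refine ⟨x, ⟨?_, by exact_mod_cast hv'.1⟩, ?_⟩
      · change ((x ⬝ᵥ fI : ℤ) : ZMod r) = 0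
        rw [ZMod.intCast_zmod_eq_zero_iff_dvd]
        exact ⟨-(a ⬝ᵥ b), by linarith⟩
      · change intVec x = projTo I (intVec (glue I x a))
        rw [intVec_glue, projTo_glue]
    · rintro ⟨z, ⟨hz, hzK⟩, rfl⟩
      have h3 : ((z ⬝ᵥ fI : ℤ) : ZMod r) = 0 := hz
      rw [ZMod.intCast_zmod_eq_zero_iff_dvd] at h3
      obtain ⟨q, hq⟩ := h3
      refine ⟨intVec (glue I z (-q • cb)), ⟨?_, mem_integerVectors.2 ⟨_, rfl⟩⟩, ?_⟩
      · change intVec (glue I z (-q • cb)) ∈ normalSpan F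
        rw [intVec_glue, hnormal, intVec_dotProduct, intVec_dotProduct, intVec_dotProduct,
          smul_dotProduct, hcb, hq, show z ⬝ᵥ e = 0 from hzK]
        constructor
        · simp
        · push_cast [smul_eq_mul]
          ring
      · change projTo I (intVec (glue I z (-q • cb))) = intVec z
        rw [intVec_glue, projTo_glue]
  have hΨinj : Function.Injective Ψ := fun y w hyw => intVec_injective hyw
  rw [pushIndex, h1, h2, AddSubgroup.relIndex_map_map_of_injective _ _ hΨinj,
    AddSubgroup.inf_relIndex_right, AddSubgroup.relIndex_ker]
  have htop : K.map φ = ⊤ := by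
    rw [eq_top_iff]
    rintro x -
    obtain ⟨c, hc1, hc2⟩ := h.exists_dual
    obtain ⟨cI, cJ, rfl⟩ := glue_surjective (I := I) c
    rw [glue_dotProduct, dotProduct_zero, add_zero] at hc1
    rw [glue_dotProduct, dotProduct_smul, smul_eq_mul] at hc2
    obtain ⟨k, rfl⟩ := ZMod.intCast_surjective x
    have hcK : cI ∈ K := hc1
    refine ⟨k • cI, K.zsmul_mem hcK k, ?_⟩
    rw [map_zsmul]
    have : φ cI = 1 := by
      have := congrArg (Int.cast : ℤ → ZMod r) hc2
      change ((cI ⬝ᵥ fI : ℤ) : ZMod r) = 1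
      simpa using this
    rw [this]
    simp
  rw [htop]
  simp

end LatticeIndex

/-! ### Lattice areas by slicing -/

section Slices

open MeasureTheory

variable {n : ℕ} {I : Finset (Fin n)} {b : {i // i ∉ I} → ℤ}
  {e : {i // i ∈ I} → ℤ} {f : Fin n → ℤ} {r : ℕ} {F : Set (Fin n → ℝ)}

theorem volume_eq_lintegral_slices {S : Set (Fin 2 → ℝ)} (hS : MeasurableSet S) :
    volume S = ∫⁻ x : ℝ, volume {s : ℝ | ![s, x] ∈ S} := by
  have h := (volume_preserving_finTwoArrow ℝ).symm
  rw [← h.measure_preimage hS.nullMeasurableSet, Measure.volume_eq_prod,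
    Measure.prod_apply_symm (h.measurable hS)]
  rfl

theorem IsAdaptedBasis.index_mul_latticeVolume (h : IsAdaptedBasis I b (vectorSpan ℝ F) e f r)
    (hF : IsClosed F) {q : Fin n → ℝ} (hq : q ∈ F) (hdim : dimOf F = 2) :
    r * latticeVolume F = 2 * (∫⁻ x : ℝ, volume {s : ℝ |
      q + s • intVec (glue I e 0) + x • (r : ℝ)⁻¹ • intVec f ∈ F}).toReal := by
  have hr : (0 : ℝ) < r := by exact_mod_cast h.pos
  set w : Fin 2 → Fin n → ℝ := ![intVec (glue I e 0), (r : ℝ)⁻¹ • intVec f] with hw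
  set M : Matrix (Fin 2) (Fin 2) ℝ := !![1, 0; 0, (r : ℝ)] with hM
  have hdet : M.det = r := by simp [hM]
  have hMw : ∀ j, ∑ k, M j k • w k = intVec (![glue I e 0, f] j) := by
    intro j
    fin_cases j
    · simp [hM, hw]
    · simp [hM, hw, hr.ne']
  have hspan : ∀ x ∈ F, ∃ t : Fin 2 → ℝ, x = q + ∑ k, t k • intVec (![glue I e 0, f] k) := by
    intro x hx
    obtain ⟨s, t, hst⟩ := h.span _ (vsub_mem_vectorSpan ℝ hx hq)
    refine ⟨![s, t], ?_⟩
    rw [Fin.sum_univ_two]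
    exact (sub_eq_iff_eq_add'.1 hst)
  have hmap := map_volume_frame q (M := M) (by rw [hdet]; exact hr.ne') w
  simp only [hMw] at hmap
  have hmeas : Measurable (fun t : Fin 2 → ℝ => q + ∑ k, t k • w k) :=
    Continuous.measurable (by fun_prop)
  rw [latticeVolume, latticeMeasure_eq hdim hq h.basis hspan, hmap, hdet,
    abs_of_pos (inv_pos.2 hr)]
  simp only [Measure.smul_apply, Nat.factorial_two, nsmul_eq_mul, smul_eq_mul, ENNReal.toReal_mul]
  rw [Measure.map_apply hmeas hF.measurableSet,
    volume_eq_lintegral_slices (hmeas hF.measurableSet), ENNReal.toReal_ofReal (inv_pos.2 hr).le]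
  have hset : ∀ x s : ℝ, ![s, x] ∈ (fun t : Fin 2 → ℝ => q + ∑ k, t k • w k) ⁻¹' F ↔
      q + s • intVec (glue I e 0) + x • (r : ℝ)⁻¹ • intVec f ∈ F := by
    intro x s
    rw [Set.mem_preimage, Fin.sum_univ_two, ← add_assoc]
    rfl
  simp only [hset]
  have h2 : ((2 : ℕ) : ENNReal).toReal = 2 := by simp
  rw [h2]
  field_simp

theorem volume_line_inter {p q : {i // i ∈ I} → ℝ} (he : IsPrimitive e) {l : ℝ}
    {t : ℝ} (hp : p = q + t • intVec e) :
    volume {s : ℝ | q + s • intVec e ∈ latticeSegment p e l} = ENNReal.ofReal l := by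
  have : {s : ℝ | q + s • intVec e ∈ latticeSegment p e l} = Set.Icc t (t + l) := by
    ext s
    subst hp
    constructor
    · rintro ⟨u, ⟨hu0, hu1⟩, hu⟩
      have h1 : s = t + u := by
        refine (measurableEmbedding_line q he).injective ?_
        rw [add_smul, ← add_assoc]
        exact hu.symm
      subst h1
      exact ⟨by linarith, by linarith⟩
    · rintro ⟨h0, h1⟩
      refine ⟨s - t, ⟨by linarith, by linarith⟩, ?_⟩
      beta_reduce
      rw [add_assoc, ← add_smul]
      congr 2
      ring
  rw [this, Real.volume_Icc, add_sub_cancel_left]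

/-- The lattice area of a polygon, multiplied by the index, from the lattice lengths of its slices. -/
theorem IsAdaptedBasis.index_mul_latticeVolume_eq (hb : IsPrimitive b)
    (h : IsAdaptedBasis I b (vectorSpan ℝ F) e f r)
    (hF : IsClosed F) (hne : F.Nonempty) (hdim : dimOf F = 2) {p : {i // i ∉ I} → ℝ}
    (hproj : ∀ z ∈ F, ∃ t : ℝ, projAlong I z = p + t • intVec b) {ℓ : ℝ → ℝ}
    (hℓ : ∀ᵐ t : ℝ, ({x | glue I x (p + t • intVec b) ∈ F} = ∅ ∧ ℓ t = 0) ∨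
      IsLatticeSegment e (ℓ t) {x | glue I x (p + t • intVec b) ∈ F}) :
    r * latticeVolume F = 2 * (∫⁻ t : ℝ, ENNReal.ofReal (ℓ t)).toReal := by
  obtain ⟨q, hq⟩ := hne
  obtain ⟨t₀, ht₀⟩ := hproj q hq
  have hr : (r : ℝ) ≠ 0 := by exact_mod_cast h.pos.ne'
  rw [h.index_mul_latticeVolume hF hq hdim]
  congr 2
  rw [← lintegral_add_left_eq_self (fun t => ENNReal.ofReal (ℓ t)) t₀]
  refine lintegral_congr_ae ?_
  have hshift := (measurePreserving_add_left volume t₀).quasiMeasurePreserving.ae hℓ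
  filter_upwards [hshift] with x hx
  -- the line of the slice over the parameter `t₀ + x`
  set c : {i // i ∈ I} → ℝ := projTo I (q + x • (r : ℝ)⁻¹ • intVec f) with hc
  have hline : ∀ s : ℝ, q + s • intVec (glue I e 0) + x • (r : ℝ)⁻¹ • intVec f =
      glue I (c + s • intVec e) (p + (t₀ + x) • intVec b) := by
    intro s
    refine glue_ext (I := I) ?_ ?_
    · rw [projTo_glue, hc, map_add, map_add, map_add, map_smul, intVec_glue, projTo_glue]
      abel
    · rw [projAlong_glue, projAlong_add, projAlong_add, projAlong_smul, projAlong_smul,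
        projAlong_smul, h.proj, ht₀, intVec_glue, projAlong_glue, intVec_zero, smul_zero, add_zero,
        smul_smul (r : ℝ)⁻¹, inv_mul_cancel₀ hr, one_smul, add_smul, add_assoc]
  have hset : {s : ℝ | q + s • intVec (glue I e 0) + x • (r : ℝ)⁻¹ • intVec f ∈ F} =
      {s : ℝ | c + s • intVec e ∈ {y | glue I y (p + (t₀ + x) • intVec b) ∈ F}} := by
    ext s
    rw [Set.mem_ofPred_eq, hline]
    rfl
  rw [hset]
  rcases hx with ⟨hempty, h0⟩ | ⟨hl, p', hp'⟩
  · rw [hempty, h0]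
    simp
  · rw [hp']
    have hmem : glue I p' (p + (t₀ + x) • intVec b) ∈ F := by
      have : p' ∈ {y | glue I y (p + (t₀ + x) • intVec b) ∈ F} := by
        rw [hp']
        exact ⟨0, ⟨le_rfl, hl⟩, by simp⟩
      exact this
    obtain ⟨s, t, hst⟩ := h.span _ (vsub_mem_vectorSpan ℝ hmem hq)
    rw [vsub_eq_sub, sub_eq_iff_eq_add] at hst
    have h1 := congrArg (projAlong I) hst
    rw [projAlong_glue, projAlong_add, projAlong_add, projAlong_smul, projAlong_smul, h.proj, ht₀,
      intVec_glue, projAlong_glue, intVec_zero, smul_zero, zero_add, smul_smul] at h1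
    have h2 : t = x * (r : ℝ)⁻¹ := by
      have h3 : t₀ + x = t₀ + t * r := by
        refine (measurableEmbedding_line p hb).injective ?_
        rw [h1, add_smul]
        abel
      field_simp
      linarith
    have h3 := congrArg (projTo I) hst
    refine volume_line_inter h.prim (t := s) ?_
    rw [projTo_glue, map_add, map_add, map_smul, map_smul, intVec_glue, projTo_glue] at h3
    rw [h3, hc, map_add, map_smul, map_smul, h2, mul_smul]
    abel

/-- The function equal to the affine function with the values `u k` and `v k` at the ends of the
interval from `k` to `k + 1`, on each of the first `L` such open intervals, and zero elsewhere. -/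
noncomputable def piecewiseAffine (u v : ℕ → ℝ) (L : ℕ) (t : ℝ) : ℝ :=
  ∑ k ∈ Finset.range L, (Set.Ioo (k : ℝ) ((k + 1 : ℕ) : ℝ)).indicator
    (fun t => u k + (t - k) • (v k - u k)) t

theorem piecewiseAffine_eq {u v : ℕ → ℝ} {L k : ℕ} (hk : k < L) {τ : ℝ} (h0 : 0 < τ) (h1 : τ < 1) :
    piecewiseAffine u v L (k + τ) = (1 - τ) * u k + τ * v k := by
  rw [piecewiseAffine, Finset.sum_eq_single_of_mem k (Finset.mem_range.2 hk)]
  · rw [Set.indicator_of_mem (by constructor <;> push_cast <;> linarith)]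
    simp only [smul_eq_mul]
    ring
  · intro j _ hjk
    refine Set.indicator_of_notMem ?_ _
    rintro ⟨h2, h3⟩
    have h4 : (j : ℝ) < ((k + 1 : ℕ) : ℝ) := by push_cast; linarith
    have h5 : (k : ℝ) < ((j + 1 : ℕ) : ℝ) := by push_cast at *; linarith
    have h4 := Nat.cast_lt.1 h4
    have h5 := Nat.cast_lt.1 h5
    omega

theorem piecewiseAffine_eq_zero {u v : ℕ → ℝ} {L : ℕ} {t : ℝ} (ht : t ∉ Set.Icc (0 : ℝ) L) :
    piecewiseAffine u v L t = 0 := by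
  refine Finset.sum_eq_zero fun k hk => Set.indicator_of_notMem (fun h => ht ?_) _
  have hk : ((k + 1 : ℕ) : ℝ) ≤ L := by exact_mod_cast Finset.mem_range.1 hk
  have hk0 : (0 : ℝ) ≤ k := Nat.cast_nonneg k
  exact ⟨hk0.trans h.1.le, h.2.le.trans hk⟩

theorem lintegral_piecewiseAffine {u v : ℕ → ℝ} (hu : ∀ k, 0 ≤ u k) (hv : ∀ k, 0 ≤ v k) (L : ℕ) :
    2 * (∫⁻ t : ℝ, ENNReal.ofReal (piecewiseAffine u v L t)).toReal =
      ∑ k ∈ Finset.range L, (u k + v k) := by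
  have hint : ∀ k : ℕ, Integrable ((Set.Ioo (k : ℝ) ((k + 1 : ℕ) : ℝ)).indicator
      (fun t => u k + (t - k) • (v k - u k))) := fun k => by
    refine IntegrableOn.integrable_indicator ?_ measurableSet_Ioo
    refine IntegrableOn.mono_set ?_ Set.Ioo_subset_Icc_self
    exact Continuous.integrableOn_Icc (by fun_prop)
  have hnonneg : ∀ t, 0 ≤ piecewiseAffine u v L t := by
    intro t
    refine Finset.sum_nonneg fun k _ => Set.indicator_nonneg (fun t ht => ?_) _
    obtain ⟨h1, h2⟩ := ht
    push_cast at h2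
    rw [smul_eq_mul]
    nlinarith [hu k, hv k, mul_nonneg (hu k) (by linarith : (0 : ℝ) ≤ 1 - (t - k)),
      mul_nonneg (hv k) (by linarith : (0 : ℝ) ≤ t - k)]
  have hintegrable : Integrable (piecewiseAffine u v L) := integrable_finsetSum _ fun k _ => hint k
  rw [← ofReal_integral_eq_lintegral_ofReal hintegrable
    (Filter.Eventually.of_forall hnonneg), ENNReal.toReal_ofReal (integral_nonneg hnonneg)]
  unfold piecewiseAffine
  rw [integral_finsetSum _ fun k _ => hint k, Finset.mul_sum]
  refine Finset.sum_congr rfl fun k _ => ?_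
  rw [integral_indicator measurableSet_Ioo, ← integral_Ioc_eq_integral_Ioo,
    ← intervalIntegral.integral_of_le (by push_cast; linarith), integral_affine, smul_eq_mul]
  ring

end Slices

/-! ### Dimensions of projected normal spaces -/

section NormalSpaces

variable {κ : Type} [Fintype κ]

/-- The covectors vanishing on a subspace. -/
def orth (W : Submodule ℝ (κ → ℝ)) : Submodule ℝ (κ → ℝ) where
  carrier := {y | ∀ x ∈ W, y ⬝ᵥ x = 0}
  add_mem' ha hb u hu := by rw [add_dotProduct, ha u hu, hb u hu, add_zero]
  zero_mem' u _ := zero_dotProduct u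
  smul_mem' c v hv u hu := by rw [smul_dotProduct, hv u hu, smul_zero]

theorem finrank_orth (W : Submodule ℝ (κ → ℝ)) :
    Module.finrank ℝ (orth W) + Module.finrank ℝ W = Fintype.card κ := by
  classical
  have h := Subspace.finrank_add_finrank_dualAnnihilator_eq W
  rw [Module.finrank_fintype_fun_eq_card] at h
  have h1 : (orth W).map (dotProductEquiv ℝ κ).toLinearMap = W.dualAnnihilator := by
    ext φ
    rw [Submodule.mem_dualAnnihilator]
    constructor
    · rintro ⟨y, hy, rfl⟩ x hx
      simpa using hy x hx
    · intro hφ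
      obtain ⟨y, rfl⟩ := (dotProductEquiv ℝ κ).surjective φ
      exact ⟨y, fun x hx => by simpa using hφ x hx, rfl⟩
  have h2 : Module.finrank ℝ ((orth W).map (dotProductEquiv ℝ κ).toLinearMap) =
    Module.finrank ℝ (orth W) := LinearEquiv.finrank_map_eq _ _
  rw [← h2, h1, add_comm, h]

theorem finrank_map_of_injective {V W : Type*} [AddCommGroup V] [Module ℝ V] [AddCommGroup W]
    [Module ℝ W] {f : V →ₗ[ℝ] W} (hf : Function.Injective f) (U : Submodule ℝ V) :
    Module.finrank ℝ (U.map f) = Module.finrank ℝ U :=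
  (Submodule.equivMapOfInjective f hf U).finrank_eq.symm

variable {n : ℕ} {I : Finset (Fin n)}

/-- The inclusion of `ℝ^I` into `ℝ^n`. -/
def glueLeft (I : Finset (Fin n)) : ({i // i ∈ I} → ℝ) →ₗ[ℝ] (Fin n → ℝ) where
  toFun x := glue I x 0
  map_add' x y := by
    have := glue_combo (I := I) x y 0 0 1 1
    simpa using this.symm
  map_smul' c x := by
    have := glue_combo (I := I) x 0 0 0 c 0
    simpa using this.symm

/-- The inclusion of the complementary coordinate space into `ℝ^n`. -/
def glueRight (I : Finset (Fin n)) : ({i // i ∉ I} → ℝ) →ₗ[ℝ] (Fin n → ℝ) where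
  toFun a := glue I 0 a
  map_add' x y := by
    have := glue_combo (I := I) 0 0 x y 1 1
    simpa using this.symm
  map_smul' c x := by
    have := glue_combo (I := I) 0 0 x 0 c 0
    simpa using this.symm

theorem glueLeft_injective : Function.Injective (glueLeft I) := fun x y h => by
  have := congrArg (projTo I) h
  simpa [glueLeft] using this

theorem glueRight_injective : Function.Injective (glueRight I) := fun x y h => by
  have := congrArg (projAlong I) h
  simpa [glueRight] using this

/-- The intersection of a subspace with `ℝ^I`. -/
def innerPart (I : Finset (Fin n)) (V : Submodule ℝ (Fin n → ℝ)) :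
    Submodule ℝ ({i // i ∈ I} → ℝ) :=
  V.comap (glueLeft I)

theorem finrank_inf_ker_projAlongLin (V : Submodule ℝ (Fin n → ℝ)) :
    Module.finrank ℝ (V ⊓ LinearMap.ker (projAlongLin I) : Submodule ℝ (Fin n → ℝ)) =
      Module.finrank ℝ (innerPart I V) := by
  suffices h : V ⊓ LinearMap.ker (projAlongLin I) = (innerPart I V).map (glueLeft I) by
    rw [h, finrank_map_of_injective glueLeft_injective]
  ext x
  constructor
  · rintro ⟨hx, hx0⟩
    have hx0 : projAlong I x = 0 := hx0
    have h : glue I (projTo I x) 0 = x := by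
      rw [← hx0, glue_proj]
    exact ⟨projTo I x, by change glue I _ 0 ∈ V; rwa [h], h⟩
  · rintro ⟨x, hx, rfl⟩
    exact ⟨hx, projAlong_glue _ _⟩

theorem normalSpan_eq_orth (F : Set (Fin n → ℝ)) : normalSpan F = orth (vectorSpan ℝ F) := rfl

theorem finrank_map_normalSpan (F : Set (Fin n → ℝ)) :
    Module.finrank ℝ (Submodule.map (projTo I) (normalSpan F)) +
      Module.finrank ℝ (innerPart I (vectorSpan ℝ F)) = I.card := by
  set V := vectorSpan ℝ F
  have h1 := finrank_map_add_finrank_inf_ker (projTo I) (normalSpan F)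
  have h2 : Module.finrank ℝ (normalSpan F ⊓ LinearMap.ker (projTo I) : Submodule ℝ (Fin n → ℝ)) =
      Module.finrank ℝ (orth (V.map (projAlongLin I))) := by
    suffices h : normalSpan F ⊓ LinearMap.ker (projTo I) =
        (orth (V.map (projAlongLin I))).map (glueRight I) by
      rw [h, finrank_map_of_injective glueRight_injective]
    ext v
    constructor
    · rintro ⟨hv, hv0⟩
      have hv0 : projTo I v = 0 := hv0
      have h : glue I 0 (projAlong I v) = v := by
        rw [← hv0, glue_proj]
      refine ⟨projAlong I v, ?_, h⟩
      rintro _ ⟨x, hx, rfl⟩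
      have := hv x hx
      rwa [dotProduct_proj (I := I), hv0, zero_dotProduct, zero_add] at this
    · rintro ⟨μ, hμ, rfl⟩
      refine ⟨fun x hx => ?_, projTo_glue _ _⟩
      change glue I 0 μ ⬝ᵥ x = 0
      rw [dotProduct_proj (I := I), projTo_glue, projAlong_glue, zero_dotProduct, zero_add]
      exact hμ _ ⟨x, hx, rfl⟩
  have h3 := finrank_orth (V.map (projAlongLin I))
  have h4 := finrank_map_add_finrank_inf_ker (projAlongLin I) V
  rw [finrank_inf_ker_projAlongLin] at h4
  have h5 : Module.finrank ℝ (normalSpan F) + Module.finrank ℝ V = Fintype.card (Fin n) :=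
    finrank_orth V
  have h6 := Finset.card_le_univ I
  rw [Fintype.card_subtype_compl, Fintype.card_coe] at h3
  omega

theorem isPrimitive_multiple_of_rat {q : κ → ℚ} (hq : q ≠ 0) :
    ∃ (e : κ → ℤ) (c : ℝ), c ≠ 0 ∧ IsPrimitive e ∧ (fun i => (q i : ℝ)) = c • intVec e := by
  classical
  set N : ℕ := ∏ i, (q i).den with hN
  have hN0 : (N : ℚ) ≠ 0 := by
    rw [hN]
    exact_mod_cast Finset.prod_ne_zero_iff.2 fun i _ => (q i).den_nz
  have hz : ∀ i, ∃ z : ℤ, (z : ℚ) = N * q i := by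
    intro i
    refine ⟨(∏ j ∈ Finset.univ.erase i, (q j).den : ℕ) * (q i).num, ?_⟩
    rw [hN, ← Finset.mul_prod_erase Finset.univ (fun j => (q j).den) (Finset.mem_univ i)]
    have := Rat.den_mul_eq_num (q i)
    push_cast at this ⊢
    rw [← this]
    ring
  choose z hz using hz
  have hz0 : z ≠ 0 := by
    rintro rfl
    refine hq (funext fun i => ?_)
    have := hz i
    simpa [hN0, eq_comm] using this
  obtain ⟨e, g, hg, he, rfl⟩ := exists_primitive hz0
  refine ⟨e, (g : ℝ) / N, ?_, he, ?_⟩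
  · have : (N : ℝ) ≠ 0 := by exact_mod_cast hN0
    exact div_ne_zero (Int.cast_ne_zero.2 hg.ne') this
  · ext i
    have h1 : (N : ℝ) ≠ 0 := by exact_mod_cast hN0
    have h2 : ((g • e) i : ℝ) = N * q i := by exact_mod_cast hz i
    have h3 : ((g • e) i : ℝ) = g * e i := by simp
    rw [h3] at h2
    simp only [Pi.smul_apply, smul_eq_mul]
    field_simp
    linarith

/-- The support face of a positive covector on a local polyhedron is compact. -/
theorem IsLocalPolyhedron.isCompact_supportFace {P : Set (κ → ℝ)} (hP : IsLocalPolyhedron P)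
    {y : κ → ℝ} (hy : ∀ i, 0 < y i) : IsCompact (supportFace P y) := by
  obtain ⟨S, hS, rfl⟩ := hP
  rw [supportFace_polyhedronOf hy]
  exact ((ratPts_finite S).subset fun s hs => hs.1).isCompact_convexHull ℝ

/-- A one-dimensional support face of a positive covector is a lattice segment, because the
polyhedron is rational. -/
theorem IsLocalPolyhedron.exists_latticeSegment {P : Set (κ → ℝ)} (hP : IsLocalPolyhedron P)
    {y : κ → ℝ} (hy : ∀ i, 0 < y i) (hdim : dimOf (supportFace P y) = 1) :
    ∃ (e : κ → ℤ) (p : κ → ℝ) (l : ℝ), IsPrimitive e ∧ 0 < l ∧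
      supportFace P y = latticeSegment p e l := by
  have hcomp := hP.isCompact_supportFace hy
  have hconv : Convex ℝ (supportFace P y) := convex_supportFace hP.convex y
  have hne := hP.supportFace_nonempty fun i => (hy i).le
  obtain ⟨S, hS, rfl⟩ := hP
  have hF := supportFace_polyhedronOf (S := S) hy
  -- two different rational points of the face
  have hsub : ¬ (supportFace (ratPts S) y).Subsingleton := by
    intro h
    have h0 : dimOf (supportFace (polyhedronOf S) y) = 0 := by
      rcases h.eq_empty_or_singleton with h | ⟨p, h⟩
      · rw [hF, h, convexHull_empty] at hne
        exact absurd hne Set.not_nonempty_empty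
      · rw [hF, h, convexHull_singleton, dimOf_singleton]
    omega
  rw [Set.not_subsingleton_iff] at hsub
  obtain ⟨p, hp, q, hq, hpq⟩ := hsub
  have hp' : p ∈ supportFace (polyhedronOf S) y := hF ▸ subset_convexHull _ _ hp
  have hq' : q ∈ supportFace (polyhedronOf S) y := hF ▸ subset_convexHull _ _ hq
  obtain ⟨⟨a, ha, rfl⟩, -⟩ := hp
  obtain ⟨⟨c, hc, rfl⟩, -⟩ := hq
  have hac : c - a ≠ 0 := by
    intro h
    rw [sub_eq_zero.1 h] at hpq
    exact hpq rfl
  obtain ⟨e, t, ht, he, hte⟩ := isPrimitive_multiple_of_rat hac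
  have hmem : intVec e ∈ vectorSpan ℝ (supportFace (polyhedronOf S) y) := by
    have h1 : intVec e = t⁻¹ • ((fun i => (c i : ℝ)) -ᵥ fun i => (a i : ℝ)) := by
      have h2 : ((fun i => (c i : ℝ)) -ᵥ fun i => (a i : ℝ)) = t • intVec e := by
        rw [← hte]
        ext i
        simp
      rw [h2, smul_smul, inv_mul_cancel₀ ht, one_smul]
    rw [h1]
    exact Submodule.smul_mem _ _ (vsub_mem_vectorSpan ℝ hq' hp')
  have hspan : Submodule.span ℝ {intVec e} = vectorSpan ℝ (supportFace (polyhedronOf S) y) := by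
    refine Submodule.eq_of_le_of_finrank_eq ((Submodule.span_singleton_le_iff_mem _ _).2 hmem) ?_
    rw [finrank_span_singleton he.ne_zero]
    exact hdim.symm
  obtain ⟨l, hl, p, hp⟩ := isLatticeSegment_of_compact he hne hcomp hconv fun x hx z hz => by
    have := vsub_mem_vectorSpan ℝ hz hx
    rw [← hspan] at this
    obtain ⟨t, ht⟩ := Submodule.mem_span_singleton.1 this
    exact ⟨t, by rw [ht]; simp⟩
  refine ⟨e, p, l, he, hl.lt_of_ne' ?_, hp⟩
  rintro rfl
  rw [hp, latticeSegment_zero, dimOf_singleton] at hdim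
  exact zero_ne_one hdim

end NormalSpaces

/-! ### Tropical weights of vertices -/

section VertexWeight

variable {n : ℕ} {I : Finset (Fin n)} {A : Finset (Fin n → ℕ)}

theorem vectorSpan_image_glue (S : Set ({i // i ∈ I} → ℝ)) (a : {i // i ∉ I} → ℝ) :
    vectorSpan ℝ ((fun x => glue I x a) '' S) = (vectorSpan ℝ S).map (glueLeft I) := by
  have h : (fun x => glue I x a) = ((glueLeft I).toAffineMap + AffineMap.const ℝ _ (glue I 0 a) :
      ({i // i ∈ I} → ℝ) →ᵃ[ℝ] (Fin n → ℝ)) := by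
    funext x
    have := glue_combo (I := I) x 0 0 a 1 1
    simp only [one_smul, add_zero, zero_add] at this
    exact this.symm
  rw [h, ← AffineMap.map_vectorSpan]
  congr 1
  ext x
  simp

theorem supportFace_overFace_singleton {a : {i // i ∉ I} → ℝ} {y : {i // i ∈ I} → ℝ}
    {v : Fin n → ℝ} (hv : projTo I v = y) :
    supportFace (overFace I (newtonPolyhedron A) {a}) v =
      (fun x => glue I x a) '' supportFace (fiberAt I (newtonPolyhedron A) a) y := by
  have hover : ∀ z, z ∈ overFace I (newtonPolyhedron A) {a} ↔
      ∃ x ∈ fiberAt I (newtonPolyhedron A) a, z = glue I x a := by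
    intro z
    constructor
    · rintro ⟨hz, rfl⟩
      exact ⟨projTo I z, ⟨z, ⟨hz, rfl⟩, rfl⟩, (glue_proj z).symm⟩
    · rintro ⟨x, hx, rfl⟩
      exact ⟨mem_fiberAt.1 hx, projAlong_glue _ _⟩
  have hdot : ∀ x, v ⬝ᵥ glue I x a = y ⬝ᵥ x + projAlong I v ⬝ᵥ a := fun x => by
    rw [dotProduct_proj (I := I), projTo_glue, projAlong_glue, hv]
  ext z
  constructor
  · rintro ⟨hz, hmin⟩
    obtain ⟨x, hx, rfl⟩ := (hover z).1 hz
    refine ⟨x, ⟨hx, fun w hw => ?_⟩, rfl⟩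
    have := hmin _ ((hover _).2 ⟨w, hw, rfl⟩)
    rw [hdot, hdot] at this
    linarith
  · rintro ⟨x, ⟨hx, hmin⟩, rfl⟩
    refine ⟨(hover _).2 ⟨x, hx, rfl⟩, fun w hw => ?_⟩
    obtain ⟨w, hw', rfl⟩ := (hover _).1 hw
    rw [hdot, hdot]
    linarith [hmin w hw']

theorem pushIndex_image_glue (S : Set ({i // i ∈ I} → ℝ)) (a : {i // i ∉ I} → ℝ) :
    pushIndex I ((fun x => glue I x a) '' S) = 1 := by
  have hmem : ∀ v : Fin n → ℝ, v ∈ normalSpan ((fun x => glue I x a) '' S) ↔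
      projTo I v ∈ orth (vectorSpan ℝ S) := by
    intro v
    rw [normalSpan_eq_orth, vectorSpan_image_glue]
    have hdot : ∀ x, v ⬝ᵥ glueLeft I x = projTo I v ⬝ᵥ x := fun x => by
      rw [dotProduct_proj (I := I)]
      change projTo I v ⬝ᵥ projTo I (glue I x 0) + _ ⬝ᵥ projAlong I (glue I x 0) = _
      rw [projTo_glue, projAlong_glue, dotProduct_zero, add_zero]
    constructor
    · intro h x hx
      rw [← hdot]
      exact h _ ⟨x, hx, rfl⟩
    · rintro h _ ⟨x, hx, rfl⟩
      rw [hdot]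
      exact h x hx
  rw [pushIndex, AddSubgroup.relIndex_eq_one]
  suffices h : ((normalSpan ((fun x => glue I x a) '' S)).toAddSubgroup ⊓
      integerVectors (Fin n)).map (projTo I).toAddMonoidHom =
      (Submodule.map (projTo I) (normalSpan ((fun x => glue I x a) '' S))).toAddSubgroup ⊓
        integerVectors {i // i ∈ I} from h.ge
  ext y
  constructor
  · rintro ⟨v, ⟨hv, hvZ⟩, rfl⟩
    exact ⟨⟨v, hv, rfl⟩, fun i => hvZ i⟩
  · rintro ⟨⟨v, hv, rfl⟩, hvZ⟩
    refine ⟨glue I (projTo I v) 0, ⟨(hmem _).2 ?_, ?_⟩, projTo_glue _ _⟩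
    · rw [projTo_glue]
      exact (hmem v).1 hv
    · intro i
      by_cases hi : i ∈ I
      · obtain ⟨z, hz⟩ := hvZ ⟨i, hi⟩
        exact ⟨z, by simp only [glue, hi, dif_pos]; exact hz⟩
      · exact ⟨0, by simp [glue, hi]⟩

theorem image_glue_latticeSegment (p : {i // i ∈ I} → ℝ) (e : {i // i ∈ I} → ℤ) (l : ℝ)
    (a : {i // i ∉ I} → ℝ) : (fun x => glue I x a) '' latticeSegment p e l =
      latticeSegment (glue I p a) (glue I e 0) l := by
  rw [latticeSegment, latticeSegment, Set.image_image]
  refine Set.image_congr fun s _ => ?_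
  have := glue_combo (I := I) p (intVec e) a 0 1 s
  rw [one_smul, one_smul, one_smul, smul_zero, add_zero] at this
  rw [intVec_glue, intVec_zero]
  exact this.symm

/-- The weight of a vertex is the lattice length of the support face of the fiber. -/
theorem pushDualFan_overFace_singleton {a : {i // i ∉ I} → ℝ}
    (ha : IsFace (projAlong I '' newtonPolyhedron A) {a}) {y : {i // i ∈ I} → ℝ}
    (hy : ∀ i, 0 < y i) : pushDualFan I (overFace I (newtonPolyhedron A) {a}) 1 y =
      latticeLength (supportFace (fiberAt I (newtonPolyhedron A) a) y) := by
  have hloc := isLocalPolyhedron_vertexFiber ha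
  set S := supportFace (fiberAt I (newtonPolyhedron A) a) y with hS
  have hdimΓ : dimOf (overFace I (newtonPolyhedron A) {a}) = I.card := by
    rw [dimOf_overFace (Set.singleton_nonempty a), dimOf_singleton, add_zero]
    obtain ⟨-, u, hu⟩ := ha
    rw [hu]
    exact fun x hx => hx.1
  have hdim : dimOf ((fun x => glue I x a) '' S) = dimOf S := by
    rw [dimOf, vectorSpan_image_glue, finrank_map_of_injective glueLeft_injective]
    rfl
  rw [pushDualFan, latticeLength]
  split_ifs with h
  · obtain ⟨e, p, l, he, hl, hSe⟩ := hloc.exists_latticeSegment hy h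
    have hE : {F : Set (Fin n → ℝ) | Bornology.IsBounded F ∧ dimOf F = 1 ∧
        (∃ v : Fin n → ℝ, projTo I v = y ∧ F.Nonempty ∧
          F = supportFace (overFace I (newtonPolyhedron A) {a}) v) ∧
        Module.finrank ℝ (Submodule.map (projTo I) (normalSpan F)) + 1 =
          dimOf (overFace I (newtonPolyhedron A) {a})} = {(fun x => glue I x a) '' S} := by
      ext F
      rw [Set.mem_singleton_iff]
      constructor
      · rintro ⟨-, -, ⟨v, hv, -, rfl⟩, -⟩
        exact supportFace_overFace_singleton hv
      · rintro rfl
        refine ⟨?_, hdim.trans h, ⟨glue I y 0, projTo_glue _ _,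
          (hloc.supportFace_nonempty fun i => (hy i).le).image _,
          (supportFace_overFace_singleton (projTo_glue _ _)).symm⟩, ?_⟩
        · refine IsCompact.isBounded ((hloc.isCompact_supportFace hy).image ?_)
          refine continuous_pi fun i => ?_
          by_cases hi : i ∈ I
          · simp only [glue, hi, dif_pos]
            fun_prop
          · simp only [glue, hi, dif_neg, not_false_eq_true]
            fun_prop
        · have h1 := finrank_map_normalSpan (I := I) ((fun x => glue I x a) '' S)
          have h2 : innerPart I (vectorSpan ℝ ((fun x => glue I x a) '' S)) = vectorSpan ℝ S := by
            rw [innerPart, vectorSpan_image_glue,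
              Submodule.comap_map_eq_of_injective glueLeft_injective]
          rw [h2] at h1
          rw [hdimΓ, ← h1]
          congr 1
          exact h.symm
    rw [hE, finsum_mem_singleton, pushIndex_image_glue, Nat.cast_one, one_mul, hS, hSe,
      image_glue_latticeSegment, latticeVolume_latticeSegment he hl,
      latticeVolume_latticeSegment ((isPrimitive_glue_zero_right).2 he) hl]
  · refine finsum_mem_eq_zero_of_forall_eq_zero ?_
    rintro F ⟨-, hF, ⟨v, hv, -, rfl⟩, -⟩
    rw [supportFace_overFace_singleton hv, hdim] at hF
    exact absurd hF h

end VertexWeight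

/-! ### Faces over an edge and their slices -/

section FaceSlices

variable {n : ℕ} {I : Finset (Fin n)} {A : Finset (Fin n → ℕ)} {p b c : {i // i ∉ I} → ℤ} {L : ℕ}
  {y : {i // i ∈ I} → ℝ} {v : Fin n → ℝ}

/-- The part of the Newton polyhedron over the segment `p + [0, L] b`. -/
def edgePart (I : Finset (Fin n)) (A : Finset (Fin n → ℕ)) (p b : {i // i ∉ I} → ℤ) (L : ℕ) :
    Set (Fin n → ℝ) :=
  overFace I (newtonPolyhedron A) (latticeSegment (intVec p) b L)

/-- The fiber of a set over the point `p + t b`. -/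
def faceSlice (I : Finset (Fin n)) (p b : {i // i ∉ I} → ℤ) (F : Set (Fin n → ℝ)) (t : ℝ) :
    Set ({i // i ∈ I} → ℝ) :=
  {x | glue I x (intVec p + t • intVec b) ∈ F}

/-- The set has points over both ends of the unit segment from `p + k b` to `p + (k + 1) b`. -/
def SpansUnit (I : Finset (Fin n)) (p b : {i // i ∉ I} → ℤ) (F : Set (Fin n → ℝ)) (k : ℕ) : Prop :=
  (faceSlice I p b F k).Nonempty ∧ (faceSlice I p b F ((k + 1 : ℕ) : ℝ)).Nonempty

theorem dotProduct_glue_line (hv : projTo I v = y) (x : {i // i ∈ I} → ℝ) (t : ℝ) :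
    v ⬝ᵥ glue I x (intVec p + t • intVec b) =
      y ⬝ᵥ x + projAlong I v ⬝ᵥ intVec p + t * (projAlong I v ⬝ᵥ intVec b) := by
  rw [dotProduct_proj (I := I), projTo_glue, projAlong_glue, hv, dotProduct_add, dotProduct_smul,
    smul_eq_mul, add_assoc]

theorem glue_mem_edgePart (hb : IsPrimitive b) {x : {i // i ∈ I} → ℝ} {t : ℝ} :
    glue I x (intVec p + t • intVec b) ∈ edgePart I A p b L ↔
      t ∈ Set.Icc (0 : ℝ) L ∧ x ∈ edgeFiber I A p b t := by
  constructor
  · rintro ⟨hx, s, hs, hst⟩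
    rw [projAlong_glue] at hst
    obtain rfl : s = t := (measurableEmbedding_line (intVec p) hb).injective hst
    exact ⟨hs, mem_edgeFiber.2 hx⟩
  · rintro ⟨ht, hx⟩
    exact glue_mem_overFace ht hx

theorem exists_of_mem_edgePart {z : Fin n → ℝ} (hz : z ∈ edgePart I A p b L) :
    ∃ t ∈ Set.Icc (0 : ℝ) L, ∃ x ∈ edgeFiber I A p b t,
      z = glue I x (intVec p + t • intVec b) := by
  obtain ⟨t, ht, h1, h2⟩ := exists_edgeFiber_of_mem_overFace hz
  exact ⟨t, ht, _, h2, by rw [← h1, glue_proj]⟩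

theorem supportFace_congr {κ : Type} [Fintype κ] {P : Set (κ → ℝ)} {v w : κ → ℝ} {d : ℝ}
    (h : ∀ z ∈ P, v ⬝ᵥ z = w ⬝ᵥ z + d) : supportFace P v = supportFace P w := by
  ext z
  refine and_congr_right fun hz => forall₂_congr fun x hx => ?_
  rw [h z hz, h x hx]
  exact add_le_add_iff_right d

theorem faceSlice_eq (hb : IsPrimitive b) (hv : projTo I v = y) {t : ℝ}
    (hne : (faceSlice I p b (supportFace (edgePart I A p b L) v) t).Nonempty) :
    faceSlice I p b (supportFace (edgePart I A p b L) v) t =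
      supportFace (edgeFiber I A p b t) y := by
  obtain ⟨x₀, hx₀⟩ := hne
  obtain ⟨ht, hx₀G⟩ := (glue_mem_edgePart hb).1 hx₀.1
  ext x
  constructor
  · intro hx
    refine ⟨((glue_mem_edgePart hb).1 hx.1).2, fun w hw => ?_⟩
    have := hx.2 _ ((glue_mem_edgePart hb).2 ⟨ht, hw⟩)
    rw [dotProduct_glue_line hv, dotProduct_glue_line hv] at this
    linarith
  · intro hx
    refine ⟨(glue_mem_edgePart hb).2 ⟨ht, hx.1⟩, fun z hz => le_trans ?_ (hx₀.2 z hz)⟩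
    rw [dotProduct_glue_line hv, dotProduct_glue_line hv]
    linarith [hx.2 x₀ hx₀G]

theorem convex_edgePart : Convex ℝ (edgePart I A p b L) := by
  intro z hz w hw s t hs ht hst
  obtain ⟨i, hi, x, hx, rfl⟩ := exists_of_mem_edgePart hz
  obtain ⟨j, hj, u, hu, rfl⟩ := exists_of_mem_edgePart hw
  have h1 := edgeFiber_convex_combo hs ht hst hx hu
  rw [glue_combo]
  have h2 : s • (intVec p + i • intVec b) + t • (intVec p + j • intVec b) =
      intVec p + (s * i + t * j) • intVec b := by
    obtain rfl : s = 1 - t := by linarith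
    module
  rw [h2]
  exact glue_mem_overFace (convex_Icc (0 : ℝ) L hi hj hs ht hst) h1

theorem faceSlice_combo {F : Set (Fin n → ℝ)} (hF : Convex ℝ F) {s t i j : ℝ} (hs : 0 ≤ s)
    (ht : 0 ≤ t) (hst : s + t = 1) {x u : {i // i ∈ I} → ℝ} (hx : x ∈ faceSlice I p b F i)
    (hu : u ∈ faceSlice I p b F j) : s • x + t • u ∈ faceSlice I p b F (s * i + t * j) := by
  have h1 := hF hx hu hs ht hst
  rw [glue_combo] at h1
  have h2 : s • (intVec p + i • intVec b) + t • (intVec p + j • intVec b) =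
      intVec p + (s * i + t * j) • intVec b := by
    obtain rfl : s = 1 - t := by linarith
    module
  rw [h2] at h1
  exact h1

/-- A face with a point over the interior of a unit segment has points over both its ends. -/
theorem IsEdgeParam.spansUnit (h : IsEdgeParam I A p b L) (hv : projTo I v = y) {k : ℕ}
    (hk : k < L) {τ : ℝ} (h0 : 0 < τ) (h1 : τ < 1)
    (hne : (faceSlice I p b (supportFace (edgePart I A p b L) v) (k + τ)).Nonempty) :
    SpansUnit I p b (supportFace (edgePart I A p b L) v) k := by
  obtain ⟨x, hx, hmin⟩ := hne
  have hxG := ((glue_mem_edgePart h.prim).1 hx).2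
  rw [h.interpolate hk h0 h1] at hxG
  obtain ⟨_, ⟨u, hu, rfl⟩, _, ⟨w, hw, rfl⟩, rfl⟩ := hxG
  have hkL : ((k + 1 : ℕ) : ℝ) ≤ L := by exact_mod_cast hk
  have hu' : glue I u (intVec p + (k : ℝ) • intVec b) ∈ edgePart I A p b L :=
    glue_mem_overFace ⟨Nat.cast_nonneg k, by exact_mod_cast hk.le⟩ hu
  have hw' : glue I w (intVec p + ((k + 1 : ℕ) : ℝ) • intVec b) ∈ edgePart I A p b L :=
    glue_mem_overFace ⟨Nat.cast_nonneg _, hkL⟩ hw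
  have hval : v ⬝ᵥ glue I ((1 - τ) • u + τ • w) (intVec p + (k + τ) • intVec b) =
      (1 - τ) * v ⬝ᵥ glue I u (intVec p + (k : ℝ) • intVec b) +
        τ * v ⬝ᵥ glue I w (intVec p + ((k + 1 : ℕ) : ℝ) • intVec b) := by
    rw [dotProduct_glue_line hv, dotProduct_glue_line hv, dotProduct_glue_line hv, dotProduct_add,
      dotProduct_smul, dotProduct_smul, smul_eq_mul, smul_eq_mul]
    push_cast
    ring
  have e1 := hmin _ hu'
  have e2 := hmin _ hw'
  set X := v ⬝ᵥ glue I ((1 - τ) • u + τ • w) (intVec p + ((k : ℝ) + τ) • intVec b)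
  have e1' : v ⬝ᵥ glue I u (intVec p + (k : ℝ) • intVec b) ≤ X := by
    nlinarith
  have e2' : v ⬝ᵥ glue I w (intVec p + ((k + 1 : ℕ) : ℝ) • intVec b) ≤ X := by
    nlinarith
  exact ⟨⟨u, hu', fun z hz => e1'.trans (hmin z hz)⟩, ⟨w, hw', fun z hz => e2'.trans (hmin z hz)⟩⟩

/-- Over the interior of a unit segment the slices of a face interpolate linearly. -/
theorem IsEdgeParam.faceSlice_interpolate (h : IsEdgeParam I A p b L) (hv : projTo I v = y)
    {k : ℕ} (hk : k < L) {τ : ℝ} (h0 : 0 < τ) (h1 : τ < 1)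
    (hspan : SpansUnit I p b (supportFace (edgePart I A p b L) v) k) :
    faceSlice I p b (supportFace (edgePart I A p b L) v) (k + τ) =
      (1 - τ) • supportFace (edgeFiber I A p b k) y +
        τ • supportFace (edgeFiber I A p b ((k + 1 : ℕ) : ℝ)) y := by
  obtain ⟨⟨x, hx⟩, ⟨u, hu⟩⟩ := hspan
  have hτ : 0 < 1 - τ := by linarith
  have hcombo := faceSlice_combo (convex_supportFace convex_edgePart v) hτ.le h0.le
    (by ring) hx hu
  have e : (1 - τ) * k + τ * ((k + 1 : ℕ) : ℝ) = k + τ := by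
    push_cast
    ring
  rw [e] at hcombo
  have hx' : x ∈ supportFace (edgeFiber I A p b k) y := by
    rw [← faceSlice_eq h.prim hv ⟨x, hx⟩]
    exact hx
  have hu' : u ∈ supportFace (edgeFiber I A p b ((k + 1 : ℕ) : ℝ)) y := by
    rw [← faceSlice_eq h.prim hv ⟨u, hu⟩]
    exact hu
  rw [faceSlice_eq h.prim hv ⟨_, hcombo⟩, h.interpolate hk h0 h1, supportFace_add,
    supportFace_smul hτ, supportFace_smul h0]
  · rw [supportFace_smul hτ]
    exact ⟨_, x, hx', rfl⟩
  · rw [supportFace_smul h0]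
    exact ⟨_, u, hu', rfl⟩

/-- The minimum of `y` on the fiber over `p + k b`. -/
noncomputable def fiberMin (I : Finset (Fin n)) (A : Finset (Fin n → ℕ)) (p b : {i // i ∉ I} → ℤ)
    {y : {i // i ∈ I} → ℝ} (hy : ∀ i, 0 ≤ y i) (k : ℕ) : ℝ :=
  supportHom hy (localFiber I A (intVec (p + k • b)))

theorem IsEdgeParam.fiberMin_le (h : IsEdgeParam I A p b L) (hy : ∀ i, 0 ≤ y i) {k : ℕ}
    (hk : k ≤ L) {x : {i // i ∈ I} → ℝ} (hx : x ∈ edgeFiber I A p b k) :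
    fiberMin I A p b hy k ≤ y ⬝ᵥ x := by
  rw [← h.localFiber_val hk] at hx
  exact supportHom_le hy _ hx

theorem IsEdgeParam.fiberMin_eq (h : IsEdgeParam I A p b L) (hy : ∀ i, 0 ≤ y i) {k : ℕ}
    (hk : k ≤ L) {x : {i // i ∈ I} → ℝ} (hx : x ∈ supportFace (edgeFiber I A p b k) y) :
    fiberMin I A p b hy k = y ⬝ᵥ x := by
  rw [← h.localFiber_val hk] at hx
  exact supportHom_eq hy _ hx

/-- The face of the part of the Newton polyhedron over an edge, at the extension of the covector `y`
that takes equal minimal values on the fibers over the ends of the `k`-th unit segment. -/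
noncomputable def unitFace (I : Finset (Fin n)) (A : Finset (Fin n → ℕ))
    (p b c : {i // i ∉ I} → ℤ) (L : ℕ) {y : {i // i ∈ I} → ℝ} (hy : ∀ i, 0 ≤ y i) (k : ℕ) : Set (Fin n → ℝ) :=
  supportFace (edgePart I A p b L)
    (glue I y ((fiberMin I A p b hy k - fiberMin I A p b hy (k + 1)) • intVec c))

/-- The minimum of `y` on the fibers is a convex function, so its linear part on a unit segment is
minorizing. -/
theorem IsEdgeParam.le_of_mem_edgeFiber (h : IsEdgeParam I A p b L) (hy : ∀ i, 0 ≤ y i) {k : ℕ}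
    (hk : k < L) {t : ℝ} {x : {i // i ∈ I} → ℝ} (hx : x ∈ edgeFiber I A p b t) :
    fiberMin I A p b hy k + k * (fiberMin I A p b hy k - fiberMin I A p b hy (k + 1)) ≤
      y ⬝ᵥ x + t * (fiberMin I A p b hy k - fiberMin I A p b hy (k + 1)) := by
  obtain ⟨x₀, hx₀⟩ := (h.isLocalPolyhedron hk.le).supportFace_nonempty hy
  obtain ⟨x₁, hx₁⟩ := (h.isLocalPolyhedron (show k + 1 ≤ L from hk)).supportFace_nonempty hy
  have e₀ := h.fiberMin_eq hy hk.le hx₀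
  have e₁ := h.fiberMin_eq hy hk hx₁
  have hle₁ : ∀ w ∈ edgeFiber I A p b ((k + 1 : ℕ) : ℝ), fiberMin I A p b hy (k + 1) ≤ y ⬝ᵥ w :=
    fun w hw => h.fiberMin_le hy hk hw
  have hle₀ : ∀ w ∈ edgeFiber I A p b k, fiberMin I A p b hy k ≤ y ⬝ᵥ w :=
    fun w hw => h.fiberMin_le hy hk.le hw
  set h₀ := fiberMin I A p b hy k
  set h₁ := fiberMin I A p b hy (k + 1)
  rcases lt_trichotomy t k with ht | rfl | ht
  · have hpos : 0 < (k : ℝ) + 1 - t := by linarith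
    have h1 := hle₀ ((1 / (k + 1 - t)) • x + ((k - t) / (k + 1 - t)) • x₁) ?_
    · rw [dotProduct_add, dotProduct_smul, dotProduct_smul, ← e₁, smul_eq_mul, smul_eq_mul,
        div_mul_eq_mul_div, div_mul_eq_mul_div, ← add_div, le_div_iff₀ hpos] at h1
      nlinarith
    · have := edgeFiber_convex_combo (s := 1 / (k + 1 - t)) (r := (k - t) / (k + 1 - t))
        (div_nonneg zero_le_one hpos.le) (div_nonneg (by linarith) hpos.le)
        (by field_simp; ring) hx hx₁.1
      have e : 1 / (k + 1 - t) * t + (k - t) / (k + 1 - t) * ((k + 1 : ℕ) : ℝ) = (k : ℝ) := by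
        push_cast
        field_simp
        ring
      rwa [e] at this
  · linarith [hle₀ x hx]
  · rcases lt_trichotomy t ((k + 1 : ℕ) : ℝ) with ht' | rfl | ht'
    · push_cast at ht'
      have hxG := hx
      rw [show t = k + (t - k) by ring, h.interpolate hk (by linarith) (by linarith)] at hxG
      obtain ⟨_, ⟨u, hu, rfl⟩, _, ⟨w, hw, rfl⟩, rfl⟩ := hxG
      have e1 := hle₀ u hu
      have e2 := hle₁ w hw
      simp only [dotProduct_add, dotProduct_smul, smul_eq_mul]
      nlinarith
    · have := hle₁ x hx
      push_cast
      linarith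
    · push_cast at ht'
      have hpos : 0 < t - k := by linarith
      have h1 := hle₁ (((t - k - 1) / (t - k)) • x₀ + (1 / (t - k)) • x) ?_
      · rw [dotProduct_add, dotProduct_smul, dotProduct_smul, ← e₀, smul_eq_mul, smul_eq_mul,
          div_mul_eq_mul_div, div_mul_eq_mul_div, ← add_div, le_div_iff₀ hpos] at h1
        nlinarith
      · have := edgeFiber_convex_combo (s := (t - k - 1) / (t - k)) (r := 1 / (t - k))
          (div_nonneg (by linarith) hpos.le) (div_nonneg zero_le_one hpos.le)
          (by field_simp; ring) hx₀.1 hx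
        have e : (t - k - 1) / (t - k) * k + 1 / (t - k) * t = ((k + 1 : ℕ) : ℝ) := by
          push_cast
          field_simp
          ring
        rwa [e] at this

theorem IsEdgeParam.unitFace_spansUnit (h : IsEdgeParam I A p b L) (hc : c ⬝ᵥ b = 1)
    (hy : ∀ i, 0 ≤ y i) {k : ℕ} (hk : k < L) :
    SpansUnit I p b (unitFace I A p b c L hy k) k := by
  obtain ⟨x₀, hx₀⟩ := (h.isLocalPolyhedron hk.le).supportFace_nonempty hy
  obtain ⟨x₁, hx₁⟩ := (h.isLocalPolyhedron (show k + 1 ≤ L from hk)).supportFace_nonempty hy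
  have e₀ := h.fiberMin_eq hy hk.le hx₀
  have e₁ := h.fiberMin_eq hy hk hx₁
  have hcb : intVec c ⬝ᵥ intVec b = 1 := by rw [intVec_dotProduct, hc, Int.cast_one]
  have hkL : ((k + 1 : ℕ) : ℝ) ≤ L := by exact_mod_cast hk
  have hv : projTo I (glue I y ((fiberMin I A p b hy k - fiberMin I A p b hy (k + 1)) •
    intVec c)) = y := projTo_glue _ _
  refine ⟨⟨x₀, glue_mem_overFace ⟨Nat.cast_nonneg k, by exact_mod_cast hk.le⟩ hx₀.1,
    fun z hz => ?_⟩, ⟨x₁, glue_mem_overFace ⟨Nat.cast_nonneg _, hkL⟩ hx₁.1, fun z hz => ?_⟩⟩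
  all_goals
    obtain ⟨t, ht, x, hx, rfl⟩ := exists_of_mem_edgePart hz
    have := h.le_of_mem_edgeFiber hy hk hx
    rw [dotProduct_glue_line hv, dotProduct_glue_line hv, projAlong_glue, smul_dotProduct,
      smul_dotProduct, hcb, smul_eq_mul, smul_eq_mul, mul_one]
  · rw [← e₀]
    linarith
  · rw [← e₁]
    push_cast
    linarith

/-- The slope of a face is determined by a unit segment which it spans. -/
theorem IsEdgeParam.eq_unitFace (h : IsEdgeParam I A p b L) (hc : c ⬝ᵥ b = 1)
    (hy : ∀ i, 0 ≤ y i) (hv : projTo I v = y) {k : ℕ} (hk : k < L)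
    (hspan : SpansUnit I p b (supportFace (edgePart I A p b L) v) k) :
    supportFace (edgePart I A p b L) v = unitFace I A p b c L hy k := by
  obtain ⟨⟨x, hx⟩, ⟨u, hu⟩⟩ := hspan
  have hx' : x ∈ supportFace (edgeFiber I A p b k) y := by
    rw [← faceSlice_eq h.prim hv ⟨x, hx⟩]
    exact hx
  have hu' : u ∈ supportFace (edgeFiber I A p b ((k + 1 : ℕ) : ℝ)) y := by
    rw [← faceSlice_eq h.prim hv ⟨u, hu⟩]
    exact hu
  have e₀ := h.fiberMin_eq hy hk.le hx'
  have e₁ := h.fiberMin_eq hy hk hu'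
  have hle := le_antisymm (hx.2 _ hu.1) (hu.2 _ hx.1)
  rw [dotProduct_glue_line hv, dotProduct_glue_line hv, ← e₀, ← e₁] at hle
  push_cast at hle
  have hcb : intVec c ⬝ᵥ intVec b = 1 := by rw [intVec_dotProduct, hc, Int.cast_one]
  have hw : projTo I (glue I y ((fiberMin I A p b hy k - fiberMin I A p b hy (k + 1)) •
    intVec c)) = y := projTo_glue _ _
  refine supportFace_congr (d := projAlong I v ⬝ᵥ intVec p -
    (fiberMin I A p b hy k - fiberMin I A p b hy (k + 1)) * (intVec c ⬝ᵥ intVec p)) fun z hz => ?_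
  obtain ⟨t, ht, x, hx, rfl⟩ := exists_of_mem_edgePart hz
  rw [dotProduct_glue_line hv, dotProduct_glue_line hw, projAlong_glue, smul_dotProduct,
    smul_dotProduct, hcb, smul_eq_mul, smul_eq_mul, mul_one]
  have : projAlong I v ⬝ᵥ intVec b = fiberMin I A p b hy k - fiberMin I A p b hy (k + 1) := by
    linarith
  rw [this]
  ring

end FaceSlices

/-! ### Tropical weights of edges -/

section EdgeWeight

variable {n : ℕ} {I : Finset (Fin n)} {A : Finset (Fin n → ℕ)} {p b c : {i // i ∉ I} → ℤ} {L : ℕ}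
  {y : {i // i ∈ I} → ℝ} {v : Fin n → ℝ}

theorem IsEdgeParam.exists_eq_convexHull (h : IsEdgeParam I A p b L) (hy : ∀ i, 0 < y i)
    (hv : projTo I v = y) :
    ∃ D ⊆ natPts A, supportFace (edgePart I A p b L) v = convexHull ℝ D := by
  obtain ⟨a, ha, hap⟩ : ∃ a ∈ natPts A, projAlong I a = intVec p := by
    have := h.left_mem
    rw [natPts_projPts] at this
    exact this
  have hfin : {x ∈ natPts A | projAlong I x ∈ latticeSegment (intVec p) b L}.Finite :=
    (natPts_finite A).subset fun x hx => hx.1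
  obtain ⟨s₀, hs₀, hmin⟩ := exists_min_dotProduct hfin
    ⟨a, ha, by rw [hap]; exact ⟨0, ⟨le_rfl, Nat.cast_nonneg L⟩, by simp⟩⟩ v
  have hval : ∀ w ∈ coneOver I, v ⬝ᵥ w = y ⬝ᵥ projTo I w := fun w hw => by
    rw [dotProduct_proj (I := I), hv, hw.2, dotProduct_zero, add_zero]
  have h0 : (0 : Fin n → ℝ) ∈ coneOver I := ⟨zero_mem_orthant, rfl⟩
  have hnonneg : ∀ w ∈ coneOver I, 0 ≤ v ⬝ᵥ w := fun w hw => by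
    rw [hval w hw]
    exact dotProduct_nonneg_orthant (fun i => (hy i).le) (projTo_coneOver hw)
  refine ⟨{s ∈ {x ∈ natPts A | projAlong I x ∈ latticeSegment (intVec p) b L} |
    v ⬝ᵥ s = v ⬝ᵥ s₀}, fun x hx => hx.1.1, ?_⟩
  rw [edgePart, overFace_eq h.edge.1 h.edge.2.1, supportFace_convexHull_add h0 hnonneg
    hs₀ hmin]
  have : {w ∈ coneOver I | v ⬝ᵥ w = 0} = {0} := by
    ext w
    rw [Set.mem_singleton_iff]
    constructor
    · rintro ⟨hw, hw0⟩
      rw [hval w hw] at hw0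
      have h1 := dotProduct_pos_of_pos hy (projTo_coneOver hw) hw0
      refine glue_ext (I := I) ?_ ?_
      · rw [h1, map_zero]
      · rw [hw.2]
        rfl
    · rintro rfl
      exact ⟨h0, dotProduct_zero v⟩
  rw [this, Set.singleton_zero, add_zero]

theorem isCompact_convexHull_natPts {D : Set (Fin n → ℝ)} (hD : D ⊆ natPts A) :
    IsCompact (convexHull ℝ D) :=
  ((natPts_finite A).subset hD).isCompact_convexHull ℝ

theorem vectorSpan_convexHull (D : Set (Fin n → ℝ)) :
    vectorSpan ℝ (convexHull ℝ D) = vectorSpan ℝ D := by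
  rw [← direction_affineSpan, affineSpan_convexHull, direction_affineSpan]

theorem exists_integer_span {D : Set (Fin n → ℝ)} (hD : D ⊆ natPts A) :
    ∃ Z : Set (Fin n → ℤ), vectorSpan ℝ D = Submodule.span ℝ (intVec '' Z) := by
  refine ⟨{z | intVec z ∈ D -ᵥ D}, ?_⟩
  rw [vectorSpan_def]
  congr 1
  ext x
  constructor
  · intro hx
    obtain ⟨d, hd, d', hd', rfl⟩ := id hx
    obtain ⟨z, rfl⟩ := exists_intVec_of_mem_natPts (hD hd)
    obtain ⟨z', rfl⟩ := exists_intVec_of_mem_natPts (hD hd')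
    exact ⟨z - z', by rw [Set.mem_ofPred_eq, intVec_sub]; exact hx, intVec_sub z z'⟩
  · rintro ⟨z, hz, rfl⟩
    exact hz

theorem projAlong_of_mem_vectorSpan {x : Fin n → ℝ} {F : Set (Fin n → ℝ)}
    (hF : F ⊆ edgePart I A p b L) (hx : x ∈ vectorSpan ℝ F) :
    ∃ t : ℝ, projAlong I x = t • intVec b := by
  have hle : vectorSpan ℝ F ≤ (Submodule.span ℝ {intVec b}).comap (projAlongLin I) := by
    rw [vectorSpan_def, Submodule.span_le]
    rintro _ ⟨z, hz, w, hw, rfl⟩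
    obtain ⟨s, -, hs⟩ := (hF hz).2
    obtain ⟨t, -, ht⟩ := (hF hw).2
    refine Submodule.mem_span_singleton.2 ⟨s - t, ?_⟩
    change _ = projAlong I z - projAlong I w
    rw [← hs, ← ht]
    module
  obtain ⟨t, ht⟩ := Submodule.mem_span_singleton.1 (hle hx)
  exact ⟨t, ht.symm⟩

theorem vectorSpan_faceSlice_le (F : Set (Fin n → ℝ)) (t : ℝ) :
    vectorSpan ℝ (faceSlice I p b F t) ≤ innerPart I (vectorSpan ℝ F) := by
  rw [vectorSpan_def, Submodule.span_le]
  rintro _ ⟨x, hx, u, hu, rfl⟩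
  have h1 := vsub_mem_vectorSpan ℝ (show _ ∈ F from hx) (show _ ∈ F from hu)
  change glue I (x - u) 0 ∈ vectorSpan ℝ F
  have h2 := glue_combo (I := I) x u (intVec p + t • intVec b) (intVec p + t • intVec b) 1 (-1)
  have e1 : (1 : ℝ) • x + (-1 : ℝ) • u = x - u := by module
  have e2 : (1 : ℝ) • (intVec p + t • intVec b) + (-1 : ℝ) • (intVec p + t • intVec b) =
    (0 : {i // i ∉ I} → ℝ) := by module
  rw [e1, e2] at h2
  rw [← h2]
  have e3 : (1 : ℝ) • glue I x (intVec p + t • intVec b) +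
      (-1 : ℝ) • glue I u (intVec p + t • intVec b) =
        glue I x (intVec p + t • intVec b) -ᵥ glue I u (intVec p + t • intVec b) := by
    rw [vsub_eq_sub]
    module
  rw [e3]
  exact h1

/-- The lattice length of the support face of the fiber over `p + k b`. -/
noncomputable def fiberLength (I : Finset (Fin n)) (A : Finset (Fin n → ℕ))
    (p b : {i // i ∉ I} → ℤ) (y : {i // i ∈ I} → ℝ) (k : ℕ) : ℝ :=
  latticeLength (supportFace (edgeFiber I A p b k) y)

open Classical in
/-- The lattice area of a face, multiplied by the index, is the trapezoid sum of the lattice lengths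
of its slices. -/
theorem IsEdgeParam.pushIndex_mul_latticeVolume (h : IsEdgeParam I A p b L) (hy : ∀ i, 0 < y i)
    (hv : projTo I v = y) (hne : (supportFace (edgePart I A p b L) v).Nonempty)
    (hdim : dimOf (supportFace (edgePart I A p b L) v) = 2)
    (hinner : Module.finrank ℝ (innerPart I (vectorSpan ℝ (supportFace (edgePart I A p b L) v))) =
      1) :
    (pushIndex I (supportFace (edgePart I A p b L) v) : ℝ) *
        latticeVolume (supportFace (edgePart I A p b L) v) =
      ∑ k ∈ Finset.range L with SpansUnit I p b (supportFace (edgePart I A p b L) v) k,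
        (fiberLength I A p b y k + fiberLength I A p b y (k + 1)) := by
  obtain ⟨D, hD, hFD⟩ := h.exists_eq_convexHull hy hv
  set F := supportFace (edgePart I A p b L) v with hF
  have hcomp : IsCompact F := by
    rw [hFD]
    exact isCompact_convexHull_natPts hD
  have hsub : F ⊆ edgePart I A p b L := fun z hz => hz.1
  obtain ⟨Z, hZ⟩ := exists_integer_span hD
  rw [← vectorSpan_convexHull, ← hFD] at hZ
  obtain ⟨e, f, r, hbasis⟩ := exists_isAdaptedBasis (I := I) h.prim hZ hdim
    (fun x hx => projAlong_of_mem_vectorSpan hsub hx) (by rw [finrank_inf_ker_projAlongLin, hinner])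
  -- a non-empty slice over a lattice point is a segment in the direction of `e`
  have hslice : ∀ k : ℕ, k ≤ L → (faceSlice I p b F k).Nonempty →
      IsLatticeSegment e (fiberLength I A p b y k) (supportFace (edgeFiber I A p b k) y) := by
    intro k hk hkne
    have hloc := h.isLocalPolyhedron hk
    have heq := faceSlice_eq h.prim hv hkne
    have hspan : Submodule.span ℝ {intVec e} = innerPart I (vectorSpan ℝ F) := by
      refine Submodule.eq_of_le_of_finrank_eq ((Submodule.span_singleton_le_iff_mem _ _).2 ?_) ?_
      · change glue I (intVec e) 0 ∈ vectorSpan ℝ F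
        have := hbasis.basis.1 0
        change intVec (glue I e 0) ∈ _ at this
        rwa [intVec_glue, intVec_zero] at this
      · rw [finrank_span_singleton hbasis.prim.ne_zero, hinner]
    obtain ⟨l, hl⟩ := isLatticeSegment_of_compact hbasis.prim
      (hloc.supportFace_nonempty fun i => (hy i).le) (hloc.isCompact_supportFace hy)
      (convex_supportFace hloc.convex y) fun x hx u hu => by
        have h1 := vsub_mem_vectorSpan ℝ hu hx
        rw [← heq] at h1
        have h2 := vectorSpan_faceSlice_le F k h1
        rw [← hspan] at h2
        obtain ⟨t, ht⟩ := Submodule.mem_span_singleton.1 h2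
        exact ⟨t, by rw [ht]; simp⟩
    rw [fiberLength, hl.latticeLength_eq hbasis.prim]
    exact hl
  set u : ℕ → ℝ := fun k => if SpansUnit I p b F k then fiberLength I A p b y k else 0 with hu
  set w : ℕ → ℝ := fun k => if SpansUnit I p b F k then fiberLength I A p b y (k + 1) else 0 with hw
  have hu0 : ∀ k, 0 ≤ u k := fun k => by
    simp only [hu]
    split_ifs
    · exact latticeLength_nonneg _
    · exact le_rfl
  have hw0 : ∀ k, 0 ≤ w k := fun k => by
    simp only [hw]
    split_ifs
    · exact latticeLength_nonneg _
    · exact le_rfl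
  have hae : ∀ᵐ t : ℝ, (faceSlice I p b F t = ∅ ∧ piecewiseAffine u w L t = 0) ∨
      IsLatticeSegment e (piecewiseAffine u w L t) (faceSlice I p b F t) := by
    have hcount : (Set.range (Nat.cast : ℕ → ℝ)).Countable := Set.countable_range _
    filter_upwards [hcount.ae_notMem MeasureTheory.volume] with t ht
    by_cases htL : t ∈ Set.Icc (0 : ℝ) L
    · obtain ⟨k, τ, rfl, h0, h1, hk⟩ : ∃ (k : ℕ) (τ : ℝ), t = k + τ ∧ 0 < τ ∧ τ < 1 ∧ k < L := by
        have h1 := Nat.floor_le htL.1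
        have h2 := Nat.lt_floor_add_one t
        have h3 : (⌊t⌋₊ : ℝ) ≠ t := fun h => ht ⟨_, h⟩
        refine ⟨⌊t⌋₊, t - ⌊t⌋₊, by ring, sub_pos.2 (h1.lt_of_ne h3), by linarith, ?_⟩
        have : (⌊t⌋₊ : ℝ) < L := (h1.lt_of_ne h3).trans_le htL.2
        exact_mod_cast this
      rw [piecewiseAffine_eq hk h0 h1]
      by_cases hspan : SpansUnit I p b F k
      · right
        rw [h.faceSlice_interpolate hv hk h0 h1 hspan]
        simp only [hu, hw, if_pos hspan]
        exact ((hslice k hk.le hspan.1).smul (by linarith)).add ((hslice (k + 1) hk hspan.2).smul h0)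
      · left
        simp only [hu, hw, if_neg hspan, mul_zero, add_zero, and_true]
        by_contra hne'
        exact hspan (h.spansUnit hv hk h0 h1 (Set.nonempty_iff_ne_empty.2 hne'))
    · left
      refine ⟨?_, piecewiseAffine_eq_zero htL⟩
      rw [Set.eq_empty_iff_forall_notMem]
      intro x hx
      exact htL ((glue_mem_edgePart h.prim).1 (hsub hx)).1
  have hproj : ∀ z ∈ F, ∃ t : ℝ, projAlong I z = intVec p + t • intVec b := fun z hz => by
    obtain ⟨t, -, ht⟩ := (hsub hz).2
    exact ⟨t, ht.symm⟩
  rw [hbasis.pushIndex_eq h.prim, hbasis.index_mul_latticeVolume_eq h.prim hcomp.isClosed hne hdim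
    hproj hae, lintegral_piecewiseAffine hu0 hw0, Finset.sum_filter]
  refine Finset.sum_congr rfl fun k _ => ?_
  simp only [hu, hw]
  split_ifs
  · rfl
  · exact add_zero _

theorem IsEdgeParam.finrank_map_projAlong (h : IsEdgeParam I A p b L) {F : Set (Fin n → ℝ)}
    (hF : F ⊆ edgePart I A p b L) {k : ℕ} (hspan : SpansUnit I p b F k) :
    Module.finrank ℝ ((vectorSpan ℝ F).map (projAlongLin I)) = 1 := by
  have : (vectorSpan ℝ F).map (projAlongLin I) = Submodule.span ℝ {intVec b} := by
    refine le_antisymm ?_ ?_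
    · rintro _ ⟨x, hx, rfl⟩
      obtain ⟨t, ht⟩ := projAlong_of_mem_vectorSpan hF hx
      exact Submodule.mem_span_singleton.2 ⟨t, ht.symm⟩
    · rw [Submodule.span_singleton_le_iff_mem]
      obtain ⟨⟨x, hx⟩, ⟨u, hu⟩⟩ := hspan
      refine ⟨_, vsub_mem_vectorSpan ℝ (show _ ∈ F from hu) (show _ ∈ F from hx), ?_⟩
      rw [vsub_eq_sub, map_sub]
      change projAlong I (glue I u _) - projAlong I (glue I x _) = _
      rw [projAlong_glue, projAlong_glue]
      push_cast
      module
  rw [this, finrank_span_singleton h.prim.ne_zero]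

theorem IsEdgeParam.exists_spansUnit (h : IsEdgeParam I A p b L) (hv : projTo I v = y)
    (hdim : dimOf (supportFace (edgePart I A p b L) v) = 2)
    (hinner : Module.finrank ℝ (innerPart I (vectorSpan ℝ (supportFace (edgePart I A p b L) v))) =
      1) : ∃ k < L, SpansUnit I p b (supportFace (edgePart I A p b L) v) k := by
  set F := supportFace (edgePart I A p b L) v with hF
  have hsub : F ⊆ edgePart I A p b L := fun z hz => hz.1
  -- two points of the face over different points of the edge
  obtain ⟨i, hi, x, hx, j, u, hu, hij⟩ : ∃ i ∈ Set.Icc (0 : ℝ) L, ∃ x ∈ faceSlice I p b F i,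
      ∃ j : ℝ, ∃ u ∈ faceSlice I p b F j, i < j := by
    by_contra! hno
    have hker : vectorSpan ℝ F ≤ LinearMap.ker (projAlongLin I) := by
      rw [vectorSpan_def, Submodule.span_le]
      rintro _ ⟨z, hz, w, hw, rfl⟩
      obtain ⟨s, hs, x, hx, rfl⟩ := exists_of_mem_edgePart (hsub hz)
      obtain ⟨t, ht, u, hu, rfl⟩ := exists_of_mem_edgePart (hsub hw)
      obtain rfl : s = t := le_antisymm (hno t ht u hw s x hz) (hno s hs x hz t u hw)
      change projAlong I (glue I x _) - projAlong I (glue I u _) = 0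
      rw [projAlong_glue, projAlong_glue, sub_self]
    have h1 := finrank_inf_ker_projAlongLin (I := I) (vectorSpan ℝ F)
    rw [inf_eq_left.2 hker, hinner] at h1
    have h2 : Module.finrank ℝ (vectorSpan ℝ F) = 2 := hdim
    omega
  have hj := ((glue_mem_edgePart h.prim).1 (hsub hu)).1
  have h1 := Nat.floor_le hi.1
  have h2 := Nat.lt_floor_add_one i
  have hkL : ⌊i⌋₊ < L := by
    have : (⌊i⌋₊ : ℝ) < L := h1.trans_lt (hij.trans_le hj.2)
    exact_mod_cast this
  refine ⟨⌊i⌋₊, hkL, ?_⟩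
  -- a point strictly between the two points and inside the unit segment that starts at `⌊i⌋₊`
  obtain ⟨t, ht1, ht2⟩ := exists_between (lt_min hij h2)
  have ht3 := ht2.trans_le (min_le_left _ _)
  have ht4 := ht2.trans_le (min_le_right _ _)
  refine h.spansUnit hv hkL (τ := t - ⌊i⌋₊) (by linarith) (by linarith) ?_
  rw [add_sub_cancel]
  have hpos : 0 < j - i := by linarith
  have := faceSlice_combo (convex_supportFace convex_edgePart v)
    (s := (j - t) / (j - i)) (t := (t - i) / (j - i)) (div_nonneg (by linarith) hpos.le)
    (div_nonneg (by linarith) hpos.le) (by field_simp; ring) hx hu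
  have e : (j - t) / (j - i) * i + (t - i) / (j - i) * j = t := by
    field_simp
    ring
  rw [e] at this
  exact ⟨_, this⟩

/-- A covector `y` on `ℝ^I` is generic if it does not annihilate the directions of `ℝ^I` parallel to the
span of any set of points of `A` for which these directions form a space of dimension at least
two. -/
def IsGenericFor (I : Finset (Fin n)) (A : Finset (Fin n → ℕ)) (y : {i // i ∈ I} → ℝ) : Prop :=
  ∀ D ⊆ natPts A, (∀ x ∈ innerPart I (vectorSpan ℝ D), y ⬝ᵥ x = 0) →
    Module.finrank ℝ (innerPart I (vectorSpan ℝ D)) ≤ 1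

theorem IsEdgeParam.finrank_innerPart_le (h : IsEdgeParam I A p b L) (hy : ∀ i, 0 < y i)
    (hgen : IsGenericFor I A y) (hv : projTo I v = y) :
    Module.finrank ℝ (innerPart I (vectorSpan ℝ (supportFace (edgePart I A p b L) v))) ≤ 1 := by
  obtain ⟨D, hD, hFD⟩ := h.exists_eq_convexHull hy hv
  have hspan : vectorSpan ℝ (supportFace (edgePart I A p b L) v) = vectorSpan ℝ D := by
    rw [hFD, vectorSpan_convexHull]
  rw [hspan]
  refine hgen D hD fun x hx => ?_
  have hx' : glue I x 0 ∈ vectorSpan ℝ (supportFace (edgePart I A p b L) v) := by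
    rw [hspan]
    exact hx
  have := vectorSpan_supportFace hx'
  rwa [dotProduct_proj (I := I), projTo_glue, projAlong_glue, hv, dotProduct_zero, add_zero] at this

/-- The weight of an edge at a generic covector is the trapezoid sum of the lattice lengths of the
support faces of the fibers: each unit segment with a non-zero contribution is spanned by exactly one
of the faces. -/
theorem IsEdgeParam.pushDualFan_eq (h : IsEdgeParam I A p b L) (hy : ∀ i, 0 < y i)
    (hgen : IsGenericFor I A y) : pushDualFan I (edgePart I A p b L) 2 y =
      ∑ k ∈ Finset.range L, (fiberLength I A p b y k + fiberLength I A p b y (k + 1)) := by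
  classical
  obtain ⟨c, hc⟩ := id h.prim
  have hy0 : ∀ i, 0 ≤ y i := fun i => (hy i).le
  have hdimΓ : dimOf (edgePart I A p b L) = I.card + 1 := by
    rw [edgePart, dimOf_overFace, h.edge.2.2]
    · exact h.edge.1.1
    · obtain ⟨-, u, hu⟩ := h.edge.1
      rw [hu]
      exact fun x hx => hx.1
  set E : Set (Set (Fin n → ℝ)) := {F : Set (Fin n → ℝ) | Bornology.IsBounded F ∧ dimOf F = 2 ∧
        (∃ v : Fin n → ℝ, projTo I v = y ∧ F.Nonempty ∧ F = supportFace (edgePart I A p b L) v) ∧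
        Module.finrank ℝ (Submodule.map (projTo I) (normalSpan F)) + 2 =
          dimOf (edgePart I A p b L)} with hE
  have hrank : ∀ F : Set (Fin n → ℝ), Module.finrank ℝ (Submodule.map (projTo I) (normalSpan F)) +
      2 = dimOf (edgePart I A p b L) ↔ Module.finrank ℝ (innerPart I (vectorSpan ℝ F)) = 1 := by
    intro F
    have := finrank_map_normalSpan (I := I) F
    omega
  set Φ : ℕ → Set (Fin n → ℝ) := unitFace I A p b c L hy0 with hΦ
  set K : Finset ℕ := {k ∈ Finset.range L | Φ k ∈ E} with hK
  have hEK : E = ((K.image Φ : Finset (Set (Fin n → ℝ))) : Set (Set (Fin n → ℝ))) := by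
    ext F
    simp only [Finset.coe_image, Set.mem_image, Finset.mem_coe]
    constructor
    · intro hF
      obtain ⟨-, hdim, ⟨v, hv, -, hFv⟩, hr⟩ := id hF
      rw [hrank] at hr
      rw [hFv] at hdim hr
      obtain ⟨k, hk, hspan⟩ := h.exists_spansUnit hv hdim hr
      have heq : F = Φ k := hFv.trans (h.eq_unitFace hc hy0 hv hk hspan)
      exact ⟨k, Finset.mem_filter.2 ⟨Finset.mem_range.2 hk, heq ▸ hF⟩, heq.symm⟩
    · rintro ⟨k, hk, rfl⟩
      exact (Finset.mem_filter.1 hk).2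
  have hsum : pushDualFan I (edgePart I A p b L) 2 y = ∑ F ∈ K.image Φ,
      (pushIndex I F : ℝ) * latticeVolume F := by
    rw [pushDualFan, ← finsum_mem_coe_finset, ← hEK]
  rw [hsum, Finset.sum_image' (fun k => fiberLength I A p b y k + fiberLength I A p b y (k + 1))]
  · refine Finset.sum_subset (Finset.filter_subset _ _) fun k hk hkK => ?_
    by_contra hne
    have hk' := Finset.mem_range.1 hk
    refine hkK (Finset.mem_filter.2 ⟨hk, ?_⟩)
    have hv : projTo I (glue I y ((fiberMin I A p b hy0 k - fiberMin I A p b hy0 (k + 1)) •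
      intVec c)) = y := projTo_glue _ _
    have hspan := h.unitFace_spansUnit hc hy0 hk'
    obtain ⟨D, hD, hFD⟩ := h.exists_eq_convexHull hy hv
    have hle := h.finrank_innerPart_le hy hgen hv
    have hπ := h.finrank_map_projAlong (fun z hz => hz.1) hspan
    have hge : 1 ≤ Module.finrank ℝ (innerPart I (vectorSpan ℝ (Φ k))) := by
      -- a support face of positive length over an end of the unit segment
      have hlen : ∀ j : ℕ, fiberLength I A p b y j ≠ 0 → (faceSlice I p b (Φ k) j).Nonempty →
          1 ≤ Module.finrank ℝ (innerPart I (vectorSpan ℝ (Φ k))) := by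
        intro j hj hjne
        have hdim : dimOf (supportFace (edgeFiber I A p b j) y) = 1 := by
          by_contra hd
          exact hj (if_neg hd)
        rw [← hdim, ← faceSlice_eq h.prim hv hjne]
        exact Submodule.finrank_mono (vectorSpan_faceSlice_le _ _)
      by_cases h0 : fiberLength I A p b y k = 0
      · exact hlen (k + 1) (fun h1 => hne (by rw [h0, h1, add_zero])) hspan.2
      · exact hlen k h0 hspan.1
    have hone : Module.finrank ℝ (innerPart I (vectorSpan ℝ (Φ k))) = 1 := le_antisymm hle hge
    refine ⟨?_, ?_, ⟨_, hv, ?_, rfl⟩, (hrank _).2 hone⟩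
    · change Bornology.IsBounded (supportFace _ _)
      rw [hFD]
      exact (isCompact_convexHull_natPts hD).isBounded
    · have := finrank_map_add_finrank_inf_ker (projAlongLin I) (vectorSpan ℝ (Φ k))
      rw [finrank_inf_ker_projAlongLin, hone] at this
      rw [dimOf, ← this]
      exact congrArg (· + 1) hπ
    · obtain ⟨x, hx⟩ := hspan.1
      exact ⟨_, hx⟩
  · intro k hk
    obtain ⟨hkL, -, hdim, ⟨v, hv, hne, hFv⟩, hr⟩ := Finset.mem_filter.1 hk
    rw [hrank] at hr
    rw [hFv] at hdim hr hne
    have heq : Finset.filter (fun j => Φ j = Φ k) K = Finset.filter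
        (fun j => SpansUnit I p b (supportFace (edgePart I A p b L) v) j) (Finset.range L) := by
      ext j
      simp only [hK, Finset.mem_filter]
      constructor
      · rintro ⟨⟨hj, -⟩, hjk⟩
        refine ⟨hj, ?_⟩
        rw [← hFv, ← hjk]
        exact h.unitFace_spansUnit hc hy0 (Finset.mem_range.1 hj)
      · rintro ⟨hj, hspan⟩
        have hjk : Φ j = Φ k :=
          ((h.eq_unitFace hc hy0 hv (Finset.mem_range.1 hj) hspan).symm.trans hFv.symm)
        exact ⟨⟨hj, hjk ▸ (Finset.mem_filter.1 hk).2⟩, hjk⟩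
    rw [heq, hFv]
    exact h.pushIndex_mul_latticeVolume hy hv hne hdim hr

end EdgeWeight

/-! ### Vanishing of the tropical fan -/

section TropicalFan

open Filter Topology

variable {n : ℕ} {I : Finset (Fin n)} {A : Finset (Fin n → ℕ)} {m : ℕ}
  {y : {i // i ∈ I} → ℝ}

/-- The lattice length of the support face of the fiber over a lattice point. -/
noncomputable def pointLength (I : Finset (Fin n)) (A : Finset (Fin n → ℕ))
    (y : {i // i ∈ I} → ℝ) (a : {i // i ∉ I} → ℤ) : ℝ :=
  latticeLength (supportFace (fiberAt I (newtonPolyhedron A) (intVec a)) y)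

theorem pointLength_nonneg (a : {i // i ∉ I} → ℤ) : 0 ≤ pointLength I A y a :=
  latticeLength_nonneg _

theorem fiberLength_eq {p b : {i // i ∉ I} → ℤ} (k : ℕ) :
    fiberLength I A p b y k = pointLength I A y (p + k • b) := by
  rw [fiberLength, pointLength, edgeFiber, intVec_add_nsmul]

/-- The weights at a generic covector add up with the same multiplicities as the fibers in the
virtual polyhedron. -/
theorem tropicalWeight_eq_sum (hI : Iᶜ.card = 2) {S : Finset ({i // i ∉ I} → ℤ)}
    {c : ({i // i ∉ I} → ℤ) → ℕ}
    (hS : ∀ {M : Type} [AddCommGroup M] (φ : ({i // i ∉ I} → ℤ) → M),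
        ∑ᶠ B ∈ {B | IsContributing I (newtonPolyhedron A) m B},
          ((-1 : ℤ) ^ dimOf B) • trapezoidSum φ B = -∑ a ∈ S, c a • φ a)
    (hy : ∀ i, 0 < y i) (hgen : IsGenericFor I A y) :
    tropicalWeight I (newtonPolyhedron A) m y = -∑ a ∈ S, (c a : ℝ) * pointLength I A y a := by
  have h := hS (pointLength I A y)
  simp only [nsmul_eq_mul] at h
  rw [tropicalWeight_eq, ← h]
  refine finsum_mem_congr rfl fun B hB => ?_
  rw [zsmul_eq_mul]
  push_cast
  congr 1
  rcases IsContributing.cases hI hB with ⟨a, rfl, ha⟩ | ⟨p, b, L, hE, rfl⟩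
  · rw [dimOf_singleton, zero_add, pushDualFan_overFace_singleton ha hy, trapezoidSum_singleton]
    rfl
  · rw [hE.edge.2.2, trapezoidSum_segment _ hE.prim hE.pos]
    refine (hE.pushDualFan_eq hy hgen).trans (Finset.sum_congr rfl fun k _ => ?_)
    rw [fiberLength_eq, fiberLength_eq]

/-- The covectors which are not generic lie in finitely many subspaces of codimension two. -/
theorem exists_nongeneric (I : Finset (Fin n)) (A : Finset (Fin n → ℕ)) :
    ∃ T : Finset (Submodule ℝ ({i // i ∈ I} → ℝ)),
      (∀ V ∈ T, Module.finrank ℝ V + 1 < Fintype.card {i // i ∈ I}) ∧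
      ∀ y, (∀ V ∈ T, y ∉ V) → IsGenericFor I A y := by
  have hfin : {V | ∃ D ⊆ natPts A, 2 ≤ Module.finrank ℝ (innerPart I (vectorSpan ℝ D)) ∧
      orth (innerPart I (vectorSpan ℝ D)) = V}.Finite := by
    refine ((natPts_finite A).finite_subsets.image
      fun D => orth (innerPart I (vectorSpan ℝ D))).subset ?_
    rintro _ ⟨D, hD, -, rfl⟩
    exact ⟨D, hD, rfl⟩
  refine ⟨hfin.toFinset, fun V hV => ?_, fun y hy D hD hyD => ?_⟩
  · obtain ⟨D, hD, h2, rfl⟩ := hfin.mem_toFinset.1 hV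
    have := finrank_orth (innerPart I (vectorSpan ℝ D))
    omega
  · by_contra h
    exact hy _ (hfin.mem_toFinset.2 ⟨D, hD, by omega, rfl⟩) hyD

/-- A hyperplane is not covered by finitely many subspaces of codimension two. -/
theorem exists_mem_orth_notMem {κ : Type} [Fintype κ] {e : κ → ℝ} (he : e ≠ 0)
    (T : Finset (Submodule ℝ (κ → ℝ)))
    (hT : ∀ V ∈ T, Module.finrank ℝ V + 1 < Fintype.card κ) :
    ∃ u : κ → ℝ, u ⬝ᵥ e = 0 ∧ ∀ V ∈ T, u ∉ V := by
  classical
  set U := orth (Submodule.span ℝ {e}) with hU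
  have hUdim : Module.finrank ℝ U + 1 = Fintype.card κ := by
    rw [← finrank_orth (Submodule.span ℝ {e}), finrank_span_singleton he]
  have htop : (⊤ : Submodule ℝ U) ∉ T.image fun V => V.comap U.subtype := by
    intro h
    obtain ⟨V, hV, hVtop⟩ := Finset.mem_image.1 h
    have hle : U ≤ V := fun x hx => by
      have : (⟨x, hx⟩ : U) ∈ V.comap U.subtype := hVtop ▸ Submodule.mem_top
      exact this
    have := Submodule.finrank_mono hle
    have := hT V hV
    omega
  obtain ⟨⟨u, hu⟩, hnot⟩ := (Set.ne_univ_iff_exists_notMem _).1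
    (Subspace.biUnion_ne_univ_of_top_notMem htop)
  refine ⟨u, hu e (Submodule.mem_span_singleton_self e), fun V hV huV => hnot ?_⟩
  exact Set.mem_biUnion (Finset.mem_image_of_mem _ hV) huV

theorem eventually_notMem {κ : Type} {y u : κ → ℝ} {V : Submodule ℝ (κ → ℝ)} (hu : u ∉ V) :
    ∀ᶠ ε in 𝓝[>] (0 : ℝ), y + ε • u ∉ V := by
  by_cases h : ∃ ε₀ > (0 : ℝ), y + ε₀ • u ∈ V
  · obtain ⟨ε₀, h0, hmem⟩ := h
    filter_upwards [Ioo_mem_nhdsGT h0] with ε hε hεV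
    have h1 := V.sub_mem hmem hεV
    have h2 : y + ε₀ • u - (y + ε • u) = (ε₀ - ε) • u := by module
    rw [h2, V.smul_mem_iff (sub_pos.2 hε.2).ne'] at h1
    exact hu h1
  · filter_upwards [self_mem_nhdsWithin] with ε hε hεV
    exact h ⟨ε, hε, hεV⟩

/-- A one-dimensional support face persists under small perturbations of the covector in the
hyperplane orthogonal to the face. -/
theorem IsLocalPolyhedron.eventually_supportFace_eq {κ : Type} [Fintype κ] {P : Set (κ → ℝ)}
    (hP : IsLocalPolyhedron P) {y u p : κ → ℝ} {e : κ → ℤ} {l : ℝ} (hy : ∀ i, 0 < y i)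
    (hF : supportFace P y = latticeSegment p e l) (hu : u ⬝ᵥ intVec e = 0) :
    ∀ᶠ ε in 𝓝[>] (0 : ℝ), supportFace P (y + ε • u) = supportFace P y := by
  have hne := hP.supportFace_nonempty fun i => (hy i).le
  obtain ⟨S, hS, rfl⟩ := hP
  have hconv := supportFace_polyhedronOf (S := S) hy
  rw [hconv, convexHull_nonempty_iff] at hne
  obtain ⟨s₁, hs₁⟩ := hne
  have hconst : ∀ s ∈ supportFace (ratPts S) y, u ⬝ᵥ s = u ⬝ᵥ p := by
    intro s hs
    have : s ∈ latticeSegment p e l := by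
      rw [← hF, hconv]
      exact subset_convexHull _ _ hs
    obtain ⟨t, -, rfl⟩ := this
    rw [dotProduct_add, dotProduct_smul, hu, smul_zero, add_zero]
  have hface : ∀ s ∈ ratPts S, y ⬝ᵥ s = y ⬝ᵥ s₁ → s ∈ supportFace (ratPts S) y := fun s hs h =>
    ⟨hs, fun w hw => h.trans_le (hs₁.2 w hw)⟩
  filter_upwards [eventually_pos_perturb hy u, eventually_perturb (ratPts_finite S) (z := u)
    hs₁.2 fun s hs h => by rw [hconst s (hface s hs h), hconst s₁ hs₁]] with ε hpos hε
  rw [supportFace_polyhedronOf hpos, hconv]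
  congr 1
  ext s
  constructor
  · intro hs
    refine hface s hs.1 ((hε s hs.1).2 ?_).1
    exact le_antisymm (hs.2 s₁ hs₁.1) (hε s hs.1).1
  · intro hs
    refine ⟨hs.1, fun w hw => le_trans (le_of_eq ?_) (hε w hw).1⟩
    have h1 : y ⬝ᵥ s = y ⬝ᵥ s₁ := le_antisymm (hs.2 s₁ hs₁.1) (hs₁.2 s hs.1)
    rw [add_dotProduct, add_dotProduct, smul_dotProduct, smul_dotProduct, h1, hconst s hs,
      hconst s₁ hs₁]

/-- The tropical fan vanishes exactly when there is no special lattice point: at a generic covector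
its weight is a negative combination of the lattice lengths of the support faces of the fibers. -/
theorem not_isZeroFan_iff (hI : Iᶜ.card = 2)
    (h0 : (0 : {i // i ∉ I} → ℝ) ∉ projAlong I '' newtonPolyhedron A)
    (hnt : ∀ i ∉ I, coordOrder (newtonPolyhedron A) i ≠ 0 →
      ¬ m ∣ coordOrder (newtonPolyhedron A) i) :
    ¬ IsZeroFan (tropicalWeight I (newtonPolyhedron A) m) ↔
      HasSpecialPoint I (newtonPolyhedron A) m := by
  classical
  obtain ⟨S, c, hS, hc, hsum⟩ := exists_newton_multiplicity hI h0 hnt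
  obtain ⟨T₀, hT₀, hgen⟩ := exists_nongeneric I A
  rw [hasSpecialPoint_iff]
  refine ⟨fun h => ?_, ?_⟩
  · by_contra! hno
    refine h ⟨T₀, hT₀, fun y hy hw => ?_⟩
    by_contra! hyT
    rw [tropicalWeight_eq_sum hI hsum hy (hgen y hyT)] at hw
    refine hw (neg_eq_zero.2 (Finset.sum_eq_zero fun a ha => ?_))
    have ha := (hS a).1 ha
    have hloc := ha.isLocalPolyhedron
    rw [pointLength, latticeLength, if_neg, mul_zero]
    exact fun hdim => hno a ha ⟨_, ⟨hloc.supportFace_nonempty fun i => (hy i).le, y, rfl⟩,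
      (hloc.isCompact_supportFace hy).isBounded, hdim⟩
  · rintro ⟨a, ha, F, ⟨hne, y₀, rfl⟩, hb, hdim⟩ ⟨T', hT', hzero⟩
    have hloc := ha.isLocalPolyhedron
    have hy₀ : ∀ i, 0 < y₀ i := fun i => pos_of_supportFace_isBounded
      (fun x hx t ht => hloc.add_mem hx (single_mem_orthant ht)) hne hb
    obtain ⟨e, p, l, he, hl, hF⟩ := hloc.exists_latticeSegment hy₀ hdim
    obtain ⟨u, hue, huT⟩ := exists_mem_orth_notMem he.ne_zero (T₀ ∪ T') fun V hV =>
      (Finset.mem_union.1 hV).elim (hT₀ V) (hT' V)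
    have hev : ∀ᶠ ε in 𝓝[>] (0 : ℝ), ∀ V ∈ T₀ ∪ T', y₀ + ε • u ∉ V :=
      (Filter.eventually_all_finset _).2 fun V hV => eventually_notMem (huT V hV)
    obtain ⟨ε, ⟨hpos, hεT⟩, hεF⟩ := ((eventually_pos_perturb hy₀ u).and hev |>.and
      (hloc.eventually_supportFace_eq hy₀ hF hue)).exists
    obtain ⟨V, hV, hmem⟩ := hzero (y₀ + ε • u) hpos (by
      rw [tropicalWeight_eq_sum hI hsum hpos
        (hgen _ fun V hV => hεT V (Finset.mem_union_left _ hV))]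
      refine (neg_neg_of_pos (Finset.sum_pos' (fun x _ =>
        mul_nonneg (Nat.cast_nonneg _) (pointLength_nonneg x)) ⟨a, (hS a).2 ha, ?_⟩)).ne
      refine mul_pos (Nat.cast_pos.2 (hc a ((hS a).2 ha))) ?_
      rw [pointLength, hεF, hF, IsLatticeSegment.latticeLength_eq he ⟨hl.le, p, rfl⟩]
      exact hl)
    exact hεT V (Finset.mem_union_right _ hV) hmem

/-- The denominator of a root of unity is its order, so it is determined by the root. -/
theorem isTropicalNearbyEigenvalue_iff {N : Set (Fin n → ℝ)} (hm : 0 < m) {k : ℤ}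
    (hk : IsCoprime k (m : ℤ)) (hnt : IsNonTautological N m) :
    IsTropicalNearbyEigenvalue I N (Complex.exp (2 * Real.pi * Complex.I * k / m)) ↔
      ¬ IsZeroFan (tropicalWeight I N m) := by
  refine ⟨?_, fun h => ⟨k, m, hm, hk, rfl, hnt, h⟩⟩
  rintro ⟨k', m', hm', hk', heq, -, h⟩
  have h1 := Complex.isPrimitiveRoot_exp_of_isCoprime k m hm.ne' hk
  have h2 := Complex.isPrimitiveRoot_exp_of_isCoprime k' m' hm'.ne' hk'
  rw [← mul_div_assoc] at h1 h2
  rw [heq] at h1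
  rwa [h1.unique h2]

end TropicalFan

theorem mainTheorem6 (n : ℕ) (I : Finset (Fin n)) (hI : Iᶜ.card = 2)
    (A : Finset (Fin n → ℕ)) (hA : A.Nonempty) (m : ℕ) (hm : 0 < m)
    (h0 : (0 : {i // i ∉ I} → ℝ) ∉ projAlong I '' newtonPolyhedron A)
    (hnt : ∀ i ∉ I, coordOrder (newtonPolyhedron A) i ≠ 0 →
      ¬ m ∣ coordOrder (newtonPolyhedron A) i) :
    (∀ B, IsContributing I (newtonPolyhedron A) m B →
      IsLocalPolyhedron (fiberPolyhedron I (newtonPolyhedron A) B)) ∧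
    (-virtualPsi I (newtonPolyhedron A) m).IsPolyhedron ∧
    (¬ (virtualPsi I (newtonPolyhedron A) m).IsTrivial ↔
      HasSpecialPoint I (newtonPolyhedron A) m) ∧
    (∀ k : ℤ, IsCoprime k (m : ℤ) → IsNonTautological (newtonPolyhedron A) m →
      (IsTropicalNearbyEigenvalue I (newtonPolyhedron A)
          (Complex.exp (2 * Real.pi * Complex.I * k / m)) ↔
        HasSpecialPoint I (newtonPolyhedron A) m)) := by
  obtain ⟨S, c, -, -, hsum⟩ := exists_newton_multiplicity hI h0 hnt
  refine ⟨fun B hB => hB.isLocalPolyhedron hI, ⟨_, virtualPsi_eq hI hsum⟩,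
    virtualPsi_isTrivial_iff hI h0 hnt, fun k hk hm' => ?_⟩
  rw [isTropicalNearbyEigenvalue_iff hm hk hm']
  exact not_isZeroFan_iff hI h0 hnt
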